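/- Let $\mathbb{Z}^2$ denote the square lattice graph, whose vertices are the points of $\mathbb{Z}^2$ and in which two vertices are adjacent if and only if their $\ell^1$-distance is $1$. A bond percolation model on $\mathbb{Z}^2$ is a probability distribution on the spanning subgraphs of $\mathbb{Z}^2$; the edges present in the random subgraph are called open, the others closed, and an open component is a connected component of the random subgraph. The model is 1-independent if, for any two sets of edges $S_1$ and $S_2$ such that no edge in $S_1$ shares a vertex with an edge in $S_2$, the states (open or closed) of the edges in $S_1$ are independent of the states of the edges in $S_2$. Theorem. In every 1-independent bond percolation model on $\mathbb{Z}^2$ in which each edge is open with probability at least $0.8459$, the origin lies in an infinite open component with positive probability. -/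

import Mathlib

open MeasureTheory ProbabilityTheory

/-- The square lattice graph on `ℤ²`: two sites are adjacent when their `ℓ¹`-distance is one. -/
def squareLattice : SimpleGraph (ℤ × ℤ) where
  Adj u v := |u.1 - v.1| + |u.2 - v.2| = 1
  symm := ⟨fun u v h => by rwa [abs_sub_comm v.1, abs_sub_comm v.2]⟩
  loopless := ⟨fun u h => by simp at h⟩

namespace BondPercolation

variable {V : Type*}

/-- A configuration declares every edge of `G` open (`true`) or closed (`false`); configurations
are the spanning subgraphs of `G`. They carry the product σ-algebra. -/
abbrev Config (G : SimpleGraph V) : Type _ := G.edgeSet → Bool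

/-- The spanning subgraph of `G` whose edges are the open edges of `ω`. -/
def openGraph {G : SimpleGraph V} (ω : Config G) : SimpleGraph V where
  Adj u v := ∃ h : s(u, v) ∈ G.edgeSet, ω ⟨s(u, v), h⟩ = true
  symm := ⟨fun u v h => by rwa [Sym2.eq_swap]⟩
  loopless := ⟨fun _ h => G.irrefl h.1⟩

/-- The (vertex set of the) open component of the vertex `v` in the configuration `ω`. -/
def openCluster {G : SimpleGraph V} (ω : Config G) (v : V) : Set V :=
  ((openGraph ω).connectedComponentMk v).supp

/-- No edge of `S` shares a vertex with an edge of `T`. -/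
def VertexDisjoint {G : SimpleGraph V} (S T : Set G.edgeSet) : Prop :=
  ∀ e ∈ S, ∀ f ∈ T, ∀ v : V, v ∈ (e : Sym2 V) → v ∉ (f : Sym2 V)

/-- A measure on configurations is 1-independent if, for any two vertex-disjoint sets of edges
(finite or infinite), the states of the edges in one set are independent of the states of the
edges in the other. -/
def IsOneIndependent {G : SimpleGraph V} (μ : Measure (Config G)) : Prop :=
  ∀ S T : Set G.edgeSet, VertexDisjoint S T →
    IndepFun (fun (ω : Config G) (e : S) => ω e) (fun (ω : Config G) (e : T) => ω e) μ

/-- The class `𝒟_{≥ p}(G)` of 1-independent bond percolation models on `G` in which each edge is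
open with probability at least `p`. -/
structure IsModelGe (G : SimpleGraph V) (p : ℝ) (μ : Measure (Config G)) : Prop where
  isProbabilityMeasure : IsProbabilityMeasure μ
  oneIndependent : IsOneIndependent μ
  le_prob_open : ∀ e : G.edgeSet, p ≤ μ.real {ω | ω e = true}

/-- On a countable vertex set, "the open component of `v` is infinite" is an event. -/
theorem measurableSet_infinite_openCluster [Countable V] {G : SimpleGraph V} (v : V) :
    MeasurableSet {ω : Config G | (openCluster ω v).Infinite} := by
  have hadj : ∀ u w : V, MeasurableSet {ω : Config G | (openGraph ω).Adj u w} := by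
    intro u w
    by_cases h : s(u, w) ∈ G.edgeSet
    · have : {ω : Config G | (openGraph ω).Adj u w} =
          (fun ω : Config G => ω ⟨s(u, w), h⟩) ⁻¹' {true} := by
        ext ω
        exact ⟨fun h' => h'.2, fun h' => ⟨h, h'⟩⟩
      rw [this]
      exact measurable_pi_apply _ (measurableSet_singleton _)
    · have : {ω : Config G | (openGraph ω).Adj u w} = ∅ := by
        ext ω
        exact ⟨fun h' => h h'.1, fun h' => h'.elim⟩
      rw [this]
      exact MeasurableSet.empty
  have hchain : ∀ (l : List V) (u : V),
      MeasurableSet {ω : Config G | List.IsChain (openGraph ω).Adj (u :: l)} := by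
    intro l
    induction l with
    | nil => intro u; simp
    | cons w l ih =>
      intro u
      simp only [List.isChain_cons_cons]
      exact (hadj u w).inter (ih w)
  have hreach : ∀ w : V, MeasurableSet {ω : Config G | w ∈ openCluster ω v} := by
    intro w
    have : {ω : Config G | w ∈ openCluster ω v} =
        ⋃ l : List V, ⋃ _ : (v :: l).getLast (by simp) = w,
          {ω : Config G | List.IsChain (openGraph ω).Adj (v :: l)} := by
      ext ω
      simp only [openCluster, Set.mem_ofPred_eq, Set.mem_iUnion, exists_prop,
        SimpleGraph.ConnectedComponent.mem_supp_iff, SimpleGraph.ConnectedComponent.eq]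
      rw [SimpleGraph.reachable_comm, SimpleGraph.reachable_iff_reflTransGen]
      constructor
      · intro h
        obtain ⟨l, hl, hw⟩ := List.exists_isChain_cons_of_relationReflTransGen h
        exact ⟨l, hw, hl⟩
      · rintro ⟨l, hw, hl⟩
        exact List.relationReflTransGen_of_exists_isChain_cons l hl hw
    rw [this]
    exact MeasurableSet.iUnion fun l => MeasurableSet.iUnion fun _ => hchain l v
  have : {ω : Config G | (openCluster ω v).Infinite} =
      ⋂ F : Finset V, ⋃ w : V, ⋃ _ : w ∉ F, {ω : Config G | w ∈ openCluster ω v} := by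
    ext ω
    simp only [Set.mem_ofPred_eq, Set.mem_iInter, Set.mem_iUnion, exists_prop]
    constructor
    · intro h F
      obtain ⟨w, hw, hF⟩ := h.exists_notMem_finset F
      exact ⟨w, hF, hw⟩
    · intro h hfin
      obtain ⟨w, hF, hw⟩ := h hfin.toFinset
      exact hF (hfin.mem_toFinset.2 hw)
  rw [this]
  exact MeasurableSet.iInter fun F => MeasurableSet.iUnion fun w =>
    MeasurableSet.iUnion fun _ => hreach w

end BondPercolation

/-! The proof is a renormalization that stays inside the class of 1-independent models. Tile the
lattice by blocks of 2 × 3 sites. For each set of closed edges inside a block, a fixed table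
designates one nonempty open component of the block. Blocks are the sites of a new square lattice.
The edge between two adjacent blocks is closed when every link joining their designated components
is closed: three links are available horizontally, two vertically. The state of a block edge depends
only on edges within its two blocks, so vertex-disjoint families of block edges depend on edges
within disjoint sets of sites and the new model is again 1-independent (`RenormField.renorm`). An
open block edge joins the two designated components by open paths, so connections in the new model
are connections in the original one.

Two things have to be controlled. The first is the probability that a block edge is closed. If f ≥ 0
depends only on edges sharing no vertex with the edge k, and k is closed with probability at most q,
then 1-independence gives E[(1_{k closed} − q) f] ≤ 0 (`RenormField.isPairState`). Hence any
pointwise inequality 1_{block edge closed} ≤ V + Σ_k (1_{k closed} − q_k) f_k, with such f_k, proves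
that V bounds the probability. The right side is a dual solution of a linear program over the states
of a pair of blocks. A `Certificate` stores one in integers, and `Certificate.pointwise` and
`Certificate.integral_le` turn a successful check into the bound.

A direct inequality would range over all states of up to 17 edges, so a certificate is nested. For a
fixed set of links, the event that the designated component of a block avoids them is dominated by a
nonnegative combination of the events that fixed sets Q of links avoid them, the weights reading
only some edges of the block. This is done for each of the two blocks, and a last inequality is
needed only for states of the edges that the weights read, together with the links.

Six rounds with certificates bring the closing probabilities of horizontal and vertical edges from
(0.1541, 0.1541) to (0.04, 0.04). Three of the rounds end with a reflection in the diagonal, because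
vertical block edges have fewer links and the weaker direction is better placed horizontally. From
there no more data is needed: whenever a block edge is closed, one of at most 12 pairs of disjoint
edges is closed, so q becomes at most 12q² and the rates decay at least geometrically
(`RenormField.bound_renorm_sq`, `RenormField.percolates_of_bound`).

The second is the origin, which is the cell 4 of the block at the origin at every scale. If that
cell is always designated, the sets representing the origin form a strictly increasing sequence of
connected sets, and their union is infinite. The probability that the cell is not designated in a
given round is bounded by short closed configurations around it (`RenormField.real_lossEvent_le`).
Over all rounds these losses add up to at most 9/10, so the origin percolates with positive
probability. -/

namespace BondPercolation

/-! ### Combinatorics of a pair of adjacent blocks -/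

/-- The two cells joined by an edge of a block. -/
def edgeCells (e : ℕ) : ℕ × ℕ :=
  [(0, 3), (1, 4), (2, 5), (0, 1), (1, 2), (3, 4), (4, 5)].getD e (0, 0)

/-- The number of links between two blocks adjacent in direction `d`. -/
def numLinks (d : Bool) : ℕ := bif d then 2 else 3

/-- The cell of the first block at the `r`-th link. -/
def linkFst (d : Bool) (r : ℕ) : ℕ := bif d then 3 * r + 2 else 3 + r

/-- The cell of the second block at the `r`-th link. -/
def linkSnd (d : Bool) (r : ℕ) : ℕ := bif d then 3 * r else r

/-- Edges of a pair of blocks: `0, …, 6` in the first block, `7, 8, 9` the links and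
`10, …, 16` in the second block. The cells of the second block are `6, …, 11`. -/
def pairCells (d : Bool) (k : ℕ) : ℕ × ℕ :=
  bif Nat.blt k 7 then edgeCells k
  else bif Nat.blt k 10 then (linkFst d (k - 7), 6 + linkSnd d (k - 7))
  else (6 + (edgeCells (k - 10)).1, 6 + (edgeCells (k - 10)).2)

/-- Whether `k` is the number of an edge of a pair of blocks. -/
def isPairEdge (d : Bool) (k : ℕ) : Bool :=
  Nat.blt k 17 && !(d && Nat.beq k 9)

/-- Whether two edges of a pair of blocks have no common cell. -/
def pairDisjoint (d : Bool) (j k : ℕ) : Bool :=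
  !(Nat.beq (pairCells d j).1 (pairCells d k).1) && !(Nat.beq (pairCells d j).1 (pairCells d k).2) &&
  !(Nat.beq (pairCells d j).2 (pairCells d k).1) && !(Nat.beq (pairCells d j).2 (pairCells d k).2)

noncomputable section

/-- Sum of `f` over the numbers below `n`. -/
def sumTo (n : ℕ) (f : ℕ → ℕ) : ℕ := Nat.rec 0 (fun k s => Nat.add s (f k)) n

/-- Whether `p` holds for all numbers below `n`. -/
def allTo (n : ℕ) (p : ℕ → Bool) : Bool := Nat.rec true (fun k s => and (p k) s) n

/-- The set of the edges of the pair of blocks, as a bit mask. -/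
def pairMask (d : Bool) : ℕ := sumTo 17 fun j => bif isPairEdge d j then 2 ^ j else 0

/-- The set of edges having no cell in common with the edge `k`, as a bit mask. -/
def disjointMask (d : Bool) (k : ℕ) : ℕ :=
  sumTo 17 fun j => bif isPairEdge d j && pairDisjoint d j k then 2 ^ j else 0

theorem sumTo_eq (n : ℕ) (f : ℕ → ℕ) : sumTo n f = ∑ i ∈ Finset.range n, f i := by
  induction n with
  | zero => rfl
  | succ n ih => rw [Finset.sum_range_succ, ← ih]; rfl

theorem allTo_iff (n : ℕ) (p : ℕ → Bool) : allTo n p = true ↔ ∀ i < n, p i = true := by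
  induction n with
  | zero => simp [allTo]
  | succ n ih =>
    have h : allTo (n + 1) p = (p n && allTo n p) := rfl
    rw [h, Bool.and_eq_true, ih]
    constructor
    · rintro ⟨h1, h2⟩ i hi
      rcases Nat.lt_succ_iff_lt_or_eq.1 hi with h | rfl
      · exact h2 i h
      · exact h1
    · exact fun h => ⟨h n (Nat.lt_succ_self n), fun i hi => h i (Nat.lt_succ_of_lt hi)⟩

/-- The cells of the designated open component of a block,
for the set `a` of closed edges. -/
def designated (a : ℕ) : ℕ := Nat.mod (Nat.shiftRight 0x8094929249240cb4db90b4db1895969a6db61cf5df9efdff61969b91969b61b6db91b6db61979f9a6fbf1df7df9fffffc30cb2d34db6c0bcfbd34dffc30db6db6db61cfdffdffdffe39ebbf3dfbfe3befbf3ffffe39fbffbffbfe3ffffffffff (Nat.mul 6 a)) 64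

/-- The links at which the designated component of the first block arrives. -/
def linksFst (d : Bool) (a : ℕ) : ℕ :=
  bif d then Nat.add (Nat.mod (Nat.shiftRight (designated a) 2) 2)
    (Nat.mul 2 (Nat.mod (Nat.shiftRight (designated a) 5) 2))
  else Nat.shiftRight (designated a) 3

/-- The links at which the designated component of the second block arrives. -/
def linksSnd (d : Bool) (b : ℕ) : ℕ :=
  bif d then Nat.add (Nat.mod (designated b) 2)
    (Nat.mul 2 (Nat.mod (Nat.shiftRight (designated b) 3) 2))
  else Nat.mod (designated b) 8

/-! ### Certificates -/

/-- Evaluates `n` before applying `f`. -/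
def force {α : Type} (n : ℕ) (f : ℕ → α) : α :=
  Nat.rec (f 0) (fun k _ => f (Nat.succ k)) n

theorem force_eq {α : Type} (n : ℕ) (f : ℕ → α) : force n f = f n := by
  cases n <;> rfl

/-- The `i`-th entry of the table `T` with entries of `f` bits. -/
def entry (f T i : ℕ) : ℕ := Nat.mod (Nat.shiftRight T (Nat.mul f i)) (Nat.pow 2 f)

/-- A list of weighted tests: each has an edge, a mask, a coefficient and a table. -/
inductive Tests where
  | nil : Tests
  | cons (k m n T : ℕ) (t : Tests) : Tests

/-- The value at the state `s` of the table `T`, which reads only the bits of `s` in `m`. -/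
def tableVal (T m s : ℕ) : ℕ :=
  entry 14 (entry 1792 T (Nat.land (Nat.shiftRight s 7) (Nat.shiftRight m 7)))
    (Nat.land (Nat.mod s 128) (Nat.mod m 128))

/-- The bit of `s` at position `k`, as a number. -/
def bitAt (s k : ℕ) : ℕ := Nat.mod (Nat.shiftRight s k) 2

namespace Tests

/-- Weighted sum of the table values. -/
def weight (s : ℕ) : Tests → ℕ
  | nil => 0
  | cons _ m n T t => n * tableVal T m s + weight s t

/-- Sum of the table values of the tests whose edge is closed. -/
def closed (s : ℕ) : Tests → ℕ
  | nil => 0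
  | cons k m _ T t => bitAt s k * tableVal T m s + closed s t

/-- Evaluates all fields. -/
def eval (t : Tests) : (Tests → Bool) → Bool :=
  Tests.rec (fun f => f nil) (fun k m n T _ ih f =>
    force k fun k => force m fun m => force n fun n => force T fun T =>
      ih fun t => f (cons k m n T t)) t

theorem eval_eq (t : Tests) (f : Tests → Bool) : t.eval f = f t := by
  induction t generalizing f with
  | nil => rfl
  | cons k m n T t ih =>
    change (force k fun k => force m fun m => force n fun n => force T fun T =>
      t.eval fun t => f (cons k m n T t)) = _
    simp only [force_eq, ih]

/-- Restricts the tables to the states whose higher bits are given by `h`. -/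
def row (h : ℕ) (t : Tests) : Tests :=
  Tests.rec nil (fun k m n T _ ih =>
    cons k (Nat.mod m 128) n (entry 1792 T (Nat.land h (Nat.shiftRight m 7))) ih) t

/-- Compares two sums of values of restricted tables. -/
def compare (t : Tests) : (c x y s a l r : ℕ) → Bool :=
  Tests.rec (fun c x y _ _ l r =>
      Nat.ble (Nat.add y (Nat.mul c l)) (Nat.add x (Nat.mul (Nat.mul 10000 c) r)))
    (fun k m n T _ ih c x y s a l r =>
      ih c x y s a (Nat.add l (Nat.mul n (entry 14 T (Nat.land a m))))
        (Nat.add r (Nat.mul (bitAt s k) (entry 14 T (Nat.land a m))))) t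

/-- A table lookup factors through the splitting of a state as `a + 128 * h`: the row selected by
`h` is extracted once and serves all 128 values of `a`. The arguments `l` and `r` are accumulators,
so the induction runs over all their values. -/
theorem compare_row (t : Tests) (c x y h a l r : ℕ) (ha : a < 128)
    (hc : (t.row h).compare c x y (a + 128 * h) a l r = true) :
    y + c * (l + t.weight (a + 128 * h)) ≤ x + 10000 * c * (r + t.closed (a + 128 * h)) := by
  induction t generalizing l r with
  | nil => exact Nat.le_of_ble_eq_true hc
  | cons k m n T t ih =>
    have hv : tableVal T m (a + 128 * h) =
        entry 14 (entry 1792 T (Nat.land h (Nat.shiftRight m 7))) (Nat.land a (Nat.mod m 128)) := by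
      have h1 : Nat.shiftRight (a + 128 * h) 7 = h := by
        change (a + 128 * h) >>> 7 = h
        rw [Nat.shiftRight_eq_div_pow]; omega
      have h2 : Nat.mod (a + 128 * h) 128 = a := by
        change (a + 128 * h) % 128 = a
        omega
      rw [tableVal, h1, h2]
    have := ih _ _ hc
    rw [weight, closed, hv]
    convert this using 3
    · simp only [Nat.add_eq, Nat.mul_eq]; ring
    · simp only [Nat.add_eq, Nat.mul_eq]; ring

end Tests

/-- Spreads out a table indexed by the bits in the list `ps` (highest first). -/
def spread (f : ℕ) (ps : List (ℕ × ℕ)) : ℕ → ℕ :=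
  List.rec (fun T => T) (fun p _ ih T =>
    force (Nat.shiftRight T p.2) fun hi => force (Nat.mod T (Nat.pow 2 p.2)) fun lo =>
      Nat.add (ih lo) (Nat.shiftLeft (ih hi) (Nat.mul f (Nat.pow 2 p.1)))) ps

/-- The positions of the bits of `m`, highest first, with the sizes of the tables for the bits
below. -/
def bitList (f m : ℕ) : ℕ → List (ℕ × ℕ) × ℕ :=
  fun n => Nat.rec ([], f) (fun k l =>
    bif Nat.beq (bitAt m k) 1 then ((k, l.2) :: l.1, Nat.mul 2 l.2) else l) n

/-- The table with entries of `f` bits, indexed by the bits in `m`. -/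
def unpack (f m T : ℕ) : ℕ := spread f (bitList f m 17).1 T

/-- The tests given by a list of edges and packed tables. -/
def Tests.ofList (key mask coeff : ℕ → ℕ) (l : List (ℕ × ℕ)) : Tests :=
  List.rec .nil (fun p _ ih =>
    .cons p.1 (mask p.1) (coeff p.1) (unpack 14 (key p.1) p.2) ih) l

/-- Conditional sum of the entries of a row of weights. -/
def rowSum (n w R : ℕ) : ℕ :=
  sumTo n fun Q => bif Nat.beq (Nat.land Q R) 0 then entry 16 w Q else 0

/-- Whether the indicator of `links a &&& R = 0` is dominated by the row sums. -/
def innerCheck (n : ℕ) (links : ℕ → ℕ) (om W : ℕ) (t : Tests) : Bool :=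
  t.eval fun t => force W fun W => force om fun om =>
  allTo n fun R => (t.row R).eval fun t => allTo 128 fun a =>
    t.compare 1 (Nat.mul 10000 (rowSum n (entry 128 W (Nat.land a om)) R))
      (bif Nat.beq (Nat.land (links a) R) 0 then 100000000 else 0)
      (Nat.add a (Nat.mul 128 R)) a 0 0

/-- Inner product of a list with a row of weights. -/
def dot (l : List ℕ) : ℕ → ℕ :=
  List.rec (fun _ => 0) (fun x _ ih w =>
    Nat.add (Nat.mul x (Nat.mod w 65536)) (ih (Nat.shiftRight w 16))) l

/-- The list of the values of `f` at `i, …, i + n - 1`, evaluated. -/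
def evalList {α : Type} (f : ℕ → ℕ) (n : ℕ) : ℕ → (List ℕ → α) → α :=
  Nat.rec (fun _ g => g [])
    (fun _ ih i g => force (f i) fun x => ih (Nat.succ i) fun l => g (x :: l)) n

/-- Whether the combined row sums are dominated, for all states in `om`. -/
def outerCheck (n om WA WB V c : ℕ) (t : Tests) : Bool :=
  t.eval fun t => force WA fun WA => force WB fun WB =>
  force (Nat.mod om 128) fun oa => force (Nat.shiftRight om 7) fun oh =>
  allTo 1024 fun h => bif Nat.beq (Nat.land h oh) h then
    (t.row h).eval fun t => force (entry 128 WB (Nat.shiftRight h 3)) fun w =>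
    force (Nat.xor (Nat.sub n 1) (Nat.mod h 8)) fun U =>
    evalList (fun Q => rowSum n w (Nat.land U Q)) n 0 fun l =>
    allTo 128 fun a => bif Nat.beq (Nat.land a oa) a then
      force (Nat.add a (Nat.mul 128 h)) fun s =>
      t.compare c (Nat.mul 10000 V) (Nat.mul 10000 (dot l (entry 128 WA a))) s a 0 0
    else true
  else true

/-- A certificate for the renormalization of the edges in one direction. -/
structure Certificate where
  outer : ℕ
  weightsFst : ℕ
  weightsSnd : ℕ
  testsFst : List (ℕ × ℕ)
  testsSnd : List (ℕ × ℕ)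
  tests : List (ℕ × ℕ)
  scale : ℕ
  value : ℕ

/-- The bound for the edge `k` of a pair of blocks. -/
def edgeBound (d : Bool) (nh nv k : ℕ) : ℕ :=
  bif Nat.blt k 3 then nh else bif Nat.blt k 7 then nv
  else bif Nat.blt k 10 then (bif d then nv else nh) else bif Nat.blt k 13 then nh else nv

namespace Certificate

variable (C : Certificate) (d : Bool) (nh nv : ℕ)

/-- The weights of the first block. -/
def wFst : ℕ := unpack 128 (Nat.mod C.outer 128) C.weightsFst

/-- The weights of the second block. -/
def wSnd : ℕ := unpack 128 (Nat.shiftRight C.outer 10) C.weightsSnd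

/-- The mask of the test of an edge of the first block. -/
def maskFst (e : ℕ) : ℕ := Nat.mod (disjointMask d e) 1024

/-- The mask of the test of an edge of the second block, with the links after the edges. -/
def maskSnd (e : ℕ) : ℕ :=
  Nat.add (Nat.shiftRight (disjointMask d (Nat.add 10 e)) 10)
    (Nat.mul 128 (Nat.mod (Nat.shiftRight (disjointMask d (Nat.add 10 e)) 7) 8))

/-- The tests of the first block. -/
def tFst : Tests := .ofList (maskFst d) (maskFst d) (edgeBound d nh nv) C.testsFst

/-- The tests of the second block. -/
def tSnd : Tests := .ofList (maskSnd d) (maskSnd d) (edgeBound d nh nv) C.testsSnd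

/-- The tests of the pair of blocks. -/
def tOut : Tests :=
  .ofList (fun k => Nat.land (disjointMask d k) C.outer) (disjointMask d) (edgeBound d nh nv) C.tests

/-- Whether the certificate is valid. -/
def check : Bool :=
  (C.testsFst.all fun p => Nat.blt p.1 7) && (C.testsSnd.all fun p => Nat.blt p.1 7) &&
  (C.tests.all fun p => isPairEdge d p.1 && Nat.beq (bitAt C.outer p.1) 1) &&
  Nat.beq (Nat.mod (Nat.shiftRight C.outer 7) 8) (Nat.sub (2 ^ numLinks d) 1) &&
  innerCheck (2 ^ numLinks d) (linksFst d) (Nat.mod C.outer 128) C.wFst (C.tFst d nh nv) &&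
  innerCheck (2 ^ numLinks d) (linksSnd d) (Nat.shiftRight C.outer 10) C.wSnd (C.tSnd d nh nv) &&
  outerCheck (2 ^ numLinks d) C.outer C.wFst C.wSnd C.value C.scale (C.tOut d nh nv)

end Certificate

end

/-! ### What a successful check asserts -/

/-- A table reads the state only through its mask. This is what makes its value a function of edges
disjoint from the tested edge once the mask consists of such edges. -/
theorem tableVal_congr {m z z' : ℕ} (T : ℕ) (h : z &&& m = z' &&& m) :
    tableVal T m z = tableVal T m z' := by
  have key : ∀ z : ℕ, tableVal T m z =
      entry 14 (entry 1792 T ((z &&& m) >>> 7)) ((z &&& m) % 128) := by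
    intro z
    have h1 : (z &&& m) >>> 7 = Nat.land (Nat.shiftRight z 7) (Nat.shiftRight m 7) :=
      Nat.shiftRight_and_distrib
    have h2 : (z &&& m) % 128 = Nat.land (Nat.mod z 128) (Nat.mod m 128) :=
      Nat.and_mod_two_pow (n := 7)
    rw [h1, h2, tableVal]
  rw [key, key, h]

theorem evalList_eq {α : Type} (f : ℕ → ℕ) (n i : ℕ) (g : List ℕ → α) :
    evalList f n i g = g ((List.range' i n).map f) := by
  induction n generalizing i g with
  | zero => rfl
  | succ n ih =>
    change (force (f i) fun x => evalList f n (Nat.succ i) fun l => g (x :: l)) = _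
    rw [force_eq, ih]
    simp [List.range'_succ]

theorem entry_succ (f T i : ℕ) : entry f T (i + 1) = entry f (T >>> f) i := by
  simp only [entry, Nat.mul_eq]
  change T >>> (f * (i + 1)) % _ = T >>> f >>> (f * i) % _
  rw [← Nat.shiftRight_add, mul_add, mul_one, add_comm]

theorem dot_map (f : ℕ → ℕ) (n i w : ℕ) :
    dot ((List.range' i n).map f) w = ∑ Q ∈ Finset.range n, f (i + Q) * entry 16 w Q := by
  induction n generalizing i w with
  | zero => rfl
  | succ n ih =>
    rw [List.range'_succ, List.map_cons, Finset.sum_range_succ']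
    change f i * (w % 65536) + dot ((List.range' (i + 1) n).map f) (w >>> 16) = _
    rw [ih, add_comm]
    congr 1
    refine Finset.sum_congr rfl fun Q _ => ?_
    rw [entry_succ, add_assoc, add_comm 1]

theorem rowSum_eq (n w R : ℕ) :
    rowSum n w R = ∑ Q ∈ Finset.range n, if Q &&& R = 0 then entry 16 w Q else 0 := by
  rw [rowSum, sumTo_eq]
  refine Finset.sum_congr rfl fun Q _ => ?_
  by_cases h : Q &&& R = 0
  · have : Nat.beq (Nat.land Q R) 0 = true := Nat.beq_eq ▸ h
    rw [this, if_pos h]; rfl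
  · have : Nat.beq (Nat.land Q R) 0 = false := by
      rw [← Bool.not_eq_true, Nat.beq_eq]; exact h
    rw [this, if_neg h]; rfl

/-- Divided by 10⁸ this reads 1[links ∩ R = ∅] ≤ Σ_Q w_Q 1[Q ∩ R = ∅] + Σ_e (1_{e closed} − q_e)
f_e, with weights and tables in units of 10⁻⁴ and with test coefficients equal to 10⁴ q_e. Up to
tests, a block can thus be replaced by a weighted family of fixed link sets whose weights read only
the edges in `om`. -/
theorem innerCheck_spec {n om W : ℕ} {links : ℕ → ℕ} {t : Tests}
    (h : innerCheck n links om W t = true) {R a : ℕ} (hR : R < n) (ha : a < 128) :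
    (if links a &&& R = 0 then 100000000 else 0) + t.weight (a + 128 * R) ≤
      10000 * rowSum n (entry 128 W (a &&& om)) R + 10000 * t.closed (a + 128 * R) := by
  simp only [innerCheck, Tests.eval_eq, force_eq, allTo_iff] at h
  have := Tests.compare_row t _ _ _ R a 0 0 ha (h R hR a ha)
  have hb : (bif Nat.beq (Nat.land (links a) R) 0 then 100000000 else 0) =
      if links a &&& R = 0 then 100000000 else 0 := by
    by_cases h : links a &&& R = 0
    · have : Nat.beq (Nat.land (links a) R) 0 = true := Nat.beq_eq ▸ h
      rw [this, if_pos h]; rfl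
    · have : Nat.beq (Nat.land (links a) R) 0 = false := by
        rw [← Bool.not_eq_true, Nat.beq_eq]; exact h
      rw [this, if_neg h]; rfl
  rw [hb] at this
  simpa using this

/-- After both replacements nothing depends on edges outside `om`, so only states contained in `om`
occur. The inner `rowSum` is the replacement of the second block against the open links in Q, and
the outer sum is the replacement of the first block. -/
theorem outerCheck_spec {n om WA WB V c : ℕ} {t : Tests}
    (hc : outerCheck n om WA WB V c t = true) {h a : ℕ} (hh : h < 1024)
    (hho : h &&& om >>> 7 = h) (ha : a < 128) (hao : a &&& om % 128 = a) :
    10000 * (∑ Q ∈ Finset.range n,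
        rowSum n (entry 128 WB (h >>> 3)) (((n - 1) ^^^ (h % 8)) &&& Q) *
          entry 16 (entry 128 WA a) Q) + c * t.weight (a + 128 * h) ≤
      10000 * V + 10000 * c * t.closed (a + 128 * h) := by
  simp only [outerCheck, Tests.eval_eq, force_eq, allTo_iff] at hc
  have h1 := hc h hh
  have e1 : Nat.beq (Nat.land h (Nat.shiftRight om 7)) h = true := Nat.beq_eq ▸ hho
  rw [e1, cond_true, evalList_eq, allTo_iff] at h1
  have h2 := h1 a ha
  have e2 : Nat.beq (Nat.land a (Nat.mod om 128)) a = true := Nat.beq_eq ▸ hao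
  rw [e2, cond_true, dot_map] at h2
  have := Tests.compare_row t _ _ _ h a 0 0 ha h2
  simp only [zero_add, Nat.mul_eq] at this
  exact this

/-! ### Random states of a pair of blocks and their moment inequalities -/

/-- A block edge is closed when every link between the designated components is closed. -/
def pairClosed (d : Bool) (s : ℕ) : Prop :=
  linksFst d (s % 128) &&&
    (((2 ^ numLinks d - 1) ^^^ (s >>> 7 % 8)) &&& linksSnd d (s >>> 10)) = 0

instance (d : Bool) : DecidablePred (pairClosed d) := fun s => by
  unfold pairClosed; infer_instance

/-- A random set of closed edges of a pair of blocks, with the moment bounds that one-independence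
provides. -/
structure IsPairState {Ω : Type*} [MeasurableSpace Ω] (μ : Measure Ω) (d : Bool) (q : ℕ → ℝ)
    (S : Ω → ℕ) : Prop where
  measurable : Measurable S
  land_eq : ∀ ω, S ω &&& pairMask d = S ω
  integral_le : ∀ k, isPairEdge d k = true → ∀ f : ℕ → ℝ, (∀ s, 0 ≤ f s) →
    ∫ ω, ((bitAt (S ω) k : ℝ) - q k) *
      f (S ω &&& disjointMask d k) ∂μ ≤ 0

namespace IsPairState

variable {Ω : Type*} [MeasurableSpace Ω] {μ : Measure Ω} {d : Bool} {q : ℕ → ℝ} {S : Ω → ℕ}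

/-- A state is contained in `pairMask d`, hence takes finitely many values, and every function of it
is bounded. -/
theorem integrable [IsFiniteMeasure μ] (hS : IsPairState μ d q S) (f : ℕ → ℝ) :
    Integrable (fun ω => f (S ω)) μ := by
  refine Integrable.of_bound (C := ∑ s ∈ Finset.range (pairMask d + 1), |f s|)
    ((measurable_from_top (f := f)).comp hS.measurable).aestronglyMeasurable
    (Filter.Eventually.of_forall fun ω => ?_)
  refine Finset.single_le_sum (f := fun s => |f s|) (fun _ _ => abs_nonneg _) ?_
  rw [Finset.mem_range, Nat.lt_succ_iff, ← hS.land_eq ω]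
  exact Nat.and_le_right

/-- One statement serves the three families of tests of a certificate. The map `z` recodes a state
of the pair as the state that the tests see, and `e` translates their edge numbers into those of the
pair. The hypotheses `hz` and `hcz` say that neither the table value of a test nor the extra factor
`c` changes when the edges meeting the tested edge are erased, so their product is an admissible
nonnegative multiplier. -/
theorem tests_le [IsFiniteMeasure μ] (hS : IsPairState μ d q S)
    (key mask coeff e z : ℕ → ℕ) (c : ℕ → ℝ) (hc : ∀ s, 0 ≤ c s) (l : List (ℕ × ℕ))
    (he : ∀ p ∈ l, isPairEdge d (e p.1) = true)
    (hn : ∀ p ∈ l, (coeff p.1 : ℝ) = 10000 * q (e p.1))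
    (hb : ∀ p ∈ l, ∀ s, s &&& pairMask d = s → bitAt (z s) p.1 = bitAt s (e p.1))
    (hz : ∀ p ∈ l, ∀ s, s &&& pairMask d = s →
      z s &&& mask p.1 = z (s &&& disjointMask d (e p.1)) &&& mask p.1)
    (hcz : ∀ p ∈ l, ∀ s, s &&& pairMask d = s → c s = c (s &&& disjointMask d (e p.1))) :
    ∫ ω, c (S ω) * (10000 * ((Tests.ofList key mask coeff l).closed (z (S ω)) : ℝ) -
      (Tests.ofList key mask coeff l).weight (z (S ω))) ∂μ ≤ 0 := by
  induction l with
  | nil => simp [Tests.ofList, Tests.closed, Tests.weight]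
  | cons p l ih =>
    have ih' := ih (fun q hq => he q (List.mem_cons_of_mem _ hq))
      (fun q hq => hn q (List.mem_cons_of_mem _ hq)) (fun q hq => hb q (List.mem_cons_of_mem _ hq))
      (fun q hq => hz q (List.mem_cons_of_mem _ hq)) (fun q hq => hcz q (List.mem_cons_of_mem _ hq))
    have hp : p ∈ p :: l := List.mem_cons_self
    set T := unpack 14 (key p.1) p.2
    have hl : Tests.ofList key mask coeff (p :: l) =
      .cons p.1 (mask p.1) (coeff p.1) T (Tests.ofList key mask coeff l) := rfl
    -- The multiplier is evaluated at the masked state here; at the end `hcz` and `hz` identify it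
    -- with its value at the true state.
    have h1 := hS.integral_le (e p.1) (he p hp)
      (fun s => 10000 * (c s * tableVal T (mask p.1) (z s)))
      (fun s => mul_nonneg (by norm_num) (mul_nonneg (hc s) (Nat.cast_nonneg _)))
    have h2 := add_nonpos h1 ih'
    rw [← integral_add (hS.integrable fun s => ((bitAt s (e p.1) : ℝ) -
        q (e p.1)) * (10000 * (c (s &&& disjointMask d (e p.1)) *
          tableVal T (mask p.1) (z (s &&& disjointMask d (e p.1))))))
      (hS.integrable fun s => c s * (10000 * ((Tests.ofList key mask coeff l).closed (z s) : ℝ) -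
      (Tests.ofList key mask coeff l).weight (z s)))] at h2
    refine le_of_eq_of_le (integral_congr_ae (Filter.Eventually.of_forall fun ω => ?_)) h2
    have hs := hS.land_eq ω
    simp only [hl, Tests.closed, Tests.weight]
    rw [hb p hp _ hs, ← hcz p hp _ hs, ← tableVal_congr T (hz p hp _ hs)]
    push_cast
    rw [hn p hp]
    ring

end IsPairState


/-! ### Bit manipulation of states and masks -/

theorem testBit_add_mul {a : ℕ} (ha : a < 128) (R i : ℕ) :
    (a + 128 * R).testBit i = if i < 7 then a.testBit i else R.testBit (i - 7) := by
  have h1 : a + 128 * R = R <<< 7 ||| a := by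
    rw [← Nat.shiftLeft_add_eq_or_of_lt (i := 7) ha, Nat.shiftLeft_eq]; omega
  rw [h1, Nat.testBit_or, Nat.testBit_shiftLeft]
  by_cases h : i < 7
  · simp [h, Nat.not_le.2 h]
  · have : a.testBit i = false :=
      Nat.testBit_lt_two_pow (lt_of_lt_of_le ha (Nat.pow_le_pow_right (by norm_num) (not_lt.1 h) : 2 ^ 7 ≤ 2 ^ i))
    simp [h, not_lt.1 h, this]

theorem bitAt_eq (s k : ℕ) : bitAt s k = (s.testBit k).toNat := by
  rw [Nat.toNat_testBit, ← Nat.shiftRight_eq_div_pow]; rfl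

theorem bitAt_congr {s s' k k' : ℕ} (h : s.testBit k = s'.testBit k') : bitAt s k = bitAt s' k' := by
  rw [bitAt_eq, bitAt_eq, h]

/-- Weak duality: a pointwise bound by a constant plus nonnegative multiples of functions of
nonpositive mean bounds the mean by the constant. -/
theorem integral_le_of_le_add {Ω : Type*} [MeasurableSpace Ω] {μ : Measure Ω}
    [IsProbabilityMeasure μ] {f f₁ f₂ f₃ : Ω → ℝ} {c c₁ c₂ c₃ : ℝ} (hf : Integrable f μ)
    (h₁ : Integrable f₁ μ) (h₂ : Integrable f₂ μ) (h₃ : Integrable f₃ μ)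
    (hc₁ : 0 ≤ c₁) (hc₂ : 0 ≤ c₂) (hc₃ : 0 ≤ c₃)
    (h : ∀ ω, f ω ≤ c + c₁ * f₁ ω + c₂ * f₂ ω + c₃ * f₃ ω)
    (i₁ : ∫ ω, f₁ ω ∂μ ≤ 0) (i₂ : ∫ ω, f₂ ω ∂μ ≤ 0) (i₃ : ∫ ω, f₃ ω ∂μ ≤ 0) :
    ∫ ω, f ω ∂μ ≤ c := by
  have k₁ : Integrable (fun ω => c + c₁ * f₁ ω) μ := (integrable_const c).add (h₁.const_mul c₁)
  have k₂ : Integrable (fun ω => c + c₁ * f₁ ω + c₂ * f₂ ω) μ := k₁.add (h₂.const_mul c₂)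
  have main := integral_mono hf (k₂.add (h₃.const_mul c₃)) h
  have e : ∫ ω, (c + c₁ * f₁ ω + c₂ * f₂ ω + c₃ * f₃ ω) ∂μ =
      c + c₁ * ∫ ω, f₁ ω ∂μ + c₂ * ∫ ω, f₂ ω ∂μ + c₃ * ∫ ω, f₃ ω ∂μ := by
    rw [integral_add k₂ (h₃.const_mul c₃), integral_add k₁ (h₂.const_mul c₂),
      integral_add (integrable_const c) (h₁.const_mul c₁)]
    simp [integral_const_mul]
  have := mul_nonpos_of_nonneg_of_nonpos hc₁ i₁
  have := mul_nonpos_of_nonneg_of_nonpos hc₂ i₂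
  have := mul_nonpos_of_nonneg_of_nonpos hc₃ i₃
  have main' : ∫ ω, f ω ∂μ ≤ ∫ ω, (c + c₁ * f₁ ω + c₂ * f₂ ω + c₃ * f₃ ω) ∂μ := main
  linarith

/-- The set of open links. -/
def openLinks (d : Bool) (s : ℕ) : ℕ := (2 ^ numLinks d - 1) ^^^ (s >>> 7 % 8)

/-- State seen by the tests of the first block. -/
noncomputable def stateFst (d : Bool) (s : ℕ) : ℕ :=
  s % 128 + 128 * (openLinks d s &&& linksSnd d (s >>> 10))

/-- State seen by the tests of the second block. -/
def stateSnd (d : Bool) (Q s : ℕ) : ℕ := s >>> 10 + 128 * (openLinks d s &&& Q)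

theorem numLinks_le (d : Bool) : numLinks d ≤ 3 := by cases d <;> decide

theorem openLinks_lt {d : Bool} {s : ℕ} (hs : s &&& pairMask d = s) :
    openLinks d s < 2 ^ numLinks d := by
  refine Nat.xor_lt_two_pow (Nat.sub_lt (by positivity) one_pos) ?_
  have h : s >>> 7 % 8 = (s >>> 7 % 8) &&& (pairMask d >>> 7 % 8) := by
    conv_lhs => rw [← hs, Nat.shiftRight_and_distrib]
    exact Nat.and_mod_two_pow (n := 3)
  rw [h]
  refine lt_of_le_of_lt Nat.and_le_right ?_
  cases d <;> decide +kernel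

theorem shiftRight_lt {d : Bool} {s : ℕ} (hs : s &&& pairMask d = s) : s >>> 10 < 128 := by
  rw [← hs, Nat.shiftRight_and_distrib]
  refine lt_of_le_of_lt Nat.and_le_right ?_
  cases d <;> decide +kernel

theorem testBit_openLinks (d : Bool) (s i : ℕ) : (openLinks d s).testBit i =
    (decide (i < numLinks d) ^^ (decide (i < 3) && s.testBit (7 + i))) := by
  have : s >>> 7 % 8 = s >>> 7 % 2 ^ 3 := rfl
  rw [openLinks, Nat.testBit_xor, Nat.testBit_two_pow_sub_one, this, Nat.testBit_mod_two_pow,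
    Nat.testBit_shiftRight]

/-- An edge inside the first block has no cell in the second, so its mask contains all seven edges
there. -/
theorem disjointMask_shiftRight (d : Bool) {e : ℕ} (he : e < 7) : disjointMask d e >>> 10 = 127 := by
  have : ∀ d : Bool, ∀ e < 7, disjointMask d e >>> 10 = 127 := by decide +kernel
  exact this d e he

theorem disjointMask_mod (d : Bool) {e : ℕ} (he : e < 7) :
    disjointMask d (10 + e) % 128 = 127 := by
  have : ∀ d : Bool, ∀ e < 7, disjointMask d (10 + e) % 128 = 127 := by decide +kernel
  exact this d e he

theorem disjointMask_lt (d : Bool) (k : ℕ) (hk : k < 17) : disjointMask d k >>> 10 < 128 := by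
  have : ∀ d : Bool, ∀ k < 17, disjointMask d k >>> 10 < 128 := by decide +kernel
  exact this d k hk

theorem isPairEdge_fst (d : Bool) {e : ℕ} (he : e < 7) : isPairEdge d e = true := by
  have : ∀ d : Bool, ∀ e < 7, isPairEdge d e = true := by decide +kernel
  exact this d e he

theorem isPairEdge_snd (d : Bool) {e : ℕ} (he : e < 7) : isPairEdge d (10 + e) = true := by
  have : ∀ d : Bool, ∀ e < 7, isPairEdge d (10 + e) = true := by decide +kernel
  exact this d e he

theorem and_mod_of_mod {s M : ℕ} (hM : M % 128 = 127) : (s &&& M) % 128 = s % 128 := by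
  rw [show (s &&& M) % 128 = (s % 128) &&& (M % 128) from Nat.and_mod_two_pow (n := 7), hM]
  have := Nat.and_two_pow_sub_one_eq_mod (s % 128) 7
  norm_num at this
  simpa using this

theorem and_shiftRight_of {d : Bool} {s M : ℕ} (hs : s &&& pairMask d = s) (hM : M >>> 10 = 127) :
    (s &&& M) >>> 10 = s >>> 10 := by
  rw [Nat.shiftRight_and_distrib, hM]
  have := Nat.and_two_pow_sub_one_eq_mod (s >>> 10) 7
  norm_num at this
  rw [this]
  exact Nat.mod_eq_of_lt (shiftRight_lt hs)

/-- The state seen by the first block contains the links that are open and arrive at the designated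
component of the second block. That component is unaffected by erasing edges that meet an edge of
the first block, since none lies in the second. The link bits are treated one at a time, and the
mask keeps only links disjoint from the tested edge. -/
theorem stateFst_and {d : Bool} {s e : ℕ} (hs : s &&& pairMask d = s) (he : e < 7) :
    stateFst d s &&& Certificate.maskFst d e =
      stateFst d (s &&& disjointMask d e) &&& Certificate.maskFst d e := by
  have hm : Certificate.maskFst d e = disjointMask d e % 2 ^ 10 := rfl
  rw [stateFst, stateFst, and_shiftRight_of hs (disjointMask_shiftRight d he), hm]
  refine Nat.eq_of_testBit_eq fun i => ?_
  have e7 : ∀ x : ℕ, x % 128 = x % 2 ^ 7 := fun _ => rfl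
  rw [Nat.testBit_and, Nat.testBit_and, testBit_add_mul (Nat.mod_lt _ (by norm_num)),
    testBit_add_mul (Nat.mod_lt _ (by norm_num)), Nat.testBit_mod_two_pow]
  by_cases hi : i < 7
  · simp only [hi, if_true, e7, Nat.testBit_mod_two_pow, Nat.testBit_and]
    cases s.testBit i <;> cases (disjointMask d e).testBit i <;> simp
  · simp only [hi, if_false, Nat.testBit_and, testBit_openLinks]
    rw [show 7 + (i - 7) = i by omega]
    cases s.testBit i <;> cases (disjointMask d e).testBit i <;> simp

/-- Here the links are intersected with a constant set `Q` in place of the designated component of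
the first block. A test of the second block therefore reads nothing of the first block. -/
theorem stateSnd_and {d : Bool} {s e : ℕ} (Q : ℕ) (hs : s &&& pairMask d = s) (he : e < 7) :
    stateSnd d Q s &&& Certificate.maskSnd d e =
      stateSnd d Q (s &&& disjointMask d (10 + e)) &&& Certificate.maskSnd d e := by
  set M := disjointMask d (10 + e) with hMdef
  have hM : M >>> 10 < 128 := disjointMask_lt d _ (by omega)
  have hm : Certificate.maskSnd d e = M >>> 10 + 128 * (M >>> 7 % 8) := rfl
  have hs2 : (s &&& M) >>> 10 < 128 := by
    rw [Nat.shiftRight_and_distrib]; exact lt_of_le_of_lt Nat.and_le_right hM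
  rw [stateSnd, stateSnd, hm]
  refine Nat.eq_of_testBit_eq fun i => ?_
  have e3 : ∀ x : ℕ, x % 8 = x % 2 ^ 3 := fun _ => rfl
  rw [Nat.testBit_and, Nat.testBit_and, testBit_add_mul (shiftRight_lt hs),
    testBit_add_mul hs2, testBit_add_mul hM]
  by_cases hi : i < 7
  · simp only [hi, if_true, Nat.testBit_shiftRight, Nat.testBit_and]
    cases s.testBit (10 + i) <;> cases M.testBit (10 + i) <;> simp
  · simp only [hi, if_false, Nat.testBit_and, testBit_openLinks, e3, Nat.testBit_mod_two_pow,
      Nat.testBit_shiftRight]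
    cases s.testBit (7 + (i - 7)) <;> cases M.testBit (7 + (i - 7)) <;> simp

theorem bitAt_stateFst (d : Bool) {s e : ℕ} (he : e < 7) : bitAt (stateFst d s) e = bitAt s e := by
  refine bitAt_congr ?_
  rw [stateFst, testBit_add_mul (Nat.mod_lt _ (by norm_num)), if_pos he,
    show s % 128 = s % 2 ^ 7 from rfl, Nat.testBit_mod_two_pow]
  simp [he]

theorem bitAt_stateSnd {d : Bool} {s e : ℕ} (Q : ℕ) (hs : s &&& pairMask d = s) (he : e < 7) :
    bitAt (stateSnd d Q s) e = bitAt s (10 + e) := by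
  refine bitAt_congr ?_
  rw [stateSnd, testBit_add_mul (shiftRight_lt hs), if_pos he, Nat.testBit_shiftRight]

/-! ### Soundness of certificates -/

namespace Certificate

variable {C : Certificate} {d : Bool} {nh nv : ℕ}

/-- The weight of the set `Q` of links in the first block. -/
noncomputable def weightAt (C : Certificate) (Q s : ℕ) : ℕ :=
  entry 16 (entry 128 C.wFst (s % 128 &&& C.outer % 128)) Q

/-- This is the dual inequality, scaled by 10¹⁶. The first block is replaced by link sets Q with
weights, against R = the open links arriving at the designated component of the second block. For
each Q the second block is then replaced against the open links in Q, multiplied by the weight of Q.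
The outer inequality bounds the resulting double sum. In the final combination the three
inequalities are multiplied by 10⁸, 10⁴ and 10⁴ respectively. -/
theorem pointwise (hC : C.check d nh nv = true) {s : ℕ} (hs : s &&& pairMask d = s) :
    (10000 : ℝ) ^ 4 * (if pairClosed d s then 1 else 0) ≤ 10000 ^ 2 * C.value +
      10000 ^ 2 * (1 * (10000 * ((C.tFst d nh nv).closed (stateFst d s) : ℝ) -
        (C.tFst d nh nv).weight (stateFst d s))) +
      10000 * (∑ Q ∈ Finset.range (2 ^ numLinks d), (C.weightAt Q s : ℝ) *
        (10000 * ((C.tSnd d nh nv).closed (stateSnd d Q s) : ℝ) -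
        (C.tSnd d nh nv).weight (stateSnd d Q s))) +
      10000 * C.scale * (1 * (10000 * ((C.tOut d nh nv).closed (s &&& C.outer) : ℝ) -
        (C.tOut d nh nv).weight (s &&& C.outer))) := by
  simp only [check, Bool.and_eq_true] at hC
  obtain ⟨⟨⟨⟨_, hl⟩, h1⟩, h2⟩, h3⟩ := hC
  have hl' : C.outer >>> 7 % 8 = 2 ^ numLinks d - 1 := Nat.beq_eq ▸ hl
  set n := 2 ^ numLinks d with hn
  set U := openLinks d s with hU
  have hUn : U < n := openLinks_lt hs
  have g1 := innerCheck_spec h1 (R := U &&& linksSnd d (s >>> 10)) (a := s % 128)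
    (lt_of_le_of_lt Nat.and_le_left hUn) (Nat.mod_lt _ (by norm_num))
  have g2 : ∀ Q, _ := fun Q => innerCheck_spec h2 (R := U &&& Q) (a := s >>> 10)
    (lt_of_le_of_lt Nat.and_le_left hUn) (shiftRight_lt hs)
  set a := s % 128 &&& C.outer % 128 with ha
  set h := s >>> 7 &&& C.outer >>> 7 with hh
  have hso : a + 128 * h = s &&& C.outer := by
    rw [ha, hh, ← Nat.shiftRight_and_distrib,
      show s % 128 &&& C.outer % 128 = (s &&& C.outer) % 128 from (Nat.and_mod_two_pow (n := 7)).symm,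
      Nat.shiftRight_eq_div_pow]
    exact Nat.mod_add_div _ _
  have hh10 : h < 1024 := by
    refine lt_of_le_of_lt Nat.and_le_left ?_
    rw [← hs, Nat.shiftRight_and_distrib]
    refine lt_of_le_of_lt Nat.and_le_right ?_
    cases d <;> decide +kernel
  -- The check requires `C.outer` to contain every link, so masking by it loses nothing of the link
  -- state.
  have hUh : (n - 1) ^^^ (h % 8) = U := by
    rw [hU, openLinks]
    congr 1
    rw [hh, show (s >>> 7 &&& C.outer >>> 7) % 8 = (s >>> 7 % 8) &&& (C.outer >>> 7 % 8) from
      Nat.and_mod_two_pow (n := 3), hl', Nat.and_two_pow_sub_one_eq_mod]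
    refine Nat.mod_eq_of_lt ?_
    have h' : s >>> 7 % 8 = (s >>> 7 % 8) &&& (pairMask d >>> 7 % 8) := by
      conv_lhs => rw [← hs, Nat.shiftRight_and_distrib]
      exact Nat.and_mod_two_pow (n := 3)
    rw [h']
    refine lt_of_le_of_lt Nat.and_le_right ?_
    cases d <;> decide +kernel
  have hh3 : h >>> 3 = s >>> 10 &&& C.outer >>> 10 := by
    rw [hh, Nat.shiftRight_and_distrib, ← Nat.shiftRight_add, ← Nat.shiftRight_add]
  have g3 := outerCheck_spec h3 (h := h) (a := a) hh10
    (by rw [hh, Nat.and_assoc, Nat.and_self]) (lt_of_le_of_lt Nat.and_le_left (Nat.mod_lt _ (by norm_num)))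
    (by rw [ha, Nat.and_assoc, Nat.and_self])
  rw [hso] at g3
  simp only [hUh, hh3] at g3
  set K : ℕ → ℕ := fun Q => rowSum n (entry 128 C.wSnd (s >>> 10 &&& C.outer >>> 10)) (U &&& Q)
    with hK
  have g2' : ∀ Q, (if linksSnd d (s >>> 10) &&& (U &&& Q) = 0 then (100000000 : ℝ) else 0) +
      (C.tSnd d nh nv).weight (stateSnd d Q s) ≤ 10000 * K Q +
        10000 * (C.tSnd d nh nv).closed (stateSnd d Q s) := fun Q => by
    have := g2 Q
    exact_mod_cast this
  have g1' : (if pairClosed d s then (100000000 : ℝ) else 0) +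
      (C.tFst d nh nv).weight (stateFst d s) ≤
      10000 * (∑ Q ∈ Finset.range n, if Q &&& (U &&& linksSnd d (s >>> 10)) = 0
        then (C.weightAt Q s : ℝ) else 0) + 10000 * (C.tFst d nh nv).closed (stateFst d s) := by
    have h4 := g1
    rw [rowSum_eq] at h4
    exact_mod_cast h4
  have g3' : (10000 : ℝ) * (∑ Q ∈ Finset.range n, (K Q : ℝ) * C.weightAt Q s) +
      C.scale * (C.tOut d nh nv).weight (s &&& C.outer) ≤ 10000 * C.value +
        10000 * C.scale * (C.tOut d nh nv).closed (s &&& C.outer) := by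
    exact_mod_cast g3
  have hsum : (∑ Q ∈ Finset.range n, if Q &&& (U &&& linksSnd d (s >>> 10)) = 0
        then (C.weightAt Q s : ℝ) else 0) * 100000000 ≤
      10000 * (∑ Q ∈ Finset.range n, (K Q : ℝ) * C.weightAt Q s) +
      ∑ Q ∈ Finset.range n, (C.weightAt Q s : ℝ) *
        (10000 * ((C.tSnd d nh nv).closed (stateSnd d Q s) : ℝ) -
        (C.tSnd d nh nv).weight (stateSnd d Q s)) := by
    rw [Finset.sum_mul, Finset.mul_sum, ← Finset.sum_add_distrib]
    refine Finset.sum_le_sum fun Q _ => ?_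
    -- The same triple intersection is read in two ways: as Q avoiding R in the replacement of the
    -- first block, and as the second component avoiding the open links in Q. This lets the second
    -- replacement act on each term of the first.
    have e1 : Q &&& (U &&& linksSnd d (s >>> 10)) = linksSnd d (s >>> 10) &&& (U &&& Q) := by
      rw [Nat.and_comm, Nat.and_right_comm, Nat.and_comm]
    rw [e1]
    have h5 := mul_le_mul_of_nonneg_left (g2' Q) (Nat.cast_nonneg (α := ℝ) (C.weightAt Q s))
    split_ifs at h5 ⊢ <;> nlinarith [h5]
  split_ifs at g1' ⊢ <;> nlinarith [g1', g3', hsum]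

/-- Integrating `pointwise` makes the three families of tests nonpositive and leaves the constant,
which is stored in units of 10⁻⁸. -/
theorem integral_le {Ω : Type*} [MeasurableSpace Ω] {μ : Measure Ω} [IsProbabilityMeasure μ]
    {S : Ω → ℕ} (hS : IsPairState μ d (fun k => edgeBound d nh nv k / 10000) S) (hC : C.check d nh nv = true) :
    ∫ ω, (if pairClosed d (S ω) then (1 : ℝ) else 0) ∂μ ≤ C.value / 100000000 := by
  have hC' := hC
  simp only [check, Bool.and_eq_true, List.all_eq_true] at hC'
  obtain ⟨⟨⟨⟨⟨⟨k1, k2⟩, k3⟩, _⟩, _⟩, _⟩, _⟩ := hC'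
  have lt7 : ∀ {x : ℕ}, Nat.blt x 7 = true → x < 7 := fun h => Nat.le_of_ble_eq_true h
  have i1 := hS.tests_le (maskFst d) (maskFst d) (edgeBound d nh nv) (fun e => e) (stateFst d)
    (fun _ => 1) (fun _ => zero_le_one) C.testsFst
    (fun p hp => isPairEdge_fst d (lt7 (k1 p hp))) (fun _ _ => (mul_div_cancel₀ _ (by norm_num)).symm)
    (fun p hp s _ => bitAt_stateFst d (lt7 (k1 p hp)))
    (fun p hp s hs => stateFst_and hs (lt7 (k1 p hp))) (fun _ _ _ _ => rfl)
  -- The extra factor is the weight of Q in the first block. It reads only edges of the first block,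
  -- all of which are disjoint from the tested edge of the second block.
  have i2 : ∀ Q, _ := fun Q => hS.tests_le (maskSnd d) (maskSnd d) (edgeBound d nh nv)
    (fun e => 10 + e) (stateSnd d Q)
    (fun s => C.weightAt Q s) (fun _ => Nat.cast_nonneg _) C.testsSnd
    (fun p hp => isPairEdge_snd d (lt7 (k2 p hp)))
    (fun p hp => by
      -- The tests of the second block number its edges 0 to 6, and their coefficients come from the
      -- first block. Both blocks carry the same bounds by translation.
      have h : edgeBound d nh nv p.1 = edgeBound d nh nv (10 + p.1) := by
        have := lt7 (k2 p hp)
        generalize p.1 = e at this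
        interval_cases e <;> rfl
      rw [h, mul_div_cancel₀ _ (by norm_num)])
    (fun p hp s hs => bitAt_stateSnd Q hs (lt7 (k2 p hp)))
    (fun p hp s hs => stateSnd_and Q hs (lt7 (k2 p hp)))
    (fun p hp s hs => by
      simp only [weightAt]
      rw [and_mod_of_mod (disjointMask_mod d (lt7 (k2 p hp)))])
  have i3 := hS.tests_le (fun k => Nat.land (disjointMask d k) C.outer) (disjointMask d)
    (edgeBound d nh nv) (fun e => e) (fun s => s &&& C.outer)
    (fun _ => 1) (fun _ => zero_le_one) C.tests
    (fun p hp => (k3 p hp).1) (fun _ _ => (mul_div_cancel₀ _ (by norm_num)).symm)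
    (fun p hp s _ => bitAt_congr (by
      have h1 : bitAt C.outer p.1 = 1 := Nat.beq_eq ▸ (k3 p hp).2
      have h2 : C.outer.testBit p.1 = true := by
        rw [bitAt_eq] at h1
        simpa using h1
      rw [Nat.testBit_and, h2, Bool.and_true]))
    (fun p hp s hs => by
      rw [Nat.and_right_comm s (disjointMask d p.1), Nat.and_assoc (s &&& C.outer), Nat.and_self])
    (fun _ _ _ _ => rfl)
  have j1 := hS.integrable fun s => (1 : ℝ) * (10000 * ((C.tFst d nh nv).closed (stateFst d s) : ℝ) -
        (C.tFst d nh nv).weight (stateFst d s))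
  have j2 : ∀ Q, Integrable (fun ω => (C.weightAt Q (S ω) : ℝ) *
        (10000 * ((C.tSnd d nh nv).closed (stateSnd d Q (S ω)) : ℝ) -
        (C.tSnd d nh nv).weight (stateSnd d Q (S ω)))) μ := fun Q =>
    hS.integrable fun s => (C.weightAt Q s : ℝ) *
        (10000 * ((C.tSnd d nh nv).closed (stateSnd d Q s) : ℝ) -
        (C.tSnd d nh nv).weight (stateSnd d Q s))
  have j3 := hS.integrable fun s => (1 : ℝ) * (10000 * ((C.tOut d nh nv).closed (s &&& C.outer) : ℝ) -
        (C.tOut d nh nv).weight (s &&& C.outer))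
  have j2' := integrable_finsetSum (Finset.range (2 ^ numLinks d)) fun Q _ => j2 Q
  have main := integral_le_of_le_add
    ((hS.integrable fun s => if pairClosed d s then (1 : ℝ) else 0).const_mul ((10000 : ℝ) ^ 4))
    j1 j2' j3 (by positivity) (by positivity) (by positivity)
    (fun ω => pointwise hC (hS.land_eq ω)) i1
    (by
      rw [integral_finsetSum _ fun Q _ => j2 Q]
      exact Finset.sum_nonpos fun Q _ => i2 Q) i3
  rw [integral_const_mul] at main
  rw [le_div_iff₀ (by norm_num)]
  linarith

end Certificate

/-! ### Blocks of the square lattice -/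

/-- The neighbour of `v` to the right (`d = false`) or above (`d = true`). -/
def nxt (d : Bool) (v : ℤ × ℤ) : ℤ × ℤ := bif d then (v.1, v.2 + 1) else (v.1 + 1, v.2)

/-- The `c`-th cell of the block `v`. -/
def cell (v : ℤ × ℤ) (c : ℕ) : ℤ × ℤ := (2 * v.1 + (c / 3 : ℕ) - 1, 3 * v.2 + (c % 3 : ℕ) - 1)

/-- The block containing the site `u`. -/
def block (u : ℤ × ℤ) : ℤ × ℤ := ((u.1 + 1) / 2, (u.2 + 1) / 3)

/-- The `c`-th cell of the pair of blocks at `v` in direction `d`. -/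
def pairCell (d : Bool) (v : ℤ × ℤ) (c : ℕ) : ℤ × ℤ :=
  if c < 6 then cell v c else cell (nxt d v) (c - 6)

/-- The direction of the edge `k` of a pair of blocks. -/
def pairDir (d : Bool) (k : ℕ) : Bool :=
  bif Nat.blt k 7 then Nat.ble 3 k else bif Nat.blt k 10 then d else Nat.ble 13 k

theorem block_cell (v : ℤ × ℤ) {c : ℕ} (hc : c < 6) : block (cell v c) = v := by
  ext <;> simp only [block, cell] <;> omega

theorem cell_injOn {v w : ℤ × ℤ} {c c' : ℕ} (hc : c < 6) (hc' : c' < 6)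
    (h : cell v c = cell w c') : v = w ∧ c = c' := by
  have hv : v = w := by rw [← block_cell v hc, h, block_cell w hc']
  subst hv
  refine ⟨rfl, ?_⟩
  simp only [cell, Prod.mk.injEq] at h
  omega

theorem nxt_ne (d : Bool) (v : ℤ × ℤ) : nxt d v ≠ v := by
  intro h
  cases d <;> simp [nxt, Prod.ext_iff] at h

theorem nxt_swap (d : Bool) (v : ℤ × ℤ) : (nxt d v).swap = nxt (!d) v.swap := by
  cases d <;> rfl

theorem pairCell_injOn (d : Bool) (v : ℤ × ℤ) {c c' : ℕ} (hc : c < 12) (hc' : c' < 12)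
    (h : pairCell d v c = pairCell d v c') : c = c' := by
  unfold pairCell at h
  split_ifs at h with h1 h2 h2
  · exact (cell_injOn h1 h2 h).2
  · exact absurd (cell_injOn h1 (by omega) h).1.symm (nxt_ne d v)
  · exact absurd (cell_injOn (by omega) h2 h).1 (nxt_ne d v)
  · have := (cell_injOn (by omega) (by omega) h).2
    omega

theorem block_pairCell (d : Bool) (v : ℤ × ℤ) {c : ℕ} (hc : c < 12) :
    block (pairCell d v c) ∈ ({v, nxt d v} : Set (ℤ × ℤ)) := by
  unfold pairCell
  split_ifs with h
  · rw [block_cell v h]; exact Set.mem_insert _ _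
  · rw [block_cell _ (by omega)]; exact Set.mem_insert_of_mem _ rfl

theorem pairCells_lt (d : Bool) {k : ℕ} (hk : isPairEdge d k = true) :
    (pairCells d k).1 < 12 ∧ (pairCells d k).2 < 12 := by
  have : ∀ d : Bool, ∀ k < 17, isPairEdge d k = true →
      (pairCells d k).1 < 12 ∧ (pairCells d k).2 < 12 := by decide +kernel
  refine this d k ?_ hk
  rw [isPairEdge, Bool.and_eq_true] at hk
  exact Nat.le_of_ble_eq_true hk.1

theorem isPairEdge_lt {d : Bool} {k : ℕ} (hk : isPairEdge d k = true) : k < 17 := by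
  rw [isPairEdge, Bool.and_eq_true] at hk
  exact Nat.le_of_ble_eq_true hk.1

/-- This ties the numbering to the geometry: edge `k` is a lattice edge, and its first cell is the
left or lower endpoint. -/
theorem nxt_pairCell (d : Bool) (v : ℤ × ℤ) {k : ℕ} (hk : isPairEdge d k = true) :
    nxt (pairDir d k) (pairCell d v (pairCells d k).1) = pairCell d v (pairCells d k).2 := by
  have h17 := isPairEdge_lt hk
  obtain ⟨x, y⟩ := v
  cases d <;> interval_cases k <;>
    first
    | exact absurd hk (by decide)
    | (simp [pairDir, pairCells, pairCell, edgeCells, nxt, cell, linkFst, linkSnd, Nat.blt, Nat.ble]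
       try ring_nf
       try trivial)

theorem pairMask_testBit (d : Bool) (j : ℕ) : (pairMask d).testBit j = isPairEdge d j := by
  have h : ∀ d : Bool, ∀ j < 17, (pairMask d).testBit j = isPairEdge d j := by decide +kernel
  by_cases hj : j < 17
  · exact h d j hj
  · have h1 : isPairEdge d j = false := by
      rw [← Bool.not_eq_true]; exact fun h => hj (isPairEdge_lt h)
    rw [h1]
    refine Nat.testBit_lt_two_pow (lt_of_lt_of_le ?_
      (Nat.pow_le_pow_right (by norm_num) (not_lt.1 hj) : 2 ^ 17 ≤ 2 ^ j))
    cases d <;> decide +kernel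

theorem disjointMask_testBit {d : Bool} {j k : ℕ} (hk : isPairEdge d k = true) :
    (disjointMask d k).testBit j = (isPairEdge d j && pairDisjoint d j k) := by
  have h : ∀ d : Bool, ∀ k < 17, ∀ j < 17,
      (disjointMask d k).testBit j = (isPairEdge d j && pairDisjoint d j k) := by decide +kernel
  have h2 : ∀ d : Bool, ∀ k < 17, disjointMask d k < 2 ^ 17 := by decide +kernel
  have hk' := isPairEdge_lt hk
  by_cases hj : j < 17
  · exact h d k hk' j hj
  · have h1 : isPairEdge d j = false := by
      rw [← Bool.not_eq_true]; exact fun h => hj (isPairEdge_lt h)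
    rw [h1, Bool.false_and]
    exact Nat.testBit_lt_two_pow (lt_of_lt_of_le (h2 d k hk')
      (Nat.pow_le_pow_right (by norm_num) (not_lt.1 hj) : 2 ^ 17 ≤ 2 ^ j))

/-! ### Designated components -/

/-- Whether no open edge of the block joins `m` with its complement. -/
noncomputable def separated (a m : ℕ) : Bool := allTo 7 fun e =>
  Nat.beq (bitAt a e) 1 || Nat.beq (bitAt m (edgeCells e).1) (bitAt m (edgeCells e).2)

theorem designated_lt (a : ℕ) : designated a < 64 := Nat.mod_lt _ (by norm_num)

theorem designated_ne_zero {a : ℕ} (ha : a < 128) : designated a ≠ 0 := by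
  have : ∀ a < 128, designated a ≠ 0 := by decide +kernel
  exact this a ha

/-- Connectedness is tested by cuts: a set of cells that no open edge leaves contains all or none of
the designated cells. This is a finite verification over 128 configurations and 64 sets of cells,
and it needs no paths. It is applied with `m` the set of cells reachable from a given point. -/
theorem designated_connected {a m : ℕ} (ha : a < 128) (hm : m < 64) (h : separated a m = true)
    {c c' : ℕ} (hc : (designated a).testBit c = true) (hcm : m.testBit c = true)
    (hc' : (designated a).testBit c' = true) : m.testBit c' = true := by
  have key : (allTo 128 fun a => allTo 64 fun m => bif separated a m then
      Nat.beq (Nat.land m (designated a)) 0 ||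
        Nat.beq (Nat.land m (designated a)) (designated a) else true) = true := by
    decide +kernel
  rw [allTo_iff] at key
  have h1 := key a ha
  rw [allTo_iff] at h1
  have h2 := h1 m hm
  rw [h, cond_true, Bool.or_eq_true, Nat.beq_eq, Nat.beq_eq] at h2
  change m &&& designated a = 0 ∨ m &&& designated a = designated a at h2
  rcases h2 with h2 | h2
  · have := congrArg (fun n => Nat.testBit n c) h2
    simp [hc, hcm] at this
  · have := congrArg (fun n => Nat.testBit n c') h2
    simpa [hc'] using this

theorem linksFst_testBit {d : Bool} {a r : ℕ} (ha : a < 128)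
    (h : (linksFst d a).testBit r = true) :
    r < numLinks d ∧ (designated a).testBit (linkFst d r) = true := by
  have h8 : ∀ d : Bool, ∀ a < 128, linksFst d a < 2 ^ 3 := by decide +kernel
  have key : ∀ d : Bool, ∀ r < 3, ∀ a < 128, (linksFst d a).testBit r = true →
    r < numLinks d ∧ (designated a).testBit (linkFst d r) = true := by decide +kernel
  refine key d r ?_ a ha h
  by_contra hr
  rw [Nat.testBit_lt_two_pow (lt_of_lt_of_le (h8 d a ha)
      (Nat.pow_le_pow_right (by norm_num) (not_lt.1 hr)))] at h
  exact absurd h (by decide)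

theorem linksSnd_testBit {d : Bool} {a r : ℕ} (ha : a < 128)
    (h : (linksSnd d a).testBit r = true) :
    r < numLinks d ∧ (designated a).testBit (linkSnd d r) = true := by
  have h8 : ∀ d : Bool, ∀ a < 128, linksSnd d a < 2 ^ 3 := by decide +kernel
  have key : ∀ d : Bool, ∀ r < 3, ∀ a < 128, (linksSnd d a).testBit r = true →
    r < numLinks d ∧ (designated a).testBit (linkSnd d r) = true := by decide +kernel
  refine key d r ?_ a ha h
  by_contra hr
  rw [Nat.testBit_lt_two_pow (lt_of_lt_of_le (h8 d a ha)
      (Nat.pow_le_pow_right (by norm_num) (not_lt.1 hr)))] at h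
  exact absurd h (by decide)

/-- If the centre is designated then so is another cell; if not, an edge at it or a pair of
other edges is closed, in two ways. -/
theorem designated_centre {a : ℕ} (ha : a < 128) :
    ((designated a).testBit 4 = true → ∃ c < 6, c ≠ 4 ∧ (designated a).testBit c = true) ∧
    ((designated a).testBit 4 = false →
      (a.testBit 1 = true ∨ a.testBit 3 = true ∧ a.testBit 6 = true) ∧
      (a.testBit 6 = true ∨ a.testBit 2 = true ∧ a.testBit 5 = true)) := by
  have : ∀ a < 128,
    ((designated a).testBit 4 = true → ∃ c < 6, c ≠ 4 ∧ (designated a).testBit c = true) ∧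
    ((designated a).testBit 4 = false →
      (a.testBit 1 = true ∨ a.testBit 3 = true ∧ a.testBit 6 = true) ∧
      (a.testBit 6 = true ∨ a.testBit 2 = true ∧ a.testBit 5 = true)) := by decide +kernel
  exact this a ha


/-! ### Renormalization of one-independent fields -/

open Classical in
/-- The number whose bits below `n` are given by `P`. -/
noncomputable def code (n : ℕ) (P : ℕ → Prop) : ℕ := Nat.ofBits fun i : Fin n => decide (P i)

theorem testBit_code (n : ℕ) (P : ℕ → Prop) (i : ℕ) :
    (code n P).testBit i = true ↔ i < n ∧ P i := by
  by_cases h : i < n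
  · rw [code, Nat.testBit_ofBits_lt _ _ h]; simp [h]
  · rw [code, Nat.testBit_ofBits_ge _ _ (not_lt.1 h)]; simp [h]

theorem code_lt (n : ℕ) (P : ℕ → Prop) : code n P < 2 ^ n := Nat.ofBits_lt_two_pow _

theorem code_and (n : ℕ) (P : ℕ → Prop) (m : ℕ) :
    code n P &&& m = code n fun i => P i ∧ m.testBit i = true := by
  refine Nat.eq_of_testBit_eq fun i => ?_
  rw [Bool.eq_iff_iff, Nat.testBit_and, Bool.and_eq_true, testBit_code, testBit_code, and_assoc]

theorem measurable_code {Ω : Type*} {m : MeasurableSpace Ω} {n : ℕ} {P : Ω → ℕ → Prop}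
    (h : ∀ i < n, MeasurableSet[m] {ω | P ω i}) : Measurable[m] fun ω => code n (P ω) := by
  classical
  have h1 : Measurable[m] fun ω => fun i : Fin n => decide (P ω i) := by
    refine measurable_pi_lambda _ fun i => ?_
    refine measurable_to_bool ?_
    convert h i i.2 using 1
    ext ω; simp
  have h2 : Measurable fun f : Fin n → Bool => Nat.ofBits f := Measurable.of_discrete
  convert h2.comp h1 using 1
  funext ω
  simp [code]

/-- A one-independent field of closed edges on the square lattice, together with disjoint connected
sets representing the sites in a random graph. -/
structure RenormField {Ω : Type*} [m₀ : MeasurableSpace Ω] (μ : Measure Ω)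
    (G : Ω → SimpleGraph (ℤ × ℤ)) where
  /-- The event that the edge at a site in a direction is closed. -/
  E : Bool → ℤ × ℤ → Set Ω
  /-- The information on the edges within a set of sites. -/
  F : Set (ℤ × ℤ) → MeasurableSpace Ω
  /-- The set of vertices representing a site. -/
  rep : Ω → ℤ × ℤ → Set (ℤ × ℤ)
  F_le : ∀ U, F U ≤ m₀
  F_mono : Monotone F
  F_indep : ∀ U U', Disjoint U U' → Indep (F U) (F U') μ
  E_meas : ∀ d v, MeasurableSet[F {v, nxt d v}] (E d v)
  rep_nonempty : ∀ ω v, (rep ω v).Nonempty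
  rep_disjoint : ∀ ω v w, v ≠ w → Disjoint (rep ω v) (rep ω w)
  rep_conn : ∀ ω v, ∀ x ∈ rep ω v, ∀ y ∈ rep ω v, (G ω).Reachable x y
  rep_link : ∀ ω d v, ω ∉ E d v → ∀ x ∈ rep ω v, ∀ y ∈ rep ω (nxt d v), (G ω).Reachable x y

namespace RenormField

variable {Ω : Type*} [m₀ : MeasurableSpace Ω] {μ : Measure Ω} {G : Ω → SimpleGraph (ℤ × ℤ)}
  (X : RenormField μ G)

/-- The closed edges of a block. -/
noncomputable def blockState (v : ℤ × ℤ) (ω : Ω) : ℕ :=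
  code 7 fun e => ω ∈ X.E (Nat.ble 3 e) (cell v (edgeCells e).1)

/-- The event that the edge `k` of a pair of blocks is closed. -/
def pairEvent (d : Bool) (v : ℤ × ℤ) (k : ℕ) : Set Ω :=
  X.E (pairDir d k) (pairCell d v (pairCells d k).1)

/-- The closed edges of a pair of blocks. -/
noncomputable def pairState (d : Bool) (v : ℤ × ℤ) (ω : Ω) : ℕ :=
  code 17 fun k => isPairEdge d k = true ∧ ω ∈ X.pairEvent d v k

theorem blockState_lt (v : ℤ × ℤ) (ω : Ω) : X.blockState v ω < 128 := code_lt 7 _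

theorem testBit_blockState {v : ℤ × ℤ} {ω : Ω} {e : ℕ} : (X.blockState v ω).testBit e = true ↔
    e < 7 ∧ ω ∈ X.E (Nat.ble 3 e) (cell v (edgeCells e).1) := testBit_code _ _ _

theorem testBit_pairState {d : Bool} {v : ℤ × ℤ} {ω : Ω} {k : ℕ} :
    (X.pairState d v ω).testBit k = true ↔ isPairEdge d k = true ∧ ω ∈ X.pairEvent d v k := by
  rw [pairState, testBit_code]
  exact ⟨fun h => h.2, fun h => ⟨isPairEdge_lt h.1, h⟩⟩

theorem pairState_land (d : Bool) (v : ℤ × ℤ) (ω : Ω) :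
    X.pairState d v ω &&& pairMask d = X.pairState d v ω := by
  refine Nat.eq_of_testBit_eq fun i => ?_
  rw [Bool.eq_iff_iff, Nat.testBit_and, Bool.and_eq_true, pairMask_testBit]
  exact ⟨fun h => h.1, fun h => ⟨h, (X.testBit_pairState.1 h).1⟩⟩

theorem edgeCells_lt {e : ℕ} (he : e < 7) : (edgeCells e).1 < 6 ∧ (edgeCells e).2 < 6 := by
  interval_cases e <;> decide

theorem pairState_mod (d : Bool) (v : ℤ × ℤ) (ω : Ω) :
    X.pairState d v ω % 128 = X.blockState v ω := by
  refine Nat.eq_of_testBit_eq fun i => ?_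
  rw [show X.pairState d v ω % 128 = X.pairState d v ω % 2 ^ 7 from rfl, Nat.testBit_mod_two_pow,
    Bool.eq_iff_iff, Bool.and_eq_true, testBit_pairState, testBit_blockState, decide_eq_true_iff]
  refine and_congr_right fun hi => ?_
  rw [isPairEdge_fst d hi, pairEvent]
  have h1 : Nat.blt i 7 = true := Nat.ble_eq_true_of_le hi
  have h2 : pairDir d i = Nat.ble 3 i := by rw [pairDir, h1, cond_true]
  have h3 : pairCells d i = edgeCells i := by rw [pairCells, h1, cond_true]
  rw [h2, h3, pairCell, if_pos (edgeCells_lt hi).1]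
  simp

theorem pairState_shiftRight (d : Bool) (v : ℤ × ℤ) (ω : Ω) :
    X.pairState d v ω >>> 10 = X.blockState (nxt d v) ω := by
  refine Nat.eq_of_testBit_eq fun i => ?_
  rw [Nat.testBit_shiftRight, Bool.eq_iff_iff, testBit_pairState, testBit_blockState]
  have hlt : isPairEdge d (10 + i) = true ↔ i < 7 :=
    ⟨fun h => by have := isPairEdge_lt h; omega, isPairEdge_snd d⟩
  rw [hlt]
  refine and_congr_right fun hi => ?_
  have h1 : pairDir d (10 + i) = Nat.ble 3 i := by interval_cases i <;> rfl
  have h2 : (pairCells d (10 + i)).1 = 6 + (edgeCells i).1 := by interval_cases i <;> rfl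
  rw [pairEvent, h1, h2, pairCell, if_neg (by omega), Nat.add_sub_cancel_left]

theorem measurable_pairEvent (d : Bool) (v : ℤ × ℤ) {k : ℕ} (hk : isPairEdge d k = true) :
    MeasurableSet[X.F {pairCell d v (pairCells d k).1, pairCell d v (pairCells d k).2}]
      (X.pairEvent d v k) := by
  have := X.E_meas (pairDir d k) (pairCell d v (pairCells d k).1)
  rwa [nxt_pairCell d v hk] at this

/-- The mask keeps only edges with both cells in `U`, and each of them is measurable with respect to
the edges within its own two cells. -/
theorem measurable_pairState_and (d : Bool) (v : ℤ × ℤ) (m : ℕ) (U : Set (ℤ × ℤ))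
    (hU : ∀ k, isPairEdge d k = true → m.testBit k = true →
      pairCell d v (pairCells d k).1 ∈ U ∧ pairCell d v (pairCells d k).2 ∈ U) :
    Measurable[X.F U] fun ω => X.pairState d v ω &&& m := by
  simp only [pairState, code_and]
  refine measurable_code fun k _ => ?_
  by_cases hk : isPairEdge d k = true ∧ m.testBit k = true
  · have h1 := X.F_mono (Set.insert_subset (hU k hk.1 hk.2).1
      (Set.singleton_subset_iff.2 (hU k hk.1 hk.2).2)) _ (X.measurable_pairEvent d v hk.1)
    convert h1 using 1
    ext ω
    simp [hk.1, hk.2]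
  · convert @MeasurableSet.empty _ (X.F U)
    ext ω
    simp only [Set.mem_ofPred_eq, Set.mem_empty_iff_false, iff_false]
    exact fun h => hk ⟨h.1.1, h.2⟩

theorem measurable_pairState_block (d : Bool) (v : ℤ × ℤ) :
    Measurable[X.F (block ⁻¹' {v, nxt d v})] (X.pairState d v) := by
  have h := X.measurable_pairState_and d v (pairMask d) (block ⁻¹' {v, nxt d v}) fun k hk _ =>
    ⟨block_pairCell d v (pairCells_lt d hk).1, block_pairCell d v (pairCells_lt d hk).2⟩
  simpa only [pairState_land] using h

theorem measurable_pairState (d : Bool) (v : ℤ × ℤ) : Measurable (X.pairState d v) :=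
  (X.measurable_pairState_block d v).mono (X.F_le _) le_rfl

theorem designated_lt_six {a c : ℕ} (h : (designated a).testBit c = true) : c < 6 := by
  by_contra hc
  rw [Nat.testBit_lt_two_pow (lt_of_lt_of_le (designated_lt _)
    (Nat.pow_le_pow_right (by norm_num) (not_lt.1 hc) : 2 ^ 6 ≤ 2 ^ c))] at h
  exact absurd h (by decide)

/-- Consider the cells all of whose representatives are reachable from `x`. An open edge of the
block joins representatives of its two cells, so it never leaves this set of cells. By the cut
criterion the set contains every designated cell as soon as it contains one. -/
theorem rep_designated (v : ℤ × ℤ) (ω : Ω) {c c' : ℕ}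
    (hc : (designated (X.blockState v ω)).testBit c = true)
    (hc' : (designated (X.blockState v ω)).testBit c' = true) {x y : ℤ × ℤ}
    (hx : x ∈ X.rep ω (cell v c)) (hy : y ∈ X.rep ω (cell v c')) : (G ω).Reachable x y := by
  set P : ℕ → Prop := fun c => ∀ y ∈ X.rep ω (cell v c), (G ω).Reachable x y with hP
  have hsep : separated (X.blockState v ω) (code 6 P) = true := by
    rw [separated, allTo_iff]
    intro e he
    by_cases hE : (X.blockState v ω).testBit e = true
    · rw [bitAt_eq, hE]; rfl
    · have hE' : ω ∉ X.E (Nat.ble 3 e) (cell v (edgeCells e).1) := fun h =>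
        hE (X.testBit_blockState.2 ⟨he, h⟩)
      -- The direction `true` is arbitrary: edges inside the first block do not depend on the
      -- direction of the pair.
      have hn : nxt (Nat.ble 3 e) (cell v (edgeCells e).1) = cell v (edgeCells e).2 := by
        have := nxt_pairCell true v (isPairEdge_fst true he)
        have h1 : Nat.blt e 7 = true := Nat.ble_eq_true_of_le he
        have h2 : pairDir true e = Nat.ble 3 e := by rw [pairDir, h1, cond_true]
        have h3 : pairCells true e = edgeCells e := by rw [pairCells, h1, cond_true]
        rwa [h2, h3, pairCell, pairCell, if_pos (edgeCells_lt he).1,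
          if_pos (edgeCells_lt he).2] at this
      have hl := X.rep_link ω _ _ hE'
      rw [hn] at hl
      have hiff : P (edgeCells e).1 ↔ P (edgeCells e).2 := by
        constructor
        · intro h z hz
          obtain ⟨u, hu⟩ := X.rep_nonempty ω (cell v (edgeCells e).1)
          exact (h u hu).trans (hl u hu z hz)
        · intro h z hz
          obtain ⟨u, hu⟩ := X.rep_nonempty ω (cell v (edgeCells e).2)
          exact (h u hu).trans (hl z hz u hu).symm
      have : (code 6 P).testBit (edgeCells e).1 = (code 6 P).testBit (edgeCells e).2 := by
        rw [Bool.eq_iff_iff, testBit_code, testBit_code, hiff]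
        exact and_congr_left fun _ => iff_of_true (edgeCells_lt he).1 (edgeCells_lt he).2
      rw [bitAt_congr this, Bool.or_eq_true]
      exact Or.inr (Nat.beq_eq ▸ rfl)
  have hcm : (code 6 P).testBit c = true :=
    (testBit_code _ _ _).2 ⟨designated_lt_six hc, fun y hy => X.rep_conn ω _ x hx y hy⟩
  exact ((testBit_code _ _ _).1 (designated_connected (X.blockState_lt v ω) (code_lt 6 P) hsep
    hc hcm hc')).2 y hy

theorem exists_link {d : Bool} {s : ℕ} (hs : ¬ pairClosed d s) : ∃ r,
    (linksFst d (s % 128)).testBit r = true ∧ (linksSnd d (s >>> 10)).testBit r = true ∧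
    (openLinks d s).testBit r = true := by
  obtain ⟨r, hr⟩ := Nat.exists_testBit_of_ne_zero hs
  have e : (2 ^ numLinks d - 1) ^^^ (s >>> 7 % 8) = openLinks d s := rfl
  rw [e, Nat.testBit_and, Nat.testBit_and, Bool.and_eq_true, Bool.and_eq_true] at hr
  exact ⟨r, hr.1, hr.2.2, hr.2.1⟩

theorem isPairEdge_link {d : Bool} {r : ℕ} (hr : r < numLinks d) :
    isPairEdge d (7 + r) = true ∧ r < 3 ∧ pairDir d (7 + r) = d ∧ linkFst d r < 6 ∧
      (pairCells d (7 + r)) = (linkFst d r, 6 + linkSnd d r) := by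
  have h3 : r < 3 := lt_of_lt_of_le hr (numLinks_le d)
  cases d <;> interval_cases r <;> first | exact absurd hr (by decide) | decide

/-- The field of the block edges. -/
noncomputable def renorm : RenormField μ G where
  E d v := {ω | pairClosed d (X.pairState d v ω)}
  F U := X.F (block ⁻¹' U)
  rep ω v := {x | ∃ c, (designated (X.blockState v ω)).testBit c = true ∧ x ∈ X.rep ω (cell v c)}
  F_le U := X.F_le _
  F_mono _ _ h := X.F_mono (Set.preimage_mono h)
  -- Disjoint sets of blocks consist of disjoint sets of sites, so one-independence passes to the
  -- blocks without loss.
  F_indep U U' h := X.F_indep _ _ (h.preimage _)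
  E_meas d v := (X.measurable_pairState_block d v) (MeasurableSpace.measurableSet_top (s := {s | pairClosed d s}))
  rep_nonempty ω v := by
    obtain ⟨c, hc⟩ := Nat.exists_testBit_of_ne_zero (designated_ne_zero (X.blockState_lt v ω))
    obtain ⟨x, hx⟩ := X.rep_nonempty ω (cell v c)
    exact ⟨x, c, hc, hx⟩
  rep_disjoint ω v w h := by
    rw [Set.disjoint_left]
    rintro x ⟨c, hc, hx⟩ ⟨c', hc', hx'⟩
    refine Set.disjoint_left.1 (X.rep_disjoint ω (cell v c) (cell w c') fun e => h ?_) hx hx'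
    exact (cell_injOn (designated_lt_six hc) (designated_lt_six hc') e).1
  rep_conn ω v := by
    rintro x ⟨c, hc, hx⟩ y ⟨c', hc', hy⟩
    exact X.rep_designated v ω hc hc' hx hy
  rep_link ω d v hE := by
    rintro x ⟨c, hc, hx⟩ y ⟨c', hc', hy⟩
    -- An open block edge supplies an open link with both ends designated. The path goes through the
    -- first component, across the link and through the second component.
    obtain ⟨r, h1, h2, h3⟩ := exists_link hE
    rw [X.pairState_mod] at h1
    rw [X.pairState_shiftRight] at h2
    obtain ⟨hr, h1⟩ := linksFst_testBit (X.blockState_lt _ ω) h1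
    obtain ⟨-, h2⟩ := linksSnd_testBit (X.blockState_lt _ ω) h2
    obtain ⟨k1, k2, k3, k4, k5⟩ := isPairEdge_link hr
    have hopen : ω ∉ X.E d (cell v (linkFst d r)) := by
      intro h
      have hs : (X.pairState d v ω).testBit (7 + r) = true := by
        rw [testBit_pairState, pairEvent, k3, k5, pairCell, if_pos k4]
        exact ⟨k1, h⟩
      rw [testBit_openLinks] at h3
      simp [hr, k2, hs] at h3
    have hn : nxt d (cell v (linkFst d r)) = cell (nxt d v) (linkSnd d r) := by
      have := nxt_pairCell d v k1
      rw [k3, k5] at this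
      simpa [pairCell, k4] using this
    have hl := X.rep_link ω d _ hopen
    rw [hn] at hl
    obtain ⟨u, hu⟩ := X.rep_nonempty ω (cell v (linkFst d r))
    obtain ⟨w, hw⟩ := X.rep_nonempty ω (cell (nxt d v) (linkSnd d r))
    exact ((X.rep_designated v ω hc h1 hx hu).trans (hl u hu w hw)).trans
      (X.rep_designated _ ω h2 hc' hw hy)

/-- The field reflected in the diagonal. -/
def swap : RenormField μ G where
  E d v := X.E (!d) v.swap
  F U := X.F (Prod.swap ⁻¹' U)
  rep ω v := X.rep ω v.swap
  F_le U := X.F_le _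
  F_mono _ _ h := X.F_mono (Set.preimage_mono h)
  F_indep U U' h := X.F_indep _ _ (h.preimage _)
  E_meas d v := by
    refine X.F_mono ?_ _ (X.E_meas (!d) v.swap)
    rw [← nxt_swap]
    rintro x (rfl | rfl)
    · simp
    · simp
  rep_nonempty ω v := X.rep_nonempty ω _
  rep_disjoint ω v w h := X.rep_disjoint ω _ _ fun e => h (Prod.swap_injective e)
  rep_conn ω v := X.rep_conn ω _
  rep_link ω d v hE := by
    have := X.rep_link ω _ _ hE
    rwa [← nxt_swap] at this

end RenormField
-- Moment inequalities from one-independence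
namespace RenormField

variable {Ω : Type*} [m₀ : MeasurableSpace Ω] {μ : Measure Ω} {G : Ω → SimpleGraph (ℤ × ℤ)}
  (X : RenormField μ G) {q : Bool → ℝ}

/-- The edges in direction `d` are closed with probability at most `q d`. -/
def Bound (q : Bool → ℝ) : Prop := ∀ d v, μ.real (X.E d v) ≤ q d

variable {X}

/-- This is where independence enters the estimates. The state of edge `k` is determined within its
two cells, and the multiplier by edges within the complement of these cells. The expectation
therefore factors as (P(k closed) − q)·E[f], with a nonpositive first factor and a nonnegative
second one. -/
theorem isPairState [IsProbabilityMeasure μ] (hX : X.Bound q) (d : Bool) (v : ℤ × ℤ) :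
    IsPairState μ d (fun k => q (pairDir d k)) (X.pairState d v) where
  measurable := X.measurable_pairState d v
  land_eq := X.pairState_land d v
  integral_le k hk f hf := by
    classical
    set p := pairCell d v (pairCells d k).1
    set p' := pairCell d v (pairCells d k).2
    set A := X.pairEvent d v k
    have hA : MeasurableSet[X.F {p, p'}] A := X.measurable_pairEvent d v hk
    have hZ : Measurable[X.F {p, p'}ᶜ] fun ω => f (X.pairState d v ω &&& disjointMask d k) := by
      refine (measurable_from_top (f := f)).comp (X.measurable_pairState_and d v _ _ ?_)
      -- Having no common cell number becomes having no common site, because distinct cells of the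
      -- pair are distinct sites.
      intro j hj hjk
      rw [disjointMask_testBit hk, hj, Bool.true_and] at hjk
      simp only [pairDisjoint, Bool.and_eq_true, Bool.not_eq_true', ← Bool.not_eq_true,
        Nat.beq_eq] at hjk
      obtain ⟨⟨⟨h1, h2⟩, h3⟩, h4⟩ := hjk
      have l1 := pairCells_lt d hj
      have l2 := pairCells_lt d hk
      constructor
      · rintro (h | h)
        · exact h1 (pairCell_injOn d v l1.1 l2.1 h)
        · exact h2 (pairCell_injOn d v l1.1 l2.2 h)
      · rintro (h | h)
        · exact h3 (pairCell_injOn d v l1.2 l2.1 h)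
        · exact h4 (pairCell_injOn d v l1.2 l2.2 h)
    have hY : Measurable[X.F {p, p'}] (A.indicator fun _ => (1 : ℝ)) :=
      measurable_const.indicator hA
    have hI : IndepFun (A.indicator fun _ => (1 : ℝ))
        (fun ω => f (X.pairState d v ω &&& disjointMask d k)) μ := by
      rw [IndepFun_iff_Indep]
      exact indep_of_indep_of_le_left (indep_of_indep_of_le_right
        (X.F_indep _ _ disjoint_compl_right) hZ.comap_le) hY.comap_le
    have hAm : MeasurableSet A := X.F_le _ _ hA
    have hbit : ∀ ω, (bitAt (X.pairState d v ω) k : ℝ) = A.indicator (fun _ => (1 : ℝ)) ω := by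
      intro ω
      rw [bitAt_eq]
      by_cases h : ω ∈ A
      · rw [(X.testBit_pairState).2 ⟨hk, h⟩, Set.indicator_of_mem h]; simp
      · have : (X.pairState d v ω).testBit k = false := by
          rw [← Bool.not_eq_true, X.testBit_pairState]
          exact fun h' => h h'.2
        rw [this, Set.indicator_of_notMem h]; simp
    have hmul := hI.integral_fun_mul_eq_mul_integral
      (hY.mono (X.F_le _) le_rfl).aestronglyMeasurable
      (hZ.mono (X.F_le _) le_rfl).aestronglyMeasurable
    have hint : ∀ g : ℕ → ℝ, Integrable (fun ω => g (X.pairState d v ω)) μ := by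
      intro g
      refine Integrable.of_bound (C := ∑ s ∈ Finset.range (pairMask d + 1), |g s|)
        ((measurable_from_top (f := g)).comp (X.measurable_pairState d v)).aestronglyMeasurable
        (Filter.Eventually.of_forall fun ω => ?_)
      refine Finset.single_le_sum (f := fun s => |g s|) (fun _ _ => abs_nonneg _) ?_
      rw [Finset.mem_range, Nat.lt_succ_iff, ← X.pairState_land d v ω]
      exact Nat.and_le_right
    simp only [sub_mul]
    rw [integral_sub (hint fun s => (bitAt s k : ℝ) * f (s &&& disjointMask d k))
      (hint fun s => q (pairDir d k) * f (s &&& disjointMask d k)), integral_const_mul]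
    simp only [hbit]
    rw [hmul, integral_indicator_const _ hAm, smul_eq_mul, mul_one, ← sub_mul]
    exact mul_nonpos_of_nonpos_of_nonneg (sub_nonpos.2 (hX _ _))
      (integral_nonneg fun ω => hf _)

end RenormField

theorem bitAt_eq_indicator {Ω : Type*} (S : Ω → ℕ) (k : ℕ) : (fun ω => (bitAt (S ω) k : ℝ)) =
    {ω | (S ω).testBit k = true}.indicator fun _ => (1 : ℝ) := by
  funext ω
  rw [bitAt_eq]
  by_cases h : (S ω).testBit k = true
  · rw [Set.indicator_of_mem (by exact h), h]; simp
  · rw [Set.indicator_of_notMem (by exact h), Bool.eq_false_of_not_eq_true h]; simp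

namespace IsPairState

variable {Ω : Type*} [MeasurableSpace Ω] {μ : Measure Ω} {d : Bool} {q : ℕ → ℝ} {S : Ω → ℕ}

theorem measurableSet_testBit (hS : IsPairState μ d q S) (k : ℕ) :
    MeasurableSet {ω | (S ω).testBit k = true} :=
  hS.measurable (MeasurableSet.of_discrete : MeasurableSet {s : ℕ | s.testBit k = true})

theorem measureReal_le [IsProbabilityMeasure μ] (hS : IsPairState μ d q S) {k : ℕ}
    (hk : isPairEdge d k = true) : μ.real {ω | (S ω).testBit k = true} ≤ q k := by
  have h := hS.integral_le k hk (fun _ => 1) fun _ => zero_le_one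
  simp only [mul_one] at h
  rw [integral_sub (hS.integrable fun s => (bitAt s k : ℝ)) (integrable_const _),
    bitAt_eq_indicator, integral_indicator_const _ (hS.measurableSet_testBit k)] at h
  simpa using h

/-- The moment inequality is applied to `k` with the indicator of edge `j` being closed as
multiplier. -/
theorem measureReal_inter_le [IsProbabilityMeasure μ] (hS : IsPairState μ d q S) {j k : ℕ}
    (hj : isPairEdge d j = true) (hk : isPairEdge d k = true) (hjk : pairDisjoint d j k = true)
    (hq : 0 ≤ q k) :
    μ.real {ω | (S ω).testBit j = true ∧ (S ω).testBit k = true} ≤ q j * q k := by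
  have h := hS.integral_le k hk (fun s => bitAt s j) fun _ => Nat.cast_nonneg _
  have hb : ∀ ω, bitAt (S ω &&& disjointMask d k) j = bitAt (S ω) j := fun ω => by
    refine bitAt_congr ?_
    rw [Nat.testBit_and, disjointMask_testBit hk, hj, hjk]
    simp
  simp only [hb, sub_mul] at h
  rw [integral_sub (hS.integrable fun s => (bitAt s k : ℝ) * bitAt s j)
    (hS.integrable fun s => q k * bitAt s j), integral_const_mul] at h
  have e1 := congrArg (fun f => ∫ ω, f ω ∂μ) (bitAt_eq_indicator S j)
  simp only [integral_indicator_const _ (hS.measurableSet_testBit j), smul_eq_mul, mul_one] at e1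
  have e2 : ∫ ω, (bitAt (S ω) k : ℝ) * bitAt (S ω) j ∂μ =
      μ.real {ω | (S ω).testBit j = true ∧ (S ω).testBit k = true} := by
    have : (fun ω => (bitAt (S ω) k : ℝ) * bitAt (S ω) j) =
        ({ω | (S ω).testBit j = true} ∩ {ω | (S ω).testBit k = true}).indicator
          fun _ => (1 : ℝ) := by
      funext ω
      have a1 := congrFun (bitAt_eq_indicator S j) ω
      have a2 := congrFun (bitAt_eq_indicator S k) ω
      rw [a1, a2]
      simp only [Set.indicator_apply, Set.mem_inter_iff]
      split_ifs <;> simp_all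
    rw [this, integral_indicator_const _
      ((hS.measurableSet_testBit j).inter (hS.measurableSet_testBit k))]
    simp [Set.inter_def]
  rw [e1, e2] at h
  have := mul_le_mul_of_nonneg_left (hS.measureReal_le hj) hq
  linarith

end IsPairState

/-! ### Closing probabilities of block edges and the loss at the origin -/

namespace RenormField

variable {Ω : Type*} [m₀ : MeasurableSpace Ω] {μ : Measure Ω}
  {G : Ω → SimpleGraph (ℤ × ℤ)} {X : RenormField μ G} {q : Bool → ℝ}

theorem real_renorm_le [IsProbabilityMeasure μ] (hX : X.Bound q) {d : Bool} {nh nv : ℕ}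
    (hh : q false = nh / 10000) (hv : q true = nv / 10000) {C : Certificate}
    (hC : C.check d nh nv = true) (v : ℤ × ℤ) :
    μ.real (X.renorm.E d v) ≤ C.value / 100000000 := by
  -- Edges 0–2 and 10–12 are horizontal, 3–6 and 13–16 vertical, and the links 7–9 have direction
  -- `d`. Thus the bound of an edge is the rate of its direction.
  have hq : (fun k => q (pairDir d k)) = fun k => (edgeBound d nh nv k : ℝ) / 10000 := by
    funext k
    unfold pairDir edgeBound
    have e1 : Nat.ble 3 k = !Nat.blt k 3 := by
      rw [Bool.eq_iff_iff, Bool.not_eq_true', ← Bool.not_eq_true, Nat.blt_eq, Nat.ble_eq, not_lt]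
    have e2 : Nat.ble 13 k = !Nat.blt k 13 := by
      rw [Bool.eq_iff_iff, Bool.not_eq_true', ← Bool.not_eq_true, Nat.blt_eq, Nat.ble_eq, not_lt]
    have e3 : Nat.blt k 3 = true → Nat.blt k 7 = true := by
      simp only [Nat.blt_eq]; omega
    rw [e1, e2]
    revert e3
    cases Nat.blt k 7 <;> cases Nat.blt k 10 <;> cases Nat.blt k 3 <;> cases Nat.blt k 13 <;>
      cases d <;> simp [hh, hv]
  have hS := isPairState hX d v
  rw [hq] at hS
  have h := Certificate.integral_le hS hC
  have e : (fun ω => if pairClosed d (X.pairState d v ω) then (1 : ℝ) else 0) =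
      (X.renorm.E d v).indicator fun _ => 1 := by
    classical
    funext ω
    rw [Set.indicator_apply]
    exact if_congr Iff.rfl rfl rfl
  rwa [e, integral_indicator_const _ (X.renorm.F_le _ _ (X.renorm.E_meas d v)), smul_eq_mul,
    mul_one] at h

/-- Pairs of disjoint edges such that whenever a block edge is closed, both edges of one of the
pairs are closed. -/
def closedPairs (d : Bool) : List (ℕ × ℕ) :=
  bif d then [(13, 8), (8, 7), (15, 7), (7, 6), (15, 14), (10, 2), (15, 13), (2, 1), (16, 13),
    (11, 10), (8, 4), (6, 4)]
  else [(9, 8), (12, 11), (9, 1), (16, 14), (12, 8), (11, 9), (8, 2), (14, 6), (2, 1), (6, 4)]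

/-- Whether the pairs in the list cover the minimal states with closed block edge. -/
noncomputable def coverCheck (d : Bool) : Bool :=
  allTo 128 fun a => allTo 128 fun b =>
    force (Nat.add (Nat.add a (Nat.mul 1024 b))
      (Nat.mul 128 (Nat.land (linksFst d a) (linksSnd d b)))) fun s =>
    (closedPairs d).any fun p => Nat.beq (Nat.mul (bitAt s p.1) (bitAt s p.2)) 1

theorem coverCheck_true (d : Bool) : coverCheck d = true := by
  cases d <;> decide +kernel

/-- With the two blocks fixed, a closed block edge forces exactly the links between the designated
components to be closed; closing other links only enlarges the state. It is enough to find a pair of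
closed edges in the minimal state, which is the one checked for each of the 128 × 128 choices of
blocks. -/
theorem exists_closedPairs {d : Bool} {s : ℕ} (hs : s &&& pairMask d = s) (h : pairClosed d s) :
    ∃ p ∈ closedPairs d, s.testBit p.1 = true ∧ s.testBit p.2 = true := by
  have ha : s % 128 < 128 := Nat.mod_lt _ (by norm_num)
  have hc := coverCheck_true d
  simp only [coverCheck, allTo_iff, force_eq] at hc
  have h1 := hc _ ha _ (shiftRight_lt hs)
  -- The links with both ends designated; all of them are closed in `s`.
  set γ := linksFst d (s % 128) &&& linksSnd d (s >>> 10) with hγ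
  have hγr : ∀ r, γ.testBit r = true → r < 3 ∧ s.testBit (7 + r) = true := by
    intro r hr
    rw [hγ, Nat.testBit_and, Bool.and_eq_true] at hr
    have hr' := (linksFst_testBit ha hr.1).1
    have hr3 := lt_of_lt_of_le hr' (numLinks_le d)
    refine ⟨hr3, ?_⟩
    have h0 : linksFst d (s % 128) &&& (openLinks d s &&& linksSnd d (s >>> 10)) = 0 := h
    have := congrArg (fun n => n.testBit r) h0
    simp only [Nat.testBit_and, hr.1, hr.2, testBit_openLinks, hr', hr3, Nat.zero_testBit] at this
    simpa using this
  have hγ8 : γ < 2 ^ 3 := Nat.lt_pow_two_of_testBit _ fun r hr => by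
    rw [← Bool.not_eq_true]
    exact fun h => absurd (hγr r h).1 (not_lt.2 hr)
  obtain ⟨p, hp, hpb⟩ := List.any_eq_true.1 h1
  -- The minimal state is contained in `s`, so a closed pair found there is closed in `s`.
  have hle : ∀ i, (Nat.add (Nat.add (s % 128) (Nat.mul 1024 (s >>> 10)))
      (Nat.mul 128 (Nat.land (linksFst d (s % 128)) (linksSnd d (s >>> 10))))).testBit i = true →
      s.testBit i = true := by
    intro i hi
    have e : Nat.add (Nat.add (s % 128) (Nat.mul 1024 (s >>> 10)))
      (Nat.mul 128 (Nat.land (linksFst d (s % 128)) (linksSnd d (s >>> 10)))) =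
        s % 128 + 128 * (2 ^ 3 * (s >>> 10) + γ) := by
      change s % 128 + 1024 * (s >>> 10) + 128 * γ = _
      ring
    rw [e, testBit_add_mul ha, Nat.testBit_two_pow_mul_add _ hγ8] at hi
    split_ifs at hi with h7 h3
    · rw [show s % 128 = s % 2 ^ 7 from rfl, Nat.testBit_mod_two_pow, Bool.and_eq_true] at hi
      exact hi.2
    · have := (hγr _ hi).2
      rwa [show 7 + (i - 7) = i by omega] at this
    · rw [Nat.testBit_shiftRight] at hi
      rwa [show 10 + (i - 7 - 3) = i by omega] at hi
  rw [Nat.beq_eq, bitAt_eq, bitAt_eq] at hpb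
  change _ * _ = 1 at hpb
  rw [mul_eq_one, Bool.toNat_eq_one, Bool.toNat_eq_one] at hpb
  exact ⟨p, hp, hle _ hpb.1, hle _ hpb.2⟩

theorem real_exists_mem_le {α : Type*} (P : α → Ω → Prop) (c : ℝ) (l : List α)
    (h : ∀ p ∈ l, μ.real {ω | P p ω} ≤ c) : μ.real {ω | ∃ p ∈ l, P p ω} ≤ l.length * c := by
  induction l with
  | nil => simp
  | cons p l ih =>
    have e : {ω | ∃ q ∈ p :: l, P q ω} = {ω | P p ω} ∪ {ω | ∃ q ∈ l, P q ω} := by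
      ext ω; simp
    rw [e, List.length_cons]
    have h1 := h p List.mem_cons_self
    have h2 := ih fun q hq => h q (List.mem_cons_of_mem _ hq)
    have := measureReal_union_le (μ := μ) {ω | P p ω} {ω | ∃ q ∈ l, P q ω}
    push_cast
    linarith

/-- Union bound over the list of disjoint pairs: by one-independence both edges of a pair are closed
with probability at most c², and there are at most 12 pairs. -/
theorem bound_renorm_sq [IsProbabilityMeasure μ] {c : ℝ} (hc : 0 ≤ c) (hX : X.Bound fun _ => c) :
    X.renorm.Bound fun _ => 12 * c ^ 2 := by
  intro d v
  have hS := isPairState hX d v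
  have h1 : X.renorm.E d v ⊆ {ω | ∃ p ∈ closedPairs d,
      (X.pairState d v ω).testBit p.1 = true ∧ (X.pairState d v ω).testBit p.2 = true} :=
    fun ω hω => exists_closedPairs (X.pairState_land d v ω) hω
  have h2 := real_exists_mem_le (μ := μ) (fun (p : ℕ × ℕ) ω =>
    (X.pairState d v ω).testBit p.1 = true ∧ (X.pairState d v ω).testBit p.2 = true) (c ^ 2)
    (closedPairs d) (fun p hp => by
      have : ∀ d : Bool, ∀ p ∈ closedPairs d, isPairEdge d p.1 = true ∧ isPairEdge d p.2 = true ∧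
        pairDisjoint d p.1 p.2 = true := by decide
      obtain ⟨k1, k2, k3⟩ := this d p hp
      have := hS.measureReal_inter_le k1 k2 k3 hc
      rwa [← sq] at this)
  refine (measureReal_mono h1).trans (h2.trans ?_)
  refine mul_le_mul_of_nonneg_right ?_ (sq_nonneg c)
  have : ∀ d, (closedPairs d).length ≤ 12 := by decide
  exact_mod_cast this d

variable (X) in
/-- The event that the centre of the block at the origin is not designated. -/
def lossEvent : Set Ω := {ω | (designated (X.blockState 0 ω)).testBit 4 = false}

/-- The origin is the cell 4 of its own block. When that cell is designated, a further designated
cell contributes a nonempty set disjoint from the old representative, hence strict growth. -/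
theorem rep_ssubset_renorm {ω : Ω} (hω : ω ∉ X.lossEvent) : X.rep ω 0 ⊂ X.renorm.rep ω 0 := by
  have h4 : (designated (X.blockState 0 ω)).testBit 4 = true := by
    rw [← Bool.not_eq_false]; exact hω
  have h0 : cell 0 4 = 0 := rfl
  have hsub : X.rep ω 0 ⊆ X.renorm.rep ω 0 := fun x hx => ⟨4, h4, by rwa [h0]⟩
  refine hsub.ssubset_of_ne fun he => ?_
  obtain ⟨c, hc6, hc4, hc⟩ := (designated_centre (X.blockState_lt 0 ω)).1 h4
  obtain ⟨x, hx⟩ := X.rep_nonempty ω (cell 0 c)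
  have hx' : x ∈ X.rep ω 0 := he ▸ (show x ∈ X.renorm.rep ω 0 from ⟨c, hc, hx⟩)
  rw [← h0] at hx'
  exact Set.disjoint_left.1 (X.rep_disjoint ω _ _ fun e =>
    hc4 (cell_injOn hc6 (by norm_num) e).2) hx hx'

/-- If the centre is not designated, then its horizontal edge 1 or both of the disjoint vertical
edges 3 and 6 are closed. Likewise its vertical edge 6 or both of the disjoint edges 2 (horizontal)
and 5 (vertical) are closed. The second bound is the better one when vertical edges are closed less
often than horizontal ones. -/
theorem real_lossEvent_le [IsProbabilityMeasure μ] (hX : X.Bound q) (hq : ∀ d, 0 ≤ q d) :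
    μ.real X.lossEvent ≤ q false + q true * q true ∧
    μ.real X.lossEvent ≤ q true + q false * q true := by
  -- Only edges of the first block matter here, so the direction of the pair is arbitrary.
  have hS := isPairState hX true 0
  have hb : ∀ ω, ∀ e < 7, (X.blockState 0 ω).testBit e = (X.pairState true 0 ω).testBit e := by
    intro ω e he
    rw [← X.pairState_mod true, show X.pairState true 0 ω % 128 = X.pairState true 0 ω % 2 ^ 7
      from rfl, Nat.testBit_mod_two_pow]
    simp [he]
  have key : ∀ j k l, isPairEdge true j = true → isPairEdge true k = true →
      isPairEdge true l = true → pairDisjoint true k l = true →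
      (∀ ω ∈ X.lossEvent, (X.pairState true 0 ω).testBit j = true ∨
        (X.pairState true 0 ω).testBit k = true ∧ (X.pairState true 0 ω).testBit l = true) →
      μ.real X.lossEvent ≤ q (pairDir true j) + q (pairDir true k) * q (pairDir true l) := by
    intro j k l hj hk hl hkl h
    refine (measureReal_mono h).trans ((measureReal_union_le _ _).trans (add_le_add ?_ ?_))
    · exact hS.measureReal_le hj
    · exact hS.measureReal_inter_le hk hl hkl (hq _)
  constructor
  · refine key 1 3 6 (by decide) (by decide) (by decide) (by decide) fun ω hω => ?_
    have := ((designated_centre (X.blockState_lt 0 ω)).2 hω).1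
    rwa [hb _ _ (by norm_num), hb _ _ (by norm_num), hb _ _ (by norm_num)] at this
  · refine key 6 2 5 (by decide) (by decide) (by decide) (by decide) fun ω hω => ?_
    have := ((designated_centre (X.blockState_lt 0 ω)).2 hω).2
    rwa [hb _ _ (by norm_num), hb _ _ (by norm_num), hb _ _ (by norm_num)] at this

end RenormField

/-! ### Data of the certificates -/

namespace Certificate

/-- Certificate for horizontal edges at closing probabilities 1541 and 1541 (in units of 1/10000). -/
def horizontal1541 : Certificate where
  outer := 32743
  weightsFst := 0x2bf000000000a22000027100000000c00000000000005d02d1500000000000002bf0000000031320000000000000000000000001fe6072a060500000000000000002d150000045200000000000000001e4c06050000000006050000000017b7000a060500000f59000000000de8040b0914060500000000060500000000000000000000032d00000000271000000000000000002be40000007100000000000000000000284001fd0000000000000000000000002c550000000000000000000000002d16032d00000000000016e80000000006060a230000000000000b6500000000060615a600000000000016e50000000006080a230000000000000000060500000000000000000000271000000ad900000000000000002710000000002d1500000000000000000000000013810ca1029f000303ab0093000e000000002c2a000000000000000000000000156311ad00000000000000000000000000002c2a000000000000000000000000172c0fe400000000000000000000000024fd00e70027000000e70013000b0000271000000000000000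00000000000000271000000000000000000000000000002710000000000000000000000000000025aa0166000000000000000000000000271000000000000000000000000000002710000000000000000000000000000027100000000000000000000000000000
  weightsSnd := 0x52700002cbb000000000000020700000000252107f5000000000000000000002c37000005ab000000000000000026650097006e05ab0000000000002d15000904e300000000000000001e170605000000000605000000001a940000060500000c7d000000000dd401dc0a20061a0121000006050000000000000000000003eb00000000271000000000000000002c2b00000000000000000000000000002af700000000000000000000000000002c2b0000000000000000000000002d0c03e700000000000015c500000002063b0b0f0000000000000f710000000005f80edb02c90000000416070000000005fc0b0f00000000000000000000000000000000000000002d15000004ae0000000000000000210b0605000027100000000000000000000006051689095001320000000000000000060500002c20000000000000000000000000149e127200000000000000000000000000002c2000000000000000000000000017190f6f0000008900000000000000000000000000000000000000000000271027100000000000000000000000000000271000000000000000000000000000002710000000000000000000000000000027100000000000000000000000000000271000000000000000000000000000002710000000000000000000000000000027100000000000000000000000000000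
  testsFst := [(3, 0x96d8000000000000000000000000000000000000000000000000000000027100002711000000000000000001538000271000000000000000980a71000027109c4211900000000000000020800000000000000000),
    (4, 0x271000000000000000000000070240000000000000000000000007026710525e2320000000000000000000000000000000000000000004734000000000000000000000000000000000000000001f50000000000000000000000008c0000000000)]
  testsSnd := [(5, 0x931800000000009c40000000000000000000000000000000000000009b2000000000009c4000000000000000000000000000000000000000898671000026d19c40000000000000013a600026ce000000000000009b2271000026d19c420d500000000000000000000000000000000000),
    (6, 0x27100000000000000000000007dac0000000000000000000000007fb6710653e11c0000000000000000000000000000000000000000004da803c000000000000000000000000000000000000001e5b00000000000000000000000000000000000)]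
  tests := [(0, 0x6805500f4039013806401d0055037409503780fc026c091030407900800680140050010405701400bf065010b069015c03b41f307ac2850074024012c00100500650000013037410d0228144022c10106c8135005002300040000000000000000006002b2049c1d406142870ea03ad010c08f01e406c01c80bb036c076030800004b400001e00000000000006800000a400003fc28b086400508700000f64000000000101280ed00bc06300a403f00d006001c4014027400005d000001d4000000000000e0079023c0b9000024f049c005099c0000ce400e053803e000017800a8083018c04e016007301e80840430159062c24a041821d078c4d0004408100000000000000021000005f8207000001c02680000000000003c00c0048003000000000000000284106036000002881761ecc3fa003c01200000000000000000000004d0a5d00000df0bb800009ac0f200c406b00d8068000001c01fc10003000000390000032c000000011b00001fa0000160000000004d00bf0520000000000006e4000000000000000350000000000000003e4000031c06c073000202f815900003500068148000004c000000002500000cc80ec0000000062813502f003f009402f006000000f006d023c060022c0350474075035812103fc1670038067002803c01540c1023c0c6096420909d825b096833e0c8827400b002c017801001640d302c00cb014400006b40000404000000000001480d7038414303cc2b810604460b20000118808d071c1ae000016a00dc046014002702140f1032811700a00000748000047c000000000000bc0dd0398394035839f0f147ba0bf80000ca000007c009c000004a00b8042027400301dc0ee035411b0158000070800005d8000000000001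445b1038c00007f86c919a04d527800001d7c00000000c8080c1f700d4053021803203a01db04001d3033c107034822e07e83f614583a0013c1160000000009c000006800008e028b00000f209a00000008000015c0590074000000009208b4140024400014401bd04ac1ce000000001a84340000316000000010f028c0bd00000000000127036a00000140094042008400000840ac0a900c503ec0001a2c00007a009c00000ac02982530000295014c00005702800ecc000005800008f8000000000001080560164000006409612c41730218000192411210d40d900000cf0218582000022e01c4000078c000079c00000001661b0024d067c06b0078063004c02c02640f0014c08604801bf05881a2077c2330a04300002002a00d000000d0067001c0eb05b82330b7c24c0b142c10d48469009008100a800e0370161036c10904f404307d001d058813b067820e000001e0000000000000c00000730a182bf16e00000b2c1f60d7c3980198125022410603d412103ec1a5053c0000c2409b042c04f0000072001c2360000000000000000000000a68005000000007d408e05081ee016005e01c001202a405500fc0bc03300000f3c00005f8000000005b000012a0000000000000000000000d2000000000000b40101040c1fa00f80d20040076029410801fc16504a40000d5800003a40000000000000010000000b60000000005803206c4000000000006bc184035c0bc02880b5000004a00e00d1004c0c006340001c4c24c03b400000000000000182003443700000000000000152000004000000e1c02202c000000e00e901840a10534242030000005f40000cfc03705700000000139000000b017423a000000000000011ebc0000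000000000011c045c02100ac064001c16203c41bc000000006b40001ca0000083000000003b40000054000026c0000000000002611440000000000137820b065c02500400020388000051c15c03f01c501b80ad070015e085427f098438b014409a041c09e046025204102a80a3c2ef0c882b10ec83eb0e4c411043c079055009004e819303a821c0590000187006c0644000000006205b84a20000000011c000000000013a800c011c007101c1db0824000045c082083007f04ec17304d0202052800013c80e106f807a000019705b444b000000003b0000000000010dc00000180060c2c0ef05c816104c006a0a3c37105e810a043c21703780001c8024d0a7005a00000d306e07ca000020504d000000000000f000b301640e6227018909ec0fb0290052042c1a5038016e02641a7069c00018e400007400000000000052851601d84a90308000010804315dc00002900630db40d703640310424063049429e05ac28803d856809c00002cd82240a70094000010009dc86e051881f04b800000001291cc82ca061400622702b0066c003035004c066816403d0182053895907c80001d84097093819e000040105e48e400d04bc072c0000288387095003b00640001bf41b2065c00204c808205e413407c82f705605900a8400020740040e6407e000022404cc6880434644071800001d427828c000004b00000b642c405dc064),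
    (1, 0x4a015804ec0cb030010804200f003140f504140dd087832f0d5850804241ad052c1760168000046808c049c1fd043008a05980860b4c14c055812805040bf02bc0e605bc11a03200ed04980f00a7c092039000004580be038c087016c00004d0000036814703880b60a9000b0ab0086046c160086815a04d821704b810402041060000000072821b024819205980e8081000000000000000000011400000001b5099c0000cf00ea049c0d902c807701e800001c00620160110000006c0c282dd04540a102ac0f101d800002a4000000401e025c03500000ba0fc8120061008a048810c062c0e202440d304e015907b828108e42380c2434a0f9032b04840ad06a01130284000048801708f43390b5034f0ce002f14240000600105071c0cf01dc0000440000081029407ec28f0dbc00012380fc05500ab07080b903d000005c80650fa41f50e3c0000ea010600bc05807c42c00dc0272070039f016c00009302b200000000dfc18404cc1b902d408e0638387036c04d000000008e469300002841380000068806507681f105441a203a400000fc18307f830001580ef16740810194000058400008c00000334001016419d0f5871600000001d941b905a402e05741fc05301cb088427e0b4c2a7038419e083c2490dc83cc0f802bf05e829b066c19a07e40070b0005b06340a00c940000ba00b607140f806e41e805240f0089423f0ce41f602bc135000000b113c4310000147058c146057c1a9082005a0d980fb04b019e000008513040c0000019c04ac16c02900c508302310f90369024813100000000b8c34c000000003e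c17b025452909940531e544fb048c00001dc0000f100400000022057419b02b00e60cd8345180424702e415e000000010642990000003066c19904302cd0c8c04b12cc10704d832e000000018b412d0000055057822408801aa09d83520df430c0a1c37f0db036112f8488107403607881d709f825f0d04015173c0340d6459000000ea18540000000000088824009381e60c70000174c2e30be046600000491b80000015c05f078026d0ad43ef113c01e1f3830e1230707024c1fd29b405f0058000074421007282650c7c0001a340f90e3c5450070133170800000000000a9828e0c1c4fb12440002aa85551470ae700e03f8149c000000000007fc2410a9c24e0f140561aa434e0f7c6cd00000c124fc1b800c00000ad430e0efc4ef198800022c43361c585b8000000029f80b20180002),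
    (2, 0x7c05701d00390124059015805a00a4067019002e00dc06001400fa036411902900bd02f408202e005205f41a104a0102039819605f8296009c04900e8000004800000a0000004400001140000000017000002003b815c06f80a6058c2c3072454105900000e2c055012008901380c7017009e02fc074013408201ec06e018c0b4000000003e0308087800003100e000000000240000000000007a43260000000000000000040ab011807b02000410000021000019a000000003200000000001000000003341b80000000027c000000014c0460000000000006e400000f000000a005b013c026009007301c40560074093019403f00a4035019806b035c08a01ec0de01c012201c4073088420e05dc1e004e42140a8c3fe00280040010000000000000000000048000006400000000000000000024823d037c3d3049c486068c44d0be8000088c09d01d813d0b0004a00b405001f805400880bc00e8033000000000280c8000000204d000902e00cf00000000218000000000006142db0000000096800000000c30048000011000000000020000000000000004ac00000000000000000038819a014c19f02600af05c435d0af000002500000a2c14a06e40ee00dc0330298014017c03702ec045000c00000d0000000001d000000c05041b9055815c053818205941f105b816407a418f08482c809503be02000e304bc07302d4082046c259000000006d402e000002b0000058043025a0000000036c000000000007800000000000074010105a407e01c408b03f001402c80d50338185000000007a80000000000000000004d01de000000003c8000001000009c40000000000048c0070380213018818b048c05b048816107a800000e8000000000000000000000000086c8f20000000056400000001d2288400000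00000000000009780f9012c07e022c0480488108068c185008800c02c400000000000264158064023002d4182062c28706f03780c445740b4041c0d603eb0cbc4c901d802602b8000002801402e00a100000040be422b0000000000002605a86310000000042c000000011c16d0366066c200109c2f000000f8023805602540000200064018c0f6000000005880000000000000000005dc3e70000000053400000000000f0c00000680000c701700354039027c000021c09e027c042055407100000a90bc83c700280000000045089064e00000dc074000000000b9079807100e8181242020505b8122003002800a000001d006d023409b004401101b804801e807003280e7027c121037812e04a01f0064427909ac2c20b542940b183600d60383007806b014400802840ef03241300104000038c00000340170000011040022602d823e04d031909200a20b6400005e0000062007f036806b01140a201a402e020c0da036c10e0220134056838003042c80ebc7e802381ae0000000049400000000000bd454600000000d4800601e80d900a8033010400000101a2019812403c8007086406d00a412f0000418036c1d70000000060000000000290ec8000000000007d405d00fc000013805e019c00e003c0ec022009b01a0121033c328032037c088448a01ec150000000003f4000000000009b4533000000007dc00005b415800f805001b4076000022b010c1df03b40000d0031d006061000002f602e06d4000000504a40000174000133800000000001118079082c08f00c80a9018c00001300e602f411b01a01a209d81b3058450c19e048201d01740000000054000000000001698464000000008c8000047827f00b80b6018800000cc39d05000df0454000097c148000027f000005d0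26020a000006a07fc000000007618b004701c400011040ae04a812b010009a00b0000045411904e81d2016c13302c8073045411b08bc25f02d41bc036c0f70768285092c3a10aa436b0af43350eac38d11344c502c0150023817a03b40d405581e407b00ff143c22f02bc01d000000007f455000000000698000000000013b00aa006c0000cdc15102c4001054018a029403b03e81540524220066c00011200000308000000000005d040b0000000060800001e80b01084007000002c0c302a405500e005dc20e01582e20320169065094a0a1c1bc2790519056408d000046c09487c40000104079400002e80cd074808f033000024941a7060808604180ef02c4001030c0cf04381df05540000e4c00001840000000000086056300000000648000000007e136400000100240ff826a084005206001a301f81a804680e408e02ff0b801b61bd03a3032c00000000160c6caab0000118090000002681901f742a301e0000207c1e601a00ec06d4174019411c044413a031022306180001a94000026800000000000470686000000007b0000010009d18c40a6024c1a8158819002c412f07601c8020c175060c0000a0044a040c081156c13c05a8000000010e0f6c86c000007e0b0000001180e5297816b000000009b811e0764109),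
    (5, 0x12c0435177c60915245a717b0928113845818486190b182b315943a1164c557152403e15082730bc80000c5010a0db01940f001bf0e5c1c814bc5a61bb06ad0f14481160047b0f0c37d12600dd110445c133c5ce1a4049e1f8000007a80000398000075c1510eac59a0f100cb07383a3188c4c11bfc67217d84f81a7878d1680599156c0000fb841d0e7c000130c5cc137800012d4575094009e15a05d41e080201410381056c00a1c5859720c470f120c35e048000013243940a4c0631838305050000015082ec086c008174429d000000018000010004000192039105c0041),
    (6, 0x120045b181460112e45d514e40b410603d1154c33c0e1849a0dfc000147c5131e94c7714f050418d037f0c9036910384e210382bd0df81f9136848918945d014ac4f5171c03d13344c8181426416f867d1c701371cfc65b239ca06112468e0df421d0fe44160b8800013a41ea085c03817306021eb0798183028e15a017f104840909d025c0d281750f2844d0dfc44e108c3af0b0000000001b8105047b0a003b411f40f10de43e51a685f81dac69d14b054a0708000123c408090000016700dd0268000110c4d002780001750789000c00014307160c8c04f17d04360ab00bb),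
    (7, 0x37410a03a407906b41f907ac2430d7c2f70e1431411403b8104844104301e105541a909884230750334153850e159456d18085cb136079a05d81e5042012c09ac2f30cc434c0a9c0000fac04e0a540000000000081060c0ea029d148c80a0c9c6350c540001c200a410fc146000003d039c0e203cc0bc0a382d607f43130f6443607b0b0812b8731181485f070827d006c036009c000044c10d166486f00e81311ce819a077c29b028811e02b408505703560cac3af0d5c06f23d824707a0475000012a099043701583f8031400000000d618b803e021c000120c25300000c305641b806b00080b842d30bb838e121837f101c2d5155849212384fa08403ac032c1c50d7c2e60c884731be86a41d2c5ee200872210a47e60adc2f009103530ec846e10304fe0fb80071a203890e5c12501d01f411748030000000090800000000001c5022b03b820a1ae82320b9831407b430a05b04400ce836b0dcc3990e9800018bc0030fc809400001460c284ca011009207c0000000004b162c000085800011302c3000021908442d90e9c33510984e30ce873c113c0001cc80730f802d4057c53e120068c080001d0f90000002406f1e600530a5817d22c828f0a440f2),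
    (8, 0x1d247dd1f8877f24787ef23a877222b4891219095a265c98827a0af220c49ed22489d620c41792a18315242891a25eccb5241800020180b121dc8d92b50b8d2708b762cecb2620049820c641e327f89c400280982088aaf2d44aac208c3252860361212cade06442c42df01da016c04e),
    (9, 0x40010c053c08f06642040a2426d04781e6087815509182f00e5c586117439a0cc439610784d511284fa17e46ea188037818705eb160829603e40d0043c084064820e08d040607d40f608fc11600941a6000055c115024410684fc10546a411505ec12780f61fb03661a6000001a80e005f0168095814f08ec34a0cd03c80acc4020cf83740e505371ca86f50b583de00000d90d30000000000013e868100002641d840f703a40ad02fc11c050406d058c1e80dac34c0cac0ed0cd831f01bc2ab06803f90e944eb03e45790d6c2a5089060117e405a0c0400016c0119070015606141b208181200c042df0bd4383091c1820d181f10d0c3690cc045b109848f0f483bf186c510142c5d61ab43a21f0c64f24506ca1a105a107e02780c8012c0d483b20f604700dc809c17ac38408e001500000000e9461b000024212b80000304000128800009882311a3c1a50c003240ab82ca0c9836e0da03af10c04a214e40001d0409d08bc00000000001108524000021a11780bb04a816513c819604cc2871a682d904503b209946730ea42d8100c3a412406c01f6c49e1e0038f0ef800600001690f946ca00004f013c4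06f06600c1149c00f01d02f9243024b0e643b4),
    (10, 0x104021015c03000a00070080018000003200c4033007404f008001f008805601f40270314084019805301dc0a300a4022011805700ec01e042013903140e405000c603780d2019c026003c007024009102f410d04ac11803a80640468119041406801800cb04481a8032409504100eb00b0028015c019009400f00700000004039019407b007004601140580014029000c0010000000000001b01a402502bc07e022c085039404a066c1d8058c22606e01e306901f60910224086025f08a42680a6c2ec05d4234089020c0ab02b30750217099c4580e745370d6c5d60de0475020003a02a40a001a400301a003f000004600e004b013005600dc04501440e503e407b05240be03c80b202f80a10268049017c098025405b01740d700000000520103000004e0208000000000005400000000000052804400000000000000000000000000000000000000000000000000208054000015a01dc019028810700401cd031074a03e03670b9439a015c07c08e015b0718146001c009078c3fd0ebc654110c73520ac5c202742500000000077066400000f7091800000000000cb4004000000007d417800000000000000000000000000d600180d300881be01c400001a4044029000301a000100e8000000005a00ec098022c060015c068000007502f003b00c4031027802d05d010907b825304d418e07b421c049c09104400fd000010a01a017b034413d062814e0aa04cf177c89404cc31e0a3440d138894f11d07010c5860915348f91578a7e1d04a67012009c00000120000000000000000dc0af04b811d00000000000000009c0000000000016c000000000000000000000000000004b000008c06f0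1aa0a403840000000003c0000aa467f10ec766000000003ac00008804e6000000002341d60000000000000d023803f00000db0004108015c02c028404500ec00001b00000000016000000a00500180000018000009a018000806d004a030006500f40f603282e201802e9048413500fc0d2000000011e801300000150598000000000006b8115000003b07c40b6015c00000002190310000000002105e024f000006801ac011025c02a04b4069000000005480000168319089c10300000ab096c0ef00fc000000000005a820603841d10000000000000007a84e9108843b028c06c0000000000007400000000d7001a0000000006400000000000aa814d000000000000000000000000000000001630000000000000000100230044000002000000000000034035016c09e02bc000007807b018416f015c0e8000001e016812106881bb07fc20c05c81fc08942ae02f007305581090038000054c0d903001bb074834407981b509f836406f430309842df0a302b30e043f00a903190d3c3d10e0855d11ac613000000000000000008000000000000d800d02a410004f0000035414f0000042032c000000000003f004506481760a0c33c060c2e20d3841c04481ee0bc0307077037108142b90b344db10e46de15286b5131453109344b10c4049c0c8859c101463f12a056e13405d31724ae51a5482d0298051044c027016c000018800002dc08a02840ea07680f00364084040c1e5042003104d407a090011a04f013b062411d051c285067c2e7008008700000000bb823a000012f08d800000000000e640b905740e5096416d0000000000000000000000000042035c0a2000006d080410902c006a0a9c2290000000000000004482ef0f0063c0000000000000002e4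01c000000000000000000000000000000000000000000000000006a01e7000000002140210000154127c29e021810e00002b000082600d402e802800690110151051c2810000000074821d09601dc098835e023406402d408e0178000051000001480a0021410302ec08304401f802c815202bc02c025c000040c00003580bc05880f501c00c804c8158000c14400000000c381bc000000008fc00000000000b7c06500000000910108000000000000000000000000000000000000000000000000002040110ad00c6013800006a00000308236081c1cb00000630418025022c00000000000024000000000000000000000000013c005026c0760508244012805600f80a600000600fd805500001a602a019901841550f0c30705a0078021c08504a415600301f806ec29604e02160710189022c05b02800000180000049000001b8098027811705e40d003581a2027418d053c11406d00c00000015064c1a508b021105683fc234c57b000409e000000010ec39102f82970ac80000000000109404c035410c0c8425d000000000000000534304000005706a00b2000013a0fe42d0030805b000c00001dc000063c000056058c1e4451800502ca0f180fe06780d20000000003400000000000000000000000003701a40c701d80b0823c01d4000011813b00000501240000001c2640000030000009f0b243c3053813e004400001a80460000101053410b01140720004064),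
    (11, 0x47010a06d413603b404d05600b103b815e064c1a606d4134078c18705001fc078019005e012c072c1a107a42330a3425509202e80a702f603b40e002d80d600b000002e00d800a00ce030c24d058412f030c0fe082438b09fc2df0c083600e804200c343eb0f6853b0ed851f135467d03cc0ab038c10703a807502e00c4071c2b109943d60df83030b4846401d41bc048c179059c14006201aa0cf83ee0f1854510845b112e862307482220dcc34b0d3037310683870cd8440135c59517704de18386c80ca850a16745630ebc46f1ac871118006e020209271afc4d526c8b2405501cf059c07a052c061036406003e808d02500b208f00d1055000006742a8066410805cc1a50640193066019308101cb07d8292097c2e4026800002540070724000038c01b07e800000000000f780df00000000b6800009d80450ae00a30d60078000001e017c02b00000000148000033c11c047012302440000358033094050c0a8452a09b46a30f545fd077c18e0420261031400004dc1fe0be84130fe454e124ca8c18f462c0bf0062068c004049c030080c0a210e0000047829f086c000012c2ec0f8407813c80a300000bd0e280cf000c00000940b600000000794166057019405700d8092c1c6023407105d815f05ac1910bfc1f9050422004e422c03c811f02c405d02c012107dc27d0a1c31f07b434b0a0040703840cf04a80cb0000000080400007540e9039015b090000000000000a3036e0e1038b1bf0b2e1bd463f0d9c54516e0903156ca6319f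ca2803401d702e00d50000000004c0000aa035a09243af000000003700000af83b00000000005c0cc000000000000000000093001003000000050bc812a07dc006051814a028c0ac116824911a0223066c0c102600270e2013d00000a4000000002a001f003000000080630000000000002d02e416603c80a1078000001b001c05800cc02ec0da08544e3063c000062426e02b817202d881f030c3f4072421a092c492080c46807d852f0418000036001200000240ef01120ce003a000005c0000000036415a085c1030bb00d218b84fb06b40c200000a6087c289048050d0d5030103d80000328005000015f01e81ae0a745b007a800000001db05040000db800000001430074000000012d0000000028007c03243ec026c0000e580a10000003077412503b41720f300000570068095011b005c04808c80ae07900b40000001020c044021c000000000000000000000000),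
    (12, 0x74017012801d008800a00a0018009004201b806a019c04c00e80290024056012002000d8047014403102c0062020c0750258072041c04e006400c00940000098011006400000000000000000008c00000000000060030022804900bc05c017403102440ca03a4184011815f02680320458102047c11b035c07504300f003e01680548193052418c056019901dc12102680ec03b40ea02780a504a018d056c1bb074426304f01a4075c14e071c20809d0149082823b04d422c08742dc09c02fd0dd857909602870b842ea0e982eb0c404b50c2847e0f7445d11148291b6860a01040410194000003c0000014000000009300b001c00e0073008c0000000064007c000008c0000118006033404f03800b202300c202c00a90038000000000000c400000000000020027000001a00000d5000000f00a4000032000000ec00002a80000000013000002000001c0000006104d011104d811b021835a03c01e102b83f008a87d5068c63a116857e034426e05e02c1050c59704b825e0a544740e1057512f8b111a147a707580000e240000d40000199801b078c0ca0000000150043b000009a0b2400015240501a3809b12ec16700000f700d4047000048807bc26302500870320074012000301b003d00cc10102e811302f40ce01a007d00680970174031016c03d019c02902e4058023c05a02fc0be011407f027809a0000056010801b000411000dc1fc08e800001d828f090826301f0178047c1a403a42190ab81ca07e44940f207e70e0c6651a38525019015c000000002f00d1000006005fc00000000000388000000000003500e000000000000000000000000000000000000000000b000000005bc3090000000060030d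00000f7088400000140020a700ed01f802607a027600000000000000000018f0000000007804200941a905d00fd01cc02f027c04800d40040104025000011500001280180000003400000000690040000008003600000000008000016c19b009c0410694111019c000002c000017c000015000000c4000000000000f800000001b303680100c0408d0fcc07c0c4000000000ee00001ea000026c00000e1012c17e000000002dc1c200000c707b0000000011306e4117000003704f81450000000000000000000120000000000001d00003b502b416c00640000000000037c01600000000cdc00000000000e0400000fc0aa0c4c00000000000000000000017f000000100f0000037c0e50928154006801700d80000064000002400000cc00a011407d0598012036412200d4088023000f0110000024801305e814e07341c806641e5073c29300040080000000000000000000000000016023c0fb017c000003402300e012f033c0a8015403e04a0193055c17e084c257052c2530bec3fd03040b903c40cb029805503600b6063c1f1068c2bf0a6823b08482ff03f01c206881ee061014a07e02aa078c2cf0b0439509dc3fe0ce848d03a41c709c420407784bb0c3436b09503100a983ee13ec67c0f145f30b9044110f840b110c620199c4af0f8050d136061e14548f716dc718023c0af033414a019c01e027800002400910224179041004301980be02041690460076037c0f2059c0f2049c0dd071c2a104c4173075c22403400c60ab0130007000000000000280000000000002a00000000000046c037098003c0c802280a9001a0000047000007d00000000000000002c2870000000034c2930000000092000000000000a8800000000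000930277000000000000c000000000000000000000000000000000000060c020003000009bc20000000c50de4127054c0000b642f6045c1850dec09f00000a407e411a04941ac007413609781c008fc22806a011b029006e034c00000d400000ec000028413102d420706080b4011016e036018b033c0990240134031c1fd048412a05b01bc04b822f045824f02800000a64000023400009a00000300000000000003180000000000057c0000f3c0000e2c0001b200000000000000000000000000000000008c188000000000e4148000016508c000000000000880000000000008442b60000000000000000000000000000021009d000007d017c03405580570000005050428200001630d5c00002e82540df006903a417a0fcc00202c406107d40e305581320000249056413803f012901581c8022011c02842ba0144001008402a015c18704bc000045c122058409c045c30c039c05f038825504dc0e00688202091897f077039a09083a705ec1450000000019c06f00000aa0534076000000007b802900000fc0b180a31ff426517f82da135008d00000f1000048400001ae00002a00000165000016c017c41500003910c2400000001780e3000300000b70d8815e0000000000000000000cc0000000031412101fc1e0020016c18d400003080000bb4076031c0ea0554000071410517000f2008818607d0113042800000001090a38176023c042053c0a108c808b0554161),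
    (13, 0x11c84fb126430e12445190d38394129c3fb0f4c5651c101f70af84361618685161040716c84b5163c45d12dc4b814446c613b050c14a45711480712186440d0c803b010043971d403770efc3661fb42a50c842cc191473f179441f140449f1c6c2f814c035812204290ec80cc030832312004a2109c28b07bc5a706601d613ac43f0ce446b193400008700ad11ac62817e83c619f86af1ca836d110439a092c2cf1154330000032114d893c176429b000012306a013b18b400004104a9013001b14941e517f87f9000000000001880348038024c08a00bc0000000000000002c),
    (14, 0x1268562111c348162c4850be43ea14a4557122456d19e43cc0e043e5168c6c3103033f0da836210bc455112844410c44720f484b412d84e218c44ab1540350264c7b40ae4388167849a1568624220c3770bd82f219e06cd0a2846403f80000c903a013c81cc099409008e01830d702f7117024411043ff14585d30d002eb13645dc13c06b11870511125413f17a03bc0fcc2de10ac000130810512644b310d003d10c875b18a03a6257016d09c80002adc5a81334240118c0480bf82e6271c3a8000021e15b418a03982f8000c208108435204cc0000000000000000001e8067)]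
  scale := 25000
  value := 9615446

theorem horizontal1541_check : horizontal1541.check false 1541 1541 = true := by decide +kernel

/-- Certificate for vertical edges at closing probabilities 1541 and 1541 (in units of 1/10000). -/
def vertical1541 : Certificate where
  outer := 44502
  weightsFst := 0x2a9f00000000000000000000000000002754000000000000000000070000000027100000000000000000000000000000271000000000000000000000000000ea2661000000000000000000000000272b002000000000000000002603012d000000160000000000000000271000000000000000000000000000000000000000002710000000000000000000002710000000000000000000000000264d000000e80000000000000000000027100000000000000000000000000000000004f703b82219000000000000000026d60000003b00000000000000000000271000000000000000000000000000002710000000000000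
  weightsSnd := 0x33e7000000000000000000000000000032fc00000000000000000000000000002c7a000000000000000000000000000031b9000000000000000000000000028a261100000000000000001d390000000009d70000000000000000000000002820007b000000000000000021bd0000000005530000000000000000000000e10000267000000000000000001d4b0000000009c60000000000000000000026e700000069000000000000000021ba00000000055700000000000000000000092501d21ccd00000000000000002710000000000000000000000000000025860000014a004100000000000000002710000000000000
  testsFst := [(0, 0x4ac000000000000000000000000000000000000000000000000000000b00bc0000000000000000040000000000000400000000000000000000002000000000000000000400000000000000000000000000000000000003001c000000000000000000000000000000000000000000000),
    (3, 0x33c000033c0000000000000000001b8000000000000000000000000033c000033c000000000000000000018000000000000000000000000),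
    (5, 0x1000005e800000000000000000000000000000000000000000000000000000000000)]
  testsSnd := [(2, 0x96000000000000000000000000000000000000000000000000000000090000000000000000000000000000000400000000000000000000000900000000040000000800000000000000000067800000000000000000000000000000000000000000c000000000000000000000000),
    (4, 0x14c4000195000008f628c030c00000000000000000000228c00000000a3c000067800008e628c06780000000000000000000000000000000),
    (6, 0x16cc000173800007962a10370000095c00027f000008aa2a127f00000000000000000000022a100000000010000000000000000000000000)]
  tests := [(1, 0x16807e034c0b403400af08341ee05001f504942e904082e7083435001e80000080000005c00907a81d6020022e037c22a03982480dd036f007400e021c125040c0e405ac222000016b01440ef0d7400108201b500b40a605e406e00344ad0a2400800b421908040f40d0009e0c981270058001072008d023014c032026e000015f0ce400001b80f109281e90080082000047603fc04609c800101242050f640a306ac0cf0d5414600840e0030020006ac10708f808f021c2e005cc05d048800a0ec800800c41090c9c00203f402b071c145015029e09d400807f0013088c117),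
    (2, 0xfa832911945480c003ff129c42f0b9035515880081228a5415b80080b7427b16540011074aa5166800312303171dec0e41be8014279c03c),
    (4, 0x52811f0a7c24507ac2510cd840f02c817807c830d0a5c3540f3446b023011007a427205ac2760e5408603dc21417a82ae0b242f1143c2a902ec190079041708d45b41058229035c0010b8c0e70e08cfe171404503240dd10c42260c90488172c05007d015d18ec23d17703412108209),
    (6, 0x4fc10f0ac828207c025b0cc440402ac0f507c035d098033c100046903340e007cc45008e45bf0f3021702b40000e200e70c5cbda17c404b01640d307982c405cc2c10f300a002c81c4189424e0a542c814e025f061808c0e042bb0c7840f179407b06542671af01ee152443a21cc1cb),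
    (7, 0x9342970b3830d0e004f808080fc09c033c0ef044311983141a5cc3d08a4358128c6070aa055907a41da092849d1ab47b90318a3007bc115),
    (8, 0x8c829a0af030f0de85a307f009909e03560f18483115420e1a98bfd091438712a85f10a9856c06f422509e850917a46d4000cb4c07b011a),
    (10, 0xbc425c0d2c3a509e8414134048c0acc34314e04bf1558549155470a078034f109833c091c0ad0b6c00108e01280d800010c600240000089),
    (11, 0x11408003c802300bc01a000c003006c0410048000007000d0000000024801701d8086018c0c5033430805080230a984d606682a610584f1021001002d40d303f001907702b5019810900f81e009e419308e825107141a5077830304e83610a3c31705c020a0a4c34a08541bd0fd0366012c02805881d1006010406a425a007c0c6068c28c064c13d0cb837f01ac02907381b104cc0df047c11503642da02780d40c50205000400201a406907641be039439003040ec06f00aa04241230a941c2000c00506a42310b30299070005a06180c8091804a06a40f2035004a03600c0),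
    (13, 0x4c80cf07d82fe032018308bc3c604f80d70cc44960a0c2b21434778094c2380c8848a096c5ba15f866309ac361139479a17b082c1e9cabe021020a05dc288044416809942ea0a2c0010f1cf8c02a42e80e9451e06843c40c9838d08e42fe081834a11181f4095c19d0f283c40860405),
    (15, 0x4bc0c5081c2c905480cb0c6440802c816908f83af09e82c1142c70e093c2390c804ca09a43c613647e909585fc163069d183081d1eb4aa401e41b0065427c08f000c0eb0e5603e01780a3438f03242d80e584bc06083ee0d643dd11481f408e81a809c82df07bc33a10ac3d208e041f)]
  scale := 35000
  value := 23190262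

theorem vertical1541_check : vertical1541.check true 1541 1541 = true := by decide +kernel

/-- Certificate for horizontal edges at closing probabilities 2320 and 962 (in units of 1/10000). -/
def horizontal2320 : Certificate where
  outer := 32743
  weightsFst := 0x3d0000000003cb000028c80000000000000000000002e52ad20000000000000001000000002a9f000001f4000000000000000015f408dd08fc03050000000000002ad20000029e00000000000000001f8c03c20000000003c20000000011d100010a860000045000000a2b0000000013af09f300000000096e000000000000000000000118000000002710000000000000000028d40000000000000000000000000000273700f100000000000000000000000028d40000000000000000000000002ad201180000000000000b2e000001a603c21085000005f600000a150000000000810d8807a9045903410cd40000000003c21352000003290000000003c2000000000000000000002710000002cd0000000000000000244e02c2000028b8000000000000021a0000000015ed0aab009a01370184032500000000000028de0000000000000000000000000f181449000003af0000000000000000000028de0000000000000000000000000f221397000004570000000000000000250200a70008000400b400a70000000027100000000000000000000000000000271000000000000000000000000000002710000000000000000000000000000027100000000000000000000000000000271000000000000000000000000000002710000000000000000000000000000027100000000000000000000000000000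
  weightsSnd := 0x47000002aa000029c7000000000000020f000000001d3d0d96000000000000000000002972000002fe00000000000000001bdc05c302eb06490000000000002a500002017f00000102000000001f8c03c20000000003c200000000125a012d08e1000006ce000008c900f60000151209f200000000080c0000000000000000000001f300000000271000000000000000002941000000000000000000000000000028f0001200000000000000000000000029370000000a00000000000000002ad201f200000000000010d40000000003c2127a000000000000123600030000002c0a32050d01fa039610d40000000003c211ff0000007b000000000000000000000000000000002ad2000001d30000000000000000234e03c2000026d00000000000000040000003c216440731007c01c000be02dc000303c20000291d0000000000000000000000000f1117ff00000000000000000000000000002916000000070000000000000000116e12a9000002f900000000000000000000000000000000000000000000271027100000000000000000000000000000271000000000000000000000000000002710000000000000000000000000000027100000000000000000000000000000271000000000000000000000000000002710000000000000000000000000000027100000000000000000000000000000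
  testsFst := [(3, 0x784c0000000000000000000000000000000000000000000000000000000271000027100000000000000000000000001ea500000000000000784e71000027109c412bc0000000000000001cc00000000000000000),
    (4, 0x27100000000000000000000006ccc0000000000000000000000006cce7102d7525a000000000000000000000000000000000000000000514c0000000000000000000000000000000000000000012b200000000000000000000001340000000000)]
  testsSnd := [(5, 0x70c400000000009c4000000000000000000000000000000000000000779400000000009c400000000000000000000000000000000000000067aa71000027109c4000000000000000000000271000000000000000779671000027109c4154d00000000000000000000000000000000000),
    (6, 0x271000000000000000000000067e4000000000000000000000000685671050cd6c70000000000000014b400000000000000000000000059840000000000000000000000000000000000000000012f000000000000000001400000000000000000)]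
  tests := [(0, 0x15005c01c006001a006c010014806601b007e008001e0000000000401c0060025000802401741e703380a002a404300380b900300bb002800f00e8006007402b003001703d40c5012c0dd015c0ce044414f003000f0000002000003701e826a046c11201700fd00001cb044c2dc000004b006c036005000f016000b01b800002100000000000000000000000c40000208030c00002e000007a8000079c0000354000000000000380110040025003000200140000210000033c0000000000000000000bc05b00280fd00781a002f0581077400005f4000022c0000000023000000f009c015008402b006401b01940da056811501d403c04a4231000001600000000000000000000002400ed0000010014000a00000000000000000000000000000000000007811409f41ae0338029145c0000000024000000000000000000000035808f0000037041404900d000c001000f003402d000803600841860268000097000800f0000000027600440f70000061014c14d03384040690000001402a04b80ba028c000000c00900000000000000000000001100ca04800e5038012e03e029300040f10000000000008000001ea091c0a7000007d032c0e001a8000000000b002000100b8047008803c001c00501e8060026c0fb04140f60020034002801201480d5036c10d076012f05b816a05fc1f10854183001800a0088017008c07b013c05d00cc00002b400002c40000000000028008e03f80c302cc03c085007908740000b4400002780b30000128000c018007c01001c809601b00c00000000043800003e80000000000002002e036806f033c276041418b091400010b800003380000000000000000d00ec00400d408f012807d000400004d8000082400000000000000024051813009ec00003f40000e4400010dc0000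1280a900001d5002c01600fc01c03880bb05980c2000007a065026006a82410a18346009c0ac00000000204000000000005a4131000010c071c041014c000000001900b80cb000409016ac01804040000d780000a8400005b80cc05f841d00000920a500000028000053400000000000a30214036c010000000e004000100ec07e00c005201dc00007e400005a40290000000037012a00000b601fc02c03580cc0abc000000000003c0000008400000a001c010800000f800e000008203b0000095800009940e7008022805c81f6000000003fc04604382d30f94000000000002b00c8072c0a9007403600a802d01ac0ae00d004b02400f303f014a04fc153069821d00000030080000006407f006816f02a00fa02940f407141ef075c2230000000000000401f009f00a4028035805608f00e7069c158070823901d40420b64005033410003ec26804f80140cac10e06ec00005080000018074018c07404280de02dc00003bc00005740000230000000000000000f000000190030000000000005640000000000025003c0000088005403d015002903600cb019813101cc000092c00004e0000000000000ac0cb000000000a400000000000a500000000000062000000000af000005102c004a02d00d000181db03600000e3c0000208000000000000000a800000cc01a800500000140528000000000005a00b8016801400000ed11540aa017c12600d83f90ab00002b6805c058c00000001c30abc47f0000126038c000000001816c000001000cb0e88031002c023000005904ec04a022000000000000318000154000001ec0000000033000000f000011f0f9800200000000ed40000000000057007302440320000051009803802d81ca0018475035c00017940000600000000012900000be000000b0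7e00be00000aa0bc400000000000dbc0dc06e80780000000022800004ac12503c81e0000002e06d815d070c26306e42fd004c01805a811c05902680b842d006cc0ca07201f90b882bc0ca405c02f0025043c102056017b037c493053c0001b0008f05f000000001560e6871c030820e09ac00004fc15a110001d00000820c44106004000001c40180638035052417d04b8443041400014b80ca066c04e00001410d004be000024b074800001e02461100000000005908a0114031805502f80460dec054068c11d01381f605f0000251814d095003e000024e119474d04dc41a07bc00005704df161800000000dd02d40d7000c00000e001607880ba044c19903184c109c0000167805a05e00000000000115c64f01f42df07a400000f810d153c00201ec0c90b8400003f000000200230fac027069c26800f826b0da400024900fb0754000000000019ac92105643240d1800002641c320cc03f01a805e0e84055066c00200bc050092800003e434c16d86e1090c00017b800011a807100000bd0e0060900000ff12b40000864417139c00000000000bf812806d803a00000271880000024815e00000000cd80001dd800015e007100000fa000c00000000cb20c400001241a91d44000000000002dc06601740b9),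
    (1, 0x14806a01cc07800e005d01400a800c804c0190098024c0d5031c2c4029c09002d408b01bc023022808401541de01a8109028012900e00fe01a406a01cc029014c12c02f80a4017c0ad04440ba010c0f50604000027c0ec025404b00b400001b4023020017e054c0be073001d000000002700910304068014409905d413f01600fa000002a03581720000000000000300000000bf0000000007a06ac00000000c300000160128000030c0a703f40900270150039813d016409b001405206d0000036c1b201400ea02d808401fc000027c06d01340ec00000fe08ac00200a0000028c075033408e00900b1041018c0524189063015408381790b3028002f01c603c019802c8000023000e06d41a4081c008096c0080cf403003800a404000cf023c0000268000071418c07e001907300000d0400c03640d003d811305a8000042001d08700000f8800001b4027089c00106dc2b809fc2bd0044017000000006841ad00000190490000015409506e8704038064c092400000000000a745ef00401840ddc000051000003ac0ce03980b904ac00006f80e2068c19c00b005a0d9c00003000b903640f904b021609c8000037c15f0bc81980c4c000106409200000a0035c10202d40db05441a2076018401940f8040816b08e42c5066c2c8053c1ef091c31d063000007500080000000001c00004c0023025c1b0042810e03340bf07d01f7066400602dc0ba0000000075c352000000003e00e504640a3067401807c008d05081b600001530e54073000009502cc0db0670164067c16b080c03f02f407e000003609e8326008400b06800e323c476609ac0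301a301ea030c000000000010e41640000017030c0dd02ec0f007602490060000053c0b20000039011416e0048000035811005f420c0a6027306300000d441e400000000fdc0100000030041418f068418807982d60b4032f08882c10bac30c0ca80760184000065819707ac0000cec000156434d0f70617007c0001264000000000006601a5070824d0a9800016282000b684e4014c0af1338000000000007d4169126812e10780081f5c2ab061c00600000f714440000000000065419406f80000e7404b1e6c0000d38508000019c1298000000000008e416108d400011c40001ec058a130c568000029012d0000000000007e0442076016f05a400000000b210f066c00001d0128400200000000000003008800006e00000000003038c000000000003b418804d0000),
    (2, 0x2000e0088020002c017005800f002c012005401e000001b00501ad01480830168072008c00000b002803240c9028804400c402402c406e00600230064001004800e005c0240000000006c00000000c8015817001a818203041300234160021425f02c8000053c061041011b0630115002c01f016803f004c030004c0220000021026421d00cc0bb0168000014809500000000034000000000005bc1d10000000050c00000000000044025009002c0000004000818d00a80000408000016407c02ac2a0023028d000000000a4000000008d047c000000000004980000000000002001200580100028018005001000240220060010003405e0070057037403d02e80b400d015b0180071031c0eb02c4113009c0c300100360000000000000000000000000000000000000900000000000000000500a41aa038c22b016c6f60024000038800001e400006bc014046400000c002c00a00290070024003003602a400e00e00fe0000111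076853202040dd0000000008400000000000748158000000003e800002340a70004000001400000000000000000000800003d4000000000401781d40154196031813202b8113045c30908a000002e80230474022042800000a801f01480280128013020001500000000074000000c00001700ed02ac102031010e03a413303c81f702dc07803340a505f417207941a50070085023403b024801002f81a3000000002b80280174000000001502f833b00000000270000000000004dc000000000004700150170000009c02d023005303180b202e4001003000003cc00000000000000000032c10f000000001ec000000000004d4000000000001b400000000000078136024805f034400a06b40000000000002c0120b68000000000003144d00000000023000000000990b50000000000006c808c013800e0000028000400002d005703a40ae01ac2e301c0000039013503f42cb03d820701b80e9073c20d05f01e605c830303940ed08542160000000011438003e800a00c002703802e00b5808d0fd806c02ac013000004809f4965000000006c0000000037a11000b600000280f4c02c0000075011800b013c017029006c028c145004c000032c00001280000000000027820d0000000045000000000450a000000000000055000001740e1005804301b4003022002f03504410008000026803b0590001039c15a04205960000000051c00000001810ca800000000000df818606f01790010014004c000013804b017c068009c01000cc03601a410b031415f00a005501080a9035c15c04b817a06a415b05b819f069422c08381da000c000004801f023816d0038066014800002c80000104000000000000000e9022822d0500218083c1d705e0000059000004d80230024000006c038008c0230194095021c0ec00e40d000c80940308194096815200bc10b0000000045000000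0000009103d9000000003f0000004c000002402c006400700900710174034039000004d0010018c093000008e027c1c70000000052800000000000acc000000000004240000000000005401f009801a000002f014405103580e902140b30170253003c0a700ec0ae000000003480000000000081826a0000000030400004c01ac006402900f81c2000063a01c4000071400014a407f091c105000015103f43ab00000000b5c063001409d0810020000000004dc0b106e00ad000002a007c0060074046018408800001dc014c1060a601860000000008c0e30000000073400000000001058372000000000c000002a8138027404800b4007012800000f00920794000076c00004801e4002028504fc34d000000006c80000000202116c00a0000000028c16c057c0be008c046000000004540fb04701ad013415200380d304342db08602e8008416901b013606801e908842d007481e003ac1e60a7431409f0095023015000c00c703b010a06204d911e80ba186422a07e402600000be0a8857400000000560000000000014580ed00140410c0c109000000002cc148009c07f03c4152043c4df0d780001328157072804600001c006284fe000001004f0000013811f132000c000400009e4073036003802341f400e403c0270667061070011b80001b6c04c10e020300003f80dc8692000000010c4000000005817f400000000000bd0192038403e040009900c813e03a811e043442a0ddc10c1b581f8098813100001a8065c6700000022055c00000000f11110000002c0000aec000066c0000250348010c000056809d0774250196018824c41f10cc40f3000024a0ed0868000007f05b8000000c000203c08b00000000ecc13806b8000040c2b901cc065046c0790370133114816e1b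b41a905d0093000046708587dd0000065081c000007820b16f800000000000378000028c00000c443c011c000000007305b0000004400003d400121240d300001bd14887400000000117000000600ae1d240000000000054c0010564097),
    (5, 0xcf83560f8c395105443e126c4b60d9c3550c3c1180a682510ffc49c0f3c436125400005a409c15ac0eb0c8838b11640ba10303941568103115851e15d85e113d047915f07bb0e8439816807f714784681d0498f12d000011a40a4000000000002f80c5c38a13f42f010c82ac1bac45812c8471177059314044c8173c5ed138843e19280000f0840f155800011683aa170c02b13846a20f9000013fc2091a1805a163c39e14c403a1a405c31a0453513506160104000124844c089800016a86dd148c00013ec93a04c4000158cd9200f000003ec204048800014184b6232c105),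
    (6, 0xcb03500f243bb0f1443c11541030ccc3440b0c0d60bc439810b80a20e903fd13685020a3805a153008c0c482f911704d30df02c0153011b10583eb14e451112183f1189806711d43a9189800e124c1b81ab000017cc5f91b2c7a0152c72513640410fc4462160c00018743fa161413d135c5b6171867e10580000fec1f80f903d417b08770d1442914e8288141c44517e07df0048000000055212d849b1cc091013103ea1c04696197c5cd1950525142c9170530000125041e0860000077c2cc03cc000138c5cf01a8000189ccc600fc00017987dd18940001804509221c145),
    (7, 0x1400570114031035816804900fd08181a50bf01de0d8427a071027c01780fb021010f071c4840a20a180bbc24a0bb834212b842e0bc843001f80b1011c057059823608b41b3073c0000af013006880000000000036c3e4037c2c7073462208e09e90e840000d2812d0da410d000000001140350110007030c28f00000000e443080fe43f2000028f000062b000002301d807805dc0f507e031900001c301680d40ee031e00e40000118035006803503b017b09d015c082815d0e1027c0c84224052430d02142d602f432d069823f05d84aa0a78158001c0ef11b028b000000003241ee01f0054096428c0ac05220c5023509a83720ef02d90da4361035012804c01840a682b40b6405707c019304783f2139839303e83db037c1da02fc1eb0c0441516846380a380000d741d5094c0a10390283196c4ed0e082ae07d400000000000a7c00004101411060141065412d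03f823300001fd0d483b31918434093400000001d00a3c2ab13f43550a601210ab02390914000000018b000000002b41570f981ee03c411002f018704d413019986820d88273070000015582ee0b602770b3031125a883315504c90004000060803c000000000000000c3417008300dc),
    (8, 0x10a04a412d459714a44e3166c64d128058f12505800eac20a07542c913306a716b8a2f0ed408818382d60f945680b883ae05a4000000006e14906741a709ff10dc35f16643a30d7c571098823406cc00000000cc15249eb2a14b4612241c9139816d0bb04bd06b40ef053c01b02a8011),
    (9, 0x1400310168035030411b057810701cc0890454120081025412a489508e02e907202180ec82160b143090bd030109ac34c141434e13004bc00f402900e40000228000069c000000007e014408a096c223083c3ba0cdc4d00a4044f000000007c458f00000a408880e210940000db403c022404b032007105b024a08f8200099007e0ff82b3043805e1a90826070426c000018c082405b00000000b3031a002012a10a800007e002500800400174027032c26105f812a02400910c8c3fa0b601a00b7c3fe08a832305102de0ce420e08646150980023057c047136003a0d580590398061090c0b30a242d50a8c54805941f804dc1f70c0438b0bf008b0ddc2ff0a203e710643b00bf83f10ae011c061448b15081261098430036c00009681f30e446aa0f6c4ce0bf02c7014022e09a4000003c1af0a7000000d42630cf842c085822900000f20000143113c0ba0b8024503d40bf0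8781e20c2c6550f146a21a344af164437707080080000000093438600003130ab00e301fc1050be826203e0193136425b05c8206039808307440f117143ee19b02fe24a8604220850800002510000018038c65000005a00b942a60204144000000001a40000ffc38a08441fc),
    (10, 0x4009004c0100018000002c00000000140040010001c019003c01200b402200e0036008801000bc02800500100014000002400b002400700e80da017808301fc02a02b804b0010001000000000ac0150054000025003802ec01302501c102b00400034049015c05903c80a500b804a0004009005000e002400000000000004019007002600000020048002000000000000020000000000000000a002204640e904840f0060400002ec0af03ac112039012103c40f6068419f05cc19f049c1e705001780330118038812d02dc1bd02c8119058418508a426a08f021a05281d50028055014c032007400000c0000000000d006400a003801a004c01d0100058022803f01e80a0020803b016c02d0040033019000100dc00101980b4000000003080b400000b4005c000000000001bc000000000001c00530000000000000000000000000000000000000000000000000012000001cc178024802906cc13f00003e400fc00000a44ae0494231009402100001bc0054472001014c068c257188858310dc2b926841f2025801e000000004dc11800001f3064c000000000006200000000000055c0a400000000000000000000000000000000000000000000000000074028008000c00b000000000000000010002801c00b4004008c025004000000ac051060445c051410605ac19106302f3092c77608d054000d404f0198086057826c083c120008c111037406207c8470082c2ba04301ba0ca4334182ca7b1a9864c0b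b07d216f47a81bd0f961ef08bf000016500000000000000000000002d428b03a415a0000000000000001b41910000000000000000000000000000000002b0000000000000003a01f905c018c0000000000000006301cd104c3a7000005a049c04e06fc2b40000000000006900000000000000003400200e800000000000050019008402500a40000060000000001f00040120038096006c0120050001010802701740f300c002901680db022403601a007906a805c023408300000000604115002011501540000000000083c022000000003f80e70000000000000000000000000000006c021000000001b0000010802d03c80f60000000016800001c01c203f014d00000e404f012c02a402700000000000265039801b000007309003770de01980aa00b801880120000000001800200bc037075400000000000000000000000007b80dc000000000000510000000000000001c400b0220000000000000000310000000004000000000000000014011c090014800000d00ad005009a00e40c30000008015808106ac1c2079825305f41b60930441004c053010003200340000340000008017506842dc01f823608f428805141cb090022d06442480a6431809f83da0c7049c0d5c49010845db000006a0000000009c152007c00001ac22b041017907482ce07441e400cc189046411908243b1048c1f608cc40a0cd447c0e7873010444e700d80f506ec196090830104bc29c06d031e0e9c5010fb45290eac4cc06d42d20b8041b0e6c4dc102850e105c5c212545ff14048671a7072f008004f007c01d00fc00000c0000013007701f409c02f80a8020809c02900b403580860318085075c11b066c182060c160075c2df06641dc000003b0000000021401a036c19f05a800000000000a5c19500dc0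d90628186000000000000000000000000000001000110000000030c0df0230050068c1690000000034c0000448000088c05f000000001e40000538092000000001e000001580150000000000000000000000000000000000800000390010021011409b08d01c9003c151032c0f600880f20d0414000b401d046000004d418000002b6053813e00d4158036818d007003700a802300f400001f400000c4043009409d00fc16b014c00003040370220048008401e01ac05303000ce053814e02c4059102c07d00180a50000000076413d00000b9069804b000000007e041000a000005c0177000000000000000000000000000000000000000190004800103800bd09681df01c0000065400003d8146039810c00000690278004049400000000000048000002c005000009f00c82c001600cc03b800300040760014000000006300800c308981bb000026f01980a9023c1c60b88068019c017020803600001680000238065816c04441a505ec1d0005c041012801001a4000005800000a0045018807107f834f00cc08f0834062000024a030c3d8002447906407e21b6000007880001bb8077000007e00000000c8801101fc1bd079c0000000000093c18900001780dc00f00088000033c07a000012e0000135056423701f800003880c700002f8008463c00001650a4c13808c43f9004c000000003a00001180a3429c000000002fc00000000ab0000000070057d04f80c80c400ea00000120000000000000f000000004ac122000012b000002f0000052124021e00000c6037004203740e0011011900b00000010031001c0dc),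
    (11, 0x1a409902780b10238000032000001d80d7042410303280a704340e403000a604d80f003940d103fc0e005e81b807f0254070024f0a142c1006c08600c80330074000039801c001010603542be025825e068427c05ec1df0a3823a06d03520aa03430aa04360dac4ea0f7444a10ec4d6009c00201080ce025c028014406305e41d5090c2bb08ac35a08a836c008409605401c6048424d0cd02f30b843d60ea449611084551454581017c0d20000100052000003dc28f06a82640f3050313ec25c132c5770818484102c4bf0ac42ef149054a14c05b31ad479417c82e31fa069d01c40a402440a902b800002980fa03a415b01dc1bf081c40703b81d7042822a03f80d803380d202b410106fc1fc074c1bc07941fa0e2003c03280000240035046c000082400005f002100000000bec097013008308e0000077c01b09180930c44114000000900f001b000002500880030168000021c25102e800001ac0aa04fc5e705b000008549de076c35e07a40e5020c1e5064c000024415e091432412941e80c640da1f5803c06180c600602450000055062c098075800002741b703e800001b00880a7c12a0670070001016a0148093009800001c004d0000000075010501d40bc01f80b602d4000035c11e03380df035c0aa0a3c0d0037413204b01df02940f9063c528095825908342450830456094423708d810c01480c5020c0460000000091c08107b412801cc09f0000000092c0c4065822203bc28314a0a5f00003dd0a483ad16ec822157834908b808602b0176032420b0000000000000008dc2a607a4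3450000063032c11206a422d000001e000004e013800000000000000000000002b0000024060c00000a4109028c0350a100b60988002066000001fc13f0654094080c1ab03100000000000050403e00000000000054000000001180ef017422200c00ae0694000028c1a8081410204b00de071080104ec295097c3c204680f20394711030424b01400000c7000000000000000000058c004042806400001b708941d60b480830000022000000008c4285098406f000005003b0263000012c00003190a7820c034466407d8197051400003d426a000015b03c015e07ec2160000000000024b00741bb09cc15900000d000680000078100000000001101ae037c33a051410b000023f00b857b060c07312ac0db046800000000a2033402f04f80e105201a204d402c0000000011c06e0088000000000000000000044017),
    (12, 0x14015003c00b0060000003800000a002900c403900f800000800150030006007800d0064018004c011015002e0108034015402f00f402b00080070000000005c00000400000000000000000000000000000000001c00000c0034004c00f00a4000012013005581d002880f806c000000e806701c408802e402d029403d01f4094039c0e201501f501cc0db00d004900d008000e003e00b803c01c412a031411302a80c403f00a502b00c1041c0d501d40ef04c80e203480ed04080e7055023505e0190064415406fc19706b423507c41f7070c27d0aa020208c82a50b10267002801600380000024000000800000001210000104003c3e90104058003000000300000000001001400903a4204041418303c469008b04d700000000000000032c000000000001680000000000083807e000000002e000003280000a98000050c00000000c801c80e6000000006e4000013c1910228200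01e0294017014c035c61d08b468505009750c105a2016c1a603201f607344f20160266098c6e312e08131b04de01920830038000006bc040058c000068c00006c002f00000000ca41a100940480680000114c02f0a800e7100c089008811c0084107000003100d407e006002d017004700f400000fc00000a408401f4091018007000b803b00580190094016003c01d004801b01a8058005405e012c04500a401f004408e026c1b2014802904d813f008c00000e80030000353068420e010805000001a10d6c40300002e0065c4d216a08a60dbc4a518a40e8017c0c20000000026c0af00000c402a8000000000001e0000000000000980940000000000000000000000000000000000000000000000000028c1c4000000001340ed00001f8069800000000000270049000000005100d2000000000000000000000000000000000000000000009402d005802700a002f006c00000ac0000000040006402b00e801f004c014000001a004c0070040013001001000ac06201481ac02c007a013408a00a0000034002100f40000400000015c000000005a00581d50000000034000004bc066084009b045c05800001ea048c16700000160c1000b01e4163000000001b81540000146046800000000000480123000000001801b1000000000000000000000000000000000000000000020c00001e000000000000150000000002407740000000000040404d00000000538000000000000000000000000000000000000000000000000000000000140004000006c0000010000006000000e805c033000d02d00af003002701a4023004c00a025c118062016606d81f005f01b507f845d0000042000001a00d81560000000007c20603280ec07bc40804981cf01c817e04d01b608ac27a055c1d107b43920bd83b30efc70710104f800b802800940c4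01a000b011c00b049c18a065c252079c1fe06f426e018c05a077c1e705502260b2823d081c2ea0b883e20dec44b110c4ec010c26206d414103dc347068829205c039c0a143cf0bec4bc0dc852b07283310de033b0bfc45d12bc3de0e6c4b4112060c143084d14bc709001404a009c08100dc0000164000025001e020c09001c0020003004f023805c022c08f019018202f802003c40fa06144af05a809a07cc0b6037807b09dc1950224007077800004ac000000000000a4000000000104e40270464014051c07a0324030000008200000af01fc1310768000006c1de0000000022014900000d105e0000000000007380000000000065818b0000000007c2a500000000000000000001f00003da0000001001c0000018000006006e02e80af0a7401302740000198096014c1a908340ad031405f069c0c6089817c000013f07c01ba09b01af01201dc004c051003407200cc00000b0000015c0c0028c1f102d80820294113025008502a006501e40b602680b305881ef050814f04bc2a4050400002b80000824084012000006380000564046000004e0358000000000104dc00007c0000005800001500000000000000000000000000000000000014b0000039007c000000013905880000000000079400000000000654171000001400001cb0000080000000001280b90170017003c104000000200000000000130056c0e90c700d7003c13c01c4000022c22907680e9008c000057016905381260000092045c1710b1c07305c41fe0040132008004c00fc00000540000a1000000000010224362093c48802cc0d1028405601a40cd01f8099043c43e121c7671b9c000000008c000000002303250bfc1aa16081f60a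9c0a2000000007b805400001970d1000000000620abc12200001a0000015809682b1000016d1c3414d00003590000000018406d00001e70b28084000000000001e102c41220a342a60000000013c10d00001d7000001304740cf05d800008100a00000000000000000440000758000126413100000e403f804c04d81d203880000000000058000004b80ab005004c025803504340ba00580a9),
    (13, 0xdfc4240ba4296109019a0c243d611004520dd051913241dd0ea841d13c04d7139437d12cc3ed11c443314d047b11944fd14005f90bbc40f0f0c8a20ef841c08a875e0dd857916e0334161c9851a2400014286920f2447e188044614844f21e6c53414902260df43e215dc46509787390d2453c0ed82a4000047a0f4047313cc38f0f0441602600000d982650ce061d16a4472202c9d716b85bf1c9c5891100b3028e8e0502205500cc0aaf0b942de000014a018817d121c22427d0a56015c4cb14bc2db0658466000000000000ed03dc08001e400000000000000000000010a),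
    (14, 0xdf43e30bbc2fb10341a90a64401121c4f511a446315244380f2c41a132442c0f04350119c12215ec4ac13844dc104023110a064c12b43690f841fd0dbc3871fec72613445140dac54b166079a15ec510130c54e185466b1a3847c109400028186db13845110a6c27605042cd0ea485d0d640000e5c3ad136844309583780c38aee116c6561cc0a5817745dd143805810942d00d5800010143681a9c72d15fc0a6100cb8c2c903fc0ae80790b70048258c1a80d981ff077403d000014d176c33e000012314381752d101920c5055c2ae0410017000000000010000000000019f)]
  scale := 31000
  value := 14570584

theorem horizontal2320_check : horizontal2320.check false 2320 962 = true := by decide +kernel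

/-- Certificate for vertical edges at closing probabilities 2320 and 962 (in units of 1/10000). -/
def vertical2320 : Certificate where
  outer := 42452
  weightsFst := 0x2e940000000000000000001c002a002b274a00000000000000000000013c270e03c2000000000000000026ce0000007d000d00000000000000000000292b000003c20000000000000000263f01060004000400000000000000001d5a05dd03da000000000000000000002710000000000000
  weightsSnd := 0x2f1b00000000000000000000000000002e710000000000000000000000f526c704090000000000000000227100000000049f000000000000000000002913000003da000000000000000022dc0000000004340000000000000000209402a200a0033b00000000000000002710000000000000
  testsFst := [(0, 0x10000000000000000000000000400100000000000000000000000000020000000000800000000000000000000000000000000000123000000200000000004001000000000040009c400000000000000000001f0005000000000700090000000005000500000000000000),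
    (1, 0x2440910000000000000000000000),
    (3, 0x9c400019c4000c000000000000000d30000000001700000000000000780000078000089c400009c400000000181000001600000000000000),
    (5, 0x9c400070000000000000005380019c40002050c0009bd80000000000000001000000000000000000018e000001300000000000000)]
  testsSnd := [(1, 0x2440000244000000000000000000),
    (2, 0x50000000000000000010000000000000100000000000000000000000000000000000000000000000000048009000000000000000000000000000000000000000002000000000000009c40000000000000000000000000000000000000000000000000000000000000000000),
    (4, 0x4f4c000273c000a7be61c000000000000000000000000261c000000078000009c40000780261c9c400000000000000000000000000000000),
    (6, 0x749c000775c000a00a69200000009be40009bd40009bee6929bd400000000000000000000269200000000000000000000000000000000000)]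
  tests := [(2, 0x1b0c5a10d740d00ae80eb06d40fe),
    (4, 0x1b00620e7c47e09d82e519cc7b9019002b1b84d3007bc2621ea001d01543ec141001b08405ae223c3e7005458121080d10a988bc2d34241),
    (6, 0x1dc0630e284270a102e719a87e5013430f11fc00f08885fc22c845802440611d60d7f07942581e2801301144d5207c1390c008a42bec26f),
    (7, 0x1aac7ba2918b4a1d7894b2c3c1db),
    (8, 0x1ab479b2b6cc2e1d3ca182ee02c9),
    (10, 0x13286030a9831f086831e0414134),
    (13, 0x354215024021502dc299003c2d310386171a9c890163c7e72418c38038c18901b429610d4580181c93615c0724144851e005423f07ac34f),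
    (15, 0x380227027c2bd032821500b832b10005fe15447ee1b7c863238cbf603b01710e7859201a023715d495115246fc003025c14f053e090c38d)]
  scale := 25000
  value := 13245802

theorem vertical2320_check : vertical2320.check true 2320 962 = true := by decide +kernel

/-- Certificate for horizontal edges at closing probabilities 1458 and 1325 (in units of 1/10000). -/
def horizontal1458 : Certificate where
  outer := 31718
  weightsFst := 0xf2000007590000058b2be5060b000000000000000021b40b92052d000000000000208a0adf000000b3052d0000086e11ef03ad052e01360122052d0000000000120000007c29030338000005b200000000000100002b83066b000000001a59000000010adf06f600b900000000180a029d0000052e09f000f90000000000000c0c0000000000000000271005b20000192100000787000007d40000000017a3138700000000000000000000000018ec126d00000000000000000000000025cb00000000000000000000000005b22710008b0000000000000000000000002710041900000000000000000000000027110449000000000000000000000000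
  weightsSnd := 0x4d9000006bd000000ae26740b7c000000000000000026f6067a0018051600000000200f0ae0000000b1052d000003d4141306c9052d00120134052d000000000022000006a4292502ec000005b200000000000000012b6c0671000000001a3c004600000ae006c000bf00000000177f02460000052e0a8800d600000000000004e8000000000000000021e30adf028f18f200000613000001680000052d16b4144600000000000000000000000016b3144600000000000000000000000022c203ae0000000000000000000005b227100119000000000000000000000000271003e9000000000000000000000000271003e8000000000000000000000000
  testsFst := [(0, 0x9aa000000000009c400000000000000000000000009c400000000000400500b0001621a6869a60a58274000000000000009c400000000000786c0009c400019a000009c40000000000000000009c400000000000408d9dd6768b6b923e864a01992f79543b57065d6279543b57065d62),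
    (3, 0x9c400000000000000000000000000000000000000000000000000000000271000027100000000000000003893c400027100000000000000099f266c00026658a821ad0000000000000003cc000000c0000000000),
    (4, 0x271000000000000000000000057bc26a000029a000000000000003b3a81533ba42d000000000000000000000000000000000000000000288c919000000100000000000000306c00031440000002063000000000000000000000003c000064c000)]
  testsSnd := [(0, 0x9c4000000000009c4000000000009c4000000000009c40000000000052e14810001a929c400000000000a12e8f907a01eb9c4000000000007d240009c3c0009c4000000000007d280009c400009c4000000000003719c0a7018a9784407846b2daca776285a9f616458b087846b2daca),
    (5, 0x997000000000009c40000000000000000000000000000000000000009c4000000000009c4000000000000000000000000000000000000000772a71000027119c400000000000000118100027100000000000000099f66670002606959dee200000000000000000000000000000000000),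
    (6, 0x271000000000000000000000045ec3153ac8381000000000000002ff2a10296e46500000000000000000000000040000000000000000026ec7c600040000000000000000027e800036f40000001ee300000000000000000000000000000000000)]
  tests := [(1, 0xd3431d06b80fb11883ac08682b50308141000009212784e600000000934000027c0010c1414f045015a043000105d41ba07140e304f0149062c1dc09dc1fd0e1426408540d003f813300a4089042c0000b340ef032827607980000f88253002c1390228000000011f1270111018006c0bf8217041c0cf11b42f607401bb08ac16e0d0826c0550000117c1f50c5c872046458d1ec400006c80000d50571000017a139806809e002f0a742a2033820b129400003100000ca851a016837b21201dc09c80660d103c3000072922f428800000000df860f01043762558049089c001),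
    (2, 0x75400e0190155002c0bd01200b70ac825a0c18436086c155058816002ec0ca01241fc0118006004c000107c000000022c00040000388000007c03000cc0080000033000000012d826f0e585bd08185950acc0e9000000c00e400000002a705480330e3c2fd01542b7109c000078017306f80d702d41c703a01e504040710974000000002f04cc00005ac0f205540aa058c071023c00000540c92f0c000000010f007800001e40db00000570114156052c0c3000000011140000000095161c0750e1c0b0000002200f0125000026d000005e1b6809900000000a44000089409c029c00001240f3000011f00000120ff03af0afc1f1044c00006000e1009400000e80d505d83bf0d90c100b7400001c40e013140e901d82070568208026c109008083d05dc153137426c000000015e400007e4146080400901a823800001ae0000000181800000000de0ccc000094421704d402801a018003ac2e906100e114b003f01d80ac07180000a14043082428c021442b041844500ec1a522d01c401b400e06d012803d0066081808a023c24f057834a072015c248c02500001520fdc0000dd40bc0ba01f801b828603241e201d021723ac173028c09a0b340de0738125),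
    (5, 0x12884e418a03da05a411f0a9c0000c20000038c007078814415480000dac273173440e08b823811c86ee0404000028800005a0000091417f12643b1133c2b8126c4051c9c0f111e041703b409d17683d51338029115c2f40b0400012e81480000000148c270007803f25582100520050),
    (6, 0x259440f154816a2b48487057433119d42a112e41bf159446106f410e1c482a110104d400001250c543fe16c80f80a9000018880000f500cf),
    (7, 0x53c0d7026805f063c17307d82390314087050c11f04e413305f814204ec15e0118000020402b00000750be826909c02920f183b7130852c02dc10a006000002c00c6066420b0210000039c00000740000000000050845d074c11408583bb068c3d80a30000170c00003b8043000008300e000b013001c0000000000002504100b0017058a09c851a1b6085202141be0000000000000000480000af878f000000016180020d842120150000004400000000000310000050400018e03ba01801c7000000c00000d500004100000000064c08c0940000000023909c014d053403601b0016000000006f40a2054827d057406407a407109181d4077422f00b81360000000000000000000aa0ee01bd16ec32c18a054e105c63c02fc0a10000000044800003242e20594000166811f07b41da017830f00bc3bc0000000000000000000000df802100a816c16b039211043c507b41d100300f006e409a01d033707680001ae4000049403c0000000011020a047419e0000000000001d1288000099018e139c4c20034164079423300840960be829f0bb46bb05dc0001fb8000083834500003f002ec3f4000002f01a000000a8007169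c0ad082c0001aac3c306d00b8),
    (8, 0x2ee4d2c18f45e833c0f8b0874229344cd6b1a405c83d4c1730dd801f),
    (9, 0xad81b50a60672053436d05d44911c2c5231d486d2146067a060428809c411307b03590ef41f7109844017c843c06604361a900ec088411b0eb828f0f2443303103a800000011ed40c001d813d07a42e4035c3891a144fa0e5833710703d800000b41bd035b044412209d414d0c4c2c8),
    (11, 0xcfc0d1088814102340e103c00970f7c21e0d5c3910b343640d303a206f001402c0134058c0c10750000059835d067c09506b415b04f021c12b036c0e0820c0b442270f1c3f715a420e21784da0fec716203487d07f400603881e707f82fd00001190a043fc05f02c9003c22100001fc0d781140000000042c1230a0c0000ae811d223067608a84370ef85a60360014000017302b402500000bc03e426d16f40e207f829d1ccc33f11e03a70a1012d0b3000004741200d880f500000a300000be0a1c06b0a680000504144021807c046007b05e817600000260000025000002b),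
    (12, 0x50000000f0000000002b0000000047c00b023c0ff02c417904401c500000000000000000000a0524001002c1b50450000012c05a02540740a043ca126c40809e0b3c10b06f210643301204615141481123fc82b05840e3087c31306380d0129c24b06f84ec148c31a07d82230eec33c012c0ae014002d01b80b7012c035020802904f802d00581fd01a806f022005f025035b080400001441ce0b4438121c01a205fc28d0aa01750bb40000d0404b000010400dc0890c2800001f8000023414c033805303440000f1c0000000000005000000000ed000001c000017a00000ff051c08200f0033022c1f801a4036064809203ac11f02d40ec049812503ec0be000016604e411e003c0e003d83a60bbc00d05ec0460bc81e40bc80000dc8021000000000000000b28040000000001d809c000007304ac0000bc014603480340d3c1c3042800008342010c4016d0d6021f05a023d00e400003f8039050810609a00c9051420906604690c5c2d203f4000000009500ec11601c025005dcbaf070400001981a609643d90e342080f501f10000144000000007b006e000011c02000e9048c0f702c8000022c16202980f501480c402541e402e020c00c80a7013c132),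
    (13, 0x1040173099421e083828d0618282151c46111bc636117c52513f094b15602b907044fe12fc3d607d0320138c81308d05760e54168082033411bc11300000d608101f3000c00111604000f8842409941740a3c2881308000001c021108466800001130c800e803e00840010000008c04b),
    (14, 0x29743af26bc19316a84cd16f81d0200c56e000023217cc1c719603da0e8815a13183560b1426112981b407385ca02d03f702f400000000d2)]
  scale := 28000
  value := 8558747

theorem horizontal1458_check : horizontal1458.check false 1458 1325 = true := by decide +kernel

/-- Certificate for vertical edges at closing probabilities 1458 and 1325 (in units of 1/10000). -/
def vertical1458 : Certificate where
  outer := 44502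
  weightsFst := 0x2bb70000000000000000000000000000293b000000000000000000010000000027100000000000000000000000000000271000000000000000000000000007351ff3000000000000000000000000261001180000000000000000262a00e6000000000000000000000000271000000000000000000000000000000000071300071ffd0000000000000000000025fc00000115000000000000000025c800000148000000000000000000002710000000000000000000000000000000000d640ccb19ac000000000000000026f80000001800000000000000000000271000000000000000000000000000002710000000000000
  weightsSnd := 0x3072000000000000000000000000000030c300000000000000000000000000002c4c00000000000000000000000000003058000000000000000000000000043823fd00000000000000001e5f0000000008b1000000000000000000000000277e00b70000000000000000226c0000000004a400000000000000000000036a0000247000000000000000001e5c0000000508af000000000000000000002734000000a60000000000000000226c0000000004a500000000000000000000077804481b510000000000000000271000000000000000000000000000002559009300ee003700000000000000002710000000000000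
  testsFst := [(0, 0xa880000000000000000000000000000001000000000000000000000039022b0000000000000000000000000000000400000000000000000006c127000000000000000004000000000000000000000000000000000000000018000001c00000000000000000000000000180000000000),
    (3, 0x20f000020d00000000000000000000fc00000000000000000000000020f400020f4000000000000000000000000000000000000000000000),
    (5, 0xc000020a00000000000000000000000002080000000400002c800000000000000000000000000000000000000000000000000000000000)]
  testsSnd := [(2, 0x10000000000000000000100000000000000000000000000000000000000000000000000000000e0000000036800000000000000000000000017bc000000400000000000000000000000000000000000000000000000000000000000),
    (4, 0x149c0001b800001242303031c000000000000000000002303000000014f400017b800014f630317b80000000000000000000000000000000),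
    (6, 0x17b00001aac0001052305033c000132400022700001302300227000000000000000000000230500040000000000000000000000000000000)]
  tests := [(1, 0x1a006d03f0089042c08c08f01e90514220054033804d432e0a483ab02380000134024014801e09e028b045c21f045423004442400d2c36e007401f03800f20a041e7025820f012c18c028c0dc0eb400004bc15800ec0a1073c04e00044b3076400004c01ab0ca412f09a408c07800e80084018087c12402e80f9035022e01441830f7c00002a40d6046c15f00c80a0003c439068405a06d400004881b00aec0860c2013f07400f300c40ac0bc027808581dd04f413a078825a0674000060800006bc08d014c0271590000148001200001b9065c1e40e8c0080da40000000173),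
    (2, 0x12b437915305fb0f6840516b85000f1432f1870000155ca8e185802e0d901f319440001520abb187402f184c3ff22940c81f800932af0065),
    (4, 0x52c1150c1424408902690dd04af032c1bc0a2c3850b9836c10ac4d5038012607cc2c206b82e51214055035c25519f026f0df431416d825103543340b9449a0acc51c114823203e00000dd012d1088d8319a407e0700018118c2ea13dc31b1b2409007d00001cd02811d58332251c225),
    (6, 0x5041150c4825608a826a0dbc4b9032c1860a0837e0b3835e11104e503dc28e09844c50aac53011d025e03700000ed01360f9cd281a3c09302d011709d02f506b02f81230067036c21819e024e0e1c30e16cc23e07b4045111832113b430a1bac0b208b001e1f2c25f1d3c30c252c225),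
    (7, 0xa3c3260dfc36c100c5b907501200ba83c312684fc11483192108e2b0cf44491718692036c6b00804140135c79e1d707a00000d4f08180be),
    (8, 0xa383220dfc3560fb4648072c1060b903c712444f010542b921ace240d0447b16e469c01f871708d414811f47c31c1476c0000d1f08640d2),
    (10, 0xe3425411004440c343a71a684fc0bd03811cc04c71f88620163886309382d416143ab0a101f30c5800009cc2080de800012c4052000007e),
    (11, 0x19c08d0404031006c01a002c00e0038039005003300dc00d0000009035c041045409c01881ff01d43b908180010f004740cb02740ea04a802b8030042c0ca090c0010c9036601901a4013c30c09101570cd035d071018e07bc35a020c2a90a8c31103001dd0a643890d042c9114c2b5020007805a81dc00ac10008142f700a40f108302de0b0c1960a642e301e80880c1018602d007e0500125064c47200000d10de4000001807601e409c0b5819b05984f400000d302ec05e04f012c0e0c000008c07206942630ba028f05ec04508240c40628075088c0f2037c083038c0cd),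
    (13, 0x4ec10a08642f402cc15e08883f604080dd0de84b90fec31e15ac7e909102ac0e6451a0960611186071e0a503b215b481122b88722230b7a02b829504e42fd02bc277096c2f70d0c0001464ffe085c4660f9c41c07744730fb44440b70375039839810741d5098c17612303590aa43ec),
    (15, 0x4f0107086c2db040c0d80db448402a815a08883f71010312157879909202a30e6452a0a503b51588827094861a189874222c487b223cb50029026405242ee0c680001304f9202c020f09ec3a808ec44c0e7c40f082c4560fa441d102c1cb09301650b0036c03c838a12e83650ad43fb)]
  scale := 31000
  value := 18134406

theorem vertical1458_check : vertical1458.check true 1458 1325 = true := by decide +kernel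

/-- Certificate for horizontal edges at closing probabilities 1814 and 856 (in units of 1/10000). -/
def horizontal1814 : Certificate where
  outer := 27618
  weightsFst := 0x16dc0ef8000000010d6902920000061b000014010656022e12bd00520000044f0000067820150000000004880000016a0000030021040277061b005807801fc600000000013d00000320048800001cfb00000a29023d02750000002128510016000000000000015600000092270a000000000000000000e400000000
  weightsSnd := 0xf79130b00010000100f03f3000006c90000149802f80195118d00eb000000000000098d221501e00000022b0000027f000002fb1f28014307ea00a2000026d1000000370000003a063b022600001c4700000acb02f8014900ef009c270f000000000000006c000a0000014a270f0000000000000000014a00000000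
  testsFst := [(0, 0x2318006000000083a808c15e006a000000005740002c480000574000220892100023dd5ffd88510543f9000000006d426a4bb800006d426a0ae8000a1b40006eb4000a1b4000000000005740002c4800005740000d080817c2d2c243d034b9469567022417d246025f000048e246025f),
    (2, 0x26b405200500007c7857d014004000001c3000000025141c3000000002bd34c0000000732e8d3000000000001c3000000025141c3000000022200001da249c5d0841a5b4c44e00001df000027b48c01df015827b016183402e0a284c0e90e117d82905808c70590266089c8c7115c266),
    (3, 0x13d0000000000000000000000000467c000000000000000000000000327c5dc000000000004ea00000002ddc0000000000000000000000000f62019000271000000000000000000000000027100000000000000026edee700021b72e4856601e00000000000000000000000000814000),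
    (4, 0x1c04000000000000000000000000050615800000000004000000000033d45c9000048a0000000000000017ba1641d1c47500000000028000226450d00000000000000000000013280000000000000000000000000d0800013f4000000062500000000000000000000000000000764000)]
  testsSnd := [(0, 0x46ac000000000053b40000f8800057ac08711dc06956300000f8800036ac82e0001d3b579400b0e783c84f3174616ec50f5aec0140e783c826e4000abc800039140000f880004214000abc800056300000f880000be40796f49312016c0e60e743c6297c36ca5d94355aec1d60e783c6),
    (2, 0x214dfeb00000004368334000000066483e803e40fc626c3340000000427ea440000000368433400000005122a44033c04a62683340000000193545e193969e5e800b4000034e6ed451a68005285e803ad011434e035db6403cd87d02045fe03f434c45e2ba4127dc295e705fe07b834d),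
    (5, 0x434857918ec000407c4c30000000098c000239800000000000000000631432b0000000699c32b09bc0000c040000000000353c0000000000078a118193a7103f6048700000000000000137671009d800000000002141dd807ee439113432809bc0000000000000000000000000000000),
    (6, 0x135000018b00000118000000000003bddb10e2400015e800000000004d1c463188446300000000000000197dd7f13384611730000000000010c430d000000017d4000000000008bc000000000014c0000000000003d80003284000000000000040000000000000000000000010000000)]
  tests := [(1, 0x5c919b838807587ad1cb429018400000d9021a1da425f000c1c41d98434000021c1770032074817a10d469f0bc80000000000002c08b),
    (5, 0x1f6c4551ce43ac038c8f51270be4258c3f225643282a680001d741f0),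
    (6, 0x1d047771b883f9299c5b526b838c0004a001974bf1222c0001aec298),
    (7, 0x1a40d802b40000e8c1cb064c5e202bc2e71abc97409e01b3074412b02bc0e50ca8074075827b099c1f903884c71fb0b2b069410900801100c28299111069911882d203f82e330449f5013000000000b2091c260023419e189055e1c3c3170b4c3a12ba0d2a062800000381d9095c078),
    (8, 0x2d9c2af085421b),
    (9, 0x2740ae0144000084c3c91c7896f0cb4220052454002c41cb032814902480aa0ab40000b483bb1ec8a87081c2f20aac1cd024814b01601f4058822a111c4e32c188710000001146827403f82e300000a7029034404bc19c175c47d2650be7087800c18483b00b4c00000002940fe01d9),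
    (11, 0x302172c4311c5c3a7000400d002c47200004130e542021ad01e3000058109981bd000026d0b4c0c613882fd0a4018f0a2010500000a6),
    (13, 0x1b5084e01fc9ce2b7488d32dc8511f943a916309d904cc13600001a3),
    (14, 0x14ec76c343496e04b884a31c07df21284470f9431412a097500001dd)]
  scale := 25000
  value := 10935530

theorem horizontal1814_check : horizontal1814.check false 1814 856 = true := by decide +kernel

/-- Certificate for vertical edges at closing probabilities 1814 and 856 (in units of 1/10000). -/
def vertical1814 : Certificate where
  outer := 42452
  weightsFst := 0x2dc00000000000000000000d0043003e27560000000000000000000000ae270d0358000000000000000026cf0009006a000000000000000000000000285a000003580000000000000000269000800000000000000000000000001ef604a20379000000000000000000002710000000000000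
  weightsSnd := 0x2e6600000000000000000000000000002dc000000000000000000000008c26f0037a000000000000000023b800000000035800000000000000000000283200000380000000000000000023b8000000000358000000000000000022000136006f036c00000000000000002710000000000000
  testsFst := [(0, 0x11000000000000000000000000000000000000000000000000000000020000000000c000000000000000000000000000000000001ae000000700000000004000000000000080009c400000000000000000001f40020014051008800501080b7000000000000000000000),
    (1, 0x1c58716000000000000000000000),
    (3, 0x9c400009c40000000000000000000d280000000098000000000000007fe80007fe80109c400009c40000000c15401b000b00000000000000),
    (5, 0x17c0009c400000000000000000004f00009c40000050c0009bb00000000000000009d0000000000000000dc00003d800000000000000000)]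
  testsSnd := [(1, 0x1c580001c5800000000000000000),
    (2, 0x6c00001100000000000000000000000000000000000000000000000000000000000000000000000000000000000dc000000000000000000000000000000000000000000000000000000000009c40000000000000000000000000000000000000000000000000000000000000000000),
    (4, 0x69080005380000a276710000000000000001b48000000271000000007fe80009c400007fea7109c400000000000000000000000000000000),
    (6, 0x4c6c000486c000a3667100000000804c0007ebc0009f827109c9400000000000000000000271000000000000000000000000000000000000)]
  tests := [(2, 0x1d3c603088c1070aa0031024c137),
    (4, 0x1dc0570c944a709b42cf193870b01340e71a4ceb307f42bb1df000b00fc2ea0ff002b096463123983fc00605a71fec1fc0b207172b4c1ae),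
    (6, 0x1f80550c2c3de09e02cc194079500d42fe10fc01908e05cd228433c01940111b0cc8608a82be1fe802900c852b1f2c17b0c107a02ab01ea),
    (7, 0x19e8783298cb601d9c9492d6419e),
    (8, 0x1a9c77a2d44b691d0499930b41fa),
    (10, 0x17086960a382a8066012507fc13e),
    (13, 0x2fc22d01c822401c42a700582f70de45ff175c874134482e2210bbc03e019d016428e0f1856d13cc8d4137871a1360434000c206098c2bf),
    (15, 0x30023901a42c4025c21d009c3250dd05ef12dc7d519f489d2150b8803301910e1055e01cc25214ac87513807070018174106c3fe066c2e1)]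
  scale := 25000
  value := 9887385

theorem vertical1814_check : vertical1814.check true 1814 856 = true := by decide +kernel

/-- Certificate for horizontal edges at closing probabilities 1094 and 989 (in units of 1/10000). -/
def horizontal1094 : Certificate where
  outer := 27618
  weightsFst := 0x1621b008290000016e086d008111cd086e0602024706600049045501d3115104de000007a50f89008c000000f514e8037a0000035311d700420000008b1b1d0f400000000000000019040100b71fcb0b2c00000000039c00ca0000000127110365000000000328000400000071271103e70000000002ef007b00000000
  weightsSnd := 0x221b08230000006807b700e512330a4902c30531049d0031049f014311330485000007b3105d0042000300e9167502e80000036e106600710000006f1f470ba1000000000028000003da00e51eb70c210000000003ca00730000006d271003d8000000000319000100010078271003c8000000000322007900000000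
  testsFst := [(0, 0x55e800108d40005b4400008d001d000000007e0000523000007e00002b44b7300017d65ad55b90e6432c000000008fc25c4bac01a08fc25c3404000a508000443c000a4f4001000000007e0000523800007e000009640a58095d4833087f1a2125a61d487ea854a60424aca0b854a604),
    (2, 0x56d023e00000005a1823e0000000000020900000004fe4209000000027127730000000533691a0000000000020900000004fe82090000000238cdf527693106030386635c334000015a00002084f101de00c0208019d83903515584e368cb2e465df0ecdec10f15cd61fddec013c9cd6),
    (3, 0x5ec00000000000000000000000063c01bc000000000001ba01d40003ae4000000000000000000000000119670400027100000000000000000012cd000270f0000000000000036066ad00020e253368cb00140000000000000000000000000250000),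
    (4, 0x80000000000049a6b400000000000000000000052a8123076024200000000094000281e4d12ccdd11000000000ec000000000100040010008000000000029c08860008001000000000000001dd000035f0000000227c0000000000000000000000000000026c000)]
  testsSnd := [(0, 0x545000008d4000545000008d8000544c00008d4000545000008d80003954e570001652558800108b023d5ddd6ed1104421558802908b023d3194000a514000545000008d80003cb4000a514000545000008d800009400a081bd8171e0c731953a4cf304451fa69a147448c936953a4cf),
    (2, 0x36f1fe6000000055fc21100000005d14314040c1035908211000000047a6920000c000455421000000004eca920011400d59082110000000289963f343960252001cc000020f602042e61983f157f0222006820f0c19cd702e9ae50c35e740e41eaf4d42a9730e285b49e1e741519eaf),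
    (5, 0x359032702a0000359432700000000000000117c000000000000000005be01fa00000005be01fa01340002ff4000000000039940000000000208ea370ab270f35943270000000000139a106670d0000000000000031768a406061c638068f800000000000000000000000000000000000),
    (6, 0x6180050000000000000005227100000000059400000000005b701cc1bbc1fe000000000000002e0271b2185e9f15e0000000000000000000000000000000000000002cd486500000000f70000000000020d0000330c00000026fe00000000000000000000000000000000000)]
  tests := [(1, 0xe240800b880f400001c80c880cb090800f080c12e078402507b40bc17642b5045c01312d4226002001a12b8398048801c1b002d9021c065),
    (5, 0x4300900f3811f0e501c8098425a1acc0b711500b90f740020ec4024),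
    (6, 0x21c438c0c301e90efc2a4133c119036804a10f813814a801b1350116),
    (7, 0x4804a000000003347eb1db4ad9075c19e0404028024c0430a3c17e0554000083c25a1b340fa000008504b41d30ad81e7015408b059000000e43b404a43c920100080000000044c348000003007740d204ec20900002610f3c89b2c8005d0000482013c258000400e0a480000b0810b),
    (8, 0x3bd051812100c5),
    (9, 0x2cc094000035401ac00003042920de84d51a2c3b9015c55b017015c011407f000021202c401002e4183121818b040810e0db000000840cc01c8000030c11006d80660450193161c095000000000400dc0a6032814080d602e03e40fa40a4034c13c0d001510000001038c1590c0c20e),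
    (11, 0xde806c0c8c14016644ba10cc6a701fc0c701d002c0c1415f0f042ab0b5039105241ba0614002060413e046810e04b80fd00e8022009804f),
    (13, 0x6302b00d9027e216c32f0c70390049008606f81b402500f200e0043),
    (14, 0x25003a50a284a8000055716384b911a40330d1c1c4017813b00580f9)]
  scale := 25000
  value := 4802178

theorem horizontal1094_check : horizontal1094.check false 1094 989 = true := by decide +kernel

/-- Certificate for vertical edges at closing probabilities 1094 and 989 (in units of 1/10000). -/
def vertical1094 : Certificate where
  outer := 42452
  weightsFst := 0x2ebc00000000000000000000000000002710000000000000000000000043268703e0000000000000000027100000000000000000000000000000000026eb000003df000000000000000027100000000000000000000000000000165e081207d900c900000000000000002710000000000000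
  weightsSnd := 0x2f3100000000000000000000000000002eca00000000000000000000001e26f5040e000000000000000023330000000003dd00000000000000000000274700000414000000000000000023330000000003dd000000000000000020d6022901f0022200000000000000002710000000000000
  testsFst := [(0, 0xf0000000000008d000000000000000000000000000000000000000021000000000001e70000000000000000000000000000000000023ec01200000000000000000000000300a200000000174116000000000000000000000),
    (1, 0x27809e00000000000000000000067c19f0000000000000000000000),
    (3, 0x99f400099c4000000000000000000aa00000000000000000000000003480000348000023ec00023ec0000040000027c00000300000000000),
    (5, 0x99c80000000000000000003100009c4000003d8000871400000000000000000000000000000000184000047000000040000004000)]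
  testsSnd := [(1, 0x23d400023d400074c800074c800000000000000000),
    (2, 0x128000000000000000000000000000000000000000000000000000000000002c54000000000000000000000000000000000000000000000000000000000000000000),
    (4, 0x4d9409b5620000a3f67100000000000000000000000002710000000027780002c54000277a7102c540000000000000000000000000000000),
    (6, 0x495406a4dd4000a4c6710000000077e800077f000077ea71077f000000000000000000000271000000000000000000000000000000000000)]
  tests := [(2, 0x20047bb1cc00001f5c00003842b4),
    (4, 0x1f02170dd45d90b0435514ec53001440000fe026207fc5ec20dc1ef00000000af80ce102cf961e842d300240a723e41ed0c888642844151),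
    (6, 0x1f41a20d9c5d80a342f415b457900000020c281430e90e1c1e0c251016400010942aa081858b21dc21300240de24441d90cc07c627c4152),
    (7, 0x1a6878819c89f01df4a202850214),
    (8, 0x1ab877615609861e8c9d42714241),
    (10, 0xda0a461f08012221000509180ce),
    (13, 0x3e425801842a501d04c600003a50ccc5c817fc8d713307e31e8cbb00a7c183001c7c60000f8d01f8ab215043a50fdc1a508f82580cfc309),
    (15, 0x3e42240080455019c2a800003b10cd05f513f07e01a4c90d1ce0b9108c81810000e24001877a0268a0016d036a0ad01d810b81c70c9c30b)]
  scale := 25000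
  value := 10747610

theorem vertical1094_check : vertical1094.check true 1094 989 = true := by decide +kernel

/-- Certificate for horizontal edges at closing probabilities 1075 and 481 (in units of 1/10000). -/
def horizontal1075 : Certificate where
  outer := 25568
  weightsFst := 0x45e14b5000001fa130a005b09f70093000003b31cb90000000000870acd1db100000000003d000002550087270a012c000000470148008600370011
  weightsSnd := 0x6e0134b000001fa116100b8072200620000040f1f45003d000000400be11c9100000031002f00340298004a271401480000004600f3008a00380013
  testsFst := [(0, 0x12e012100c000034b018a0558055000017e024c02e214c180025002d04bc95d01013802e697c6081c17100000f9026824728940e502e0247055000055c42983ffc0005ec81b80000116000020e273c117000020e012808f313ccc825e85eb60458a801981640000f9e0000355023cf9e),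
    (1, 0x59e406501540245548c94010005d540805349dc04e403cf334fbc04c),
    (2, 0x1238021047800e318814605d4044000009c04d403b1e2409c04d403904105e500cc1234211cff01f01830000000037817422d000003b417504f45d31ff933f2e5819a5a5c19e000008503e826e24a40d808cc26e00a405302f0d3f2605d1119dda250214154069502702641c60f75027),
    (3, 0xca8005000001400000000000010181c0000000000000000000000005d540e7000000000001e604cc0002ed8000000009e0000000000000004115c0000270f00d800000280000580000000270f000000001080001bb95e6000267d25c4e130074000000000000000000000000015c000),
    (4, 0xee40030000000000000a000800f02857a0001c00000a000000240005bc810c01081f1000000000e00001d11836137ce690000000009800013446c7080c000001c000000000008e400012c4000000000000ac0002a681482af00000000ffc00000000000000000000000000000154000)]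
  testsSnd := [(0, 0x1890097000000018241c80404032235c1ba04b40431e301c7040002f0c9cb2f004d1d11e2813802ec24925ed80a08f010b250410004602490c0c00057381441e801930000248262400058b01ec32e016c000024801f80492c64dd401500b600010f00dc45c358d9a161f7c40601710f0),
    (1, 0x6bdc09300740286ee4f5c015000d6a0011c500c0004c1d0e054d8000),
    (2, 0xebdf92000000016c005305e004627140cd07f00bd250005605e00470d057f40000000198c000062c1d127eda3305d023130c800005bc1d1071549929892421b8001f04f028527941585a301462cc00510a2c2850238d180200e8e019006503b0d8a1415adf1a45c07213006c0d50d8a),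
    (5, 0x372034b07f8011388833c0010011067000002b4004080400000000005f9c098000000057801d404bc0003018000000000031300000134000050da410c7270f2d54310004c000026000013ce7101a3c00000c40001af96f30c7a6641320f0500000000000000000000000000000020000),
    (6, 0x69402608d40000564000000001203018f0044c0000908000004800060600ab07441ce0000000031c0001d0d9230f30b390d6000100fc0000de834a015000000000000000000031000014d800017a800000f80002bc400028b00000000e7100000000000000000000000000000020000)]
  tests := [(5, 0x15d81d00b347a11d1816527380e6),
    (6, 0x15e02c41cbc1e4088873c22c4120),
    (7, 0x20857015ec00010584a207504ec0000642056c34215f425e14300d8),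
    (8, 0x2ab00ab02580c8),
    (9, 0x3a45b8110836e19d0000023c3cb000054713782a606f40100fbc162),
    (13, 0x14b43301e80abf09186fb03a00d3),
    (14, 0x13a47dd0a2caad0c6c18c1d1c10f)]
  scale := 25000
  value := 3803025

theorem horizontal1075_check : horizontal1075.check false 1075 481 = true := by decide +kernel

/-- Certificate for vertical edges at closing probabilities 1075 and 481 (in units of 1/10000). -/
def vertical1075 : Certificate where
  outer := 34244
  weightsFst := 0x57271903d200000000000000001b6300090ba2039f000000000000000023920374012100d00000000000000000270201e5000e0013
  weightsSnd := 0x46270903eb00000000000000001ca9003a07ed044a000000000000000023870373012600dc0000000000000000270f01e600020021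
  testsFst := [(0, 0xde20000000007c01e0000001006400000000000000011000000000007e6000000000000000000000003c0000000000000000007c116c0000d12000015a0000000092021800000005890208000000000000000000000000000000000000000000000002400000000000000),
    (1, 0x4001004400f000000000000005478229000000000000000000000),
    (3, 0x94ec0009c8417400000db0000007097000000002c1000000000000005c3c000959434265700ce9ecc000000000100000b300f429b0000000),
    (4, 0x46de04ca0c683100050b3015805641ce09c6b729267b51ee39d7a76c),
    (5, 0xd980005df468305b400000000e500000015b146b9089c0c99f680c929100001dc118a34f400000000000000000000002600000000000000)]
  testsSnd := [(1, 0x1000001a0010000001001b5738000083800000000000000000),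
    (2, 0xc4fc000c3dd000003b00000000000001005c001000001d000001a00001b6000036c0004000000000000000000000000000001b001001806e088d3a78a8f000000006a8000083800005f400055dc009088800900000000000000000000000000000000000000000000240080020008),
    (3, 0x5e0197a0001a8c9ec67b202e80bb3d81c826ebdb0c7d9e8fca0aa77f),
    (4, 0x39346e145a4154a0a267b047000d0000458331c0140001e2d000001c4f7c83c583c176967e6779f640010000000000c08f00000500004000),
    (6, 0x196470c60600093ab4e76055816c055c4516dfc14734f8e62a3ac15a261084041580002c1d0b000000000000000000000000000000000000)]
  tests := [(2, 0x7201db02ac04c),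
    (6, 0x10d404712bc24d16641871e7828b),
    (7, 0x3141a72348b7507907a62d88150),
    (8, 0x2adc272),
    (10, 0x63420301e4052),
    (15, 0xf904fe160c78d01041f50614291)]
  scale := 25000
  value := 3737717

theorem vertical1075_check : vertical1075.check true 1075 481 = true := by decide +kernel

end Certificate
namespace RenormField

/-! ### Iterated renormalization -/

section Chain

variable {Ω : Type*} [m₀ : MeasurableSpace Ω] {μ : Measure Ω}
  {G : Ω → SimpleGraph (ℤ × ℤ)} {X : RenormField μ G} {q : Bool → ℝ}

/-- Up to an event of probability at most `ℓ`, the representatives of the origin lie in an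
infinite connected set. -/
def Percolates (X : RenormField μ G) (ℓ : ℝ) : Prop :=
  ∃ Λ : Set Ω, μ.real Λ ≤ ℓ ∧ ∀ ω ∉ Λ, ∃ I : Set (ℤ × ℤ), I.Infinite ∧ X.rep ω 0 ⊆ I ∧
    ∀ x ∈ I, ∀ y ∈ I, (G ω).Reachable x y

/-- The reflection fixes the origin and leaves the random graph unchanged, so the two assertions
coincide. -/
theorem Percolates.of_swap {ℓ : ℝ} (h : X.swap.Percolates ℓ) : X.Percolates ℓ := h

/-- Outside the loss event the representative of the origin is contained in that of its block, so an
infinite connected set for the block also serves for the origin. The exceptional events are united.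
-/
theorem Percolates.of_renorm {ℓ ℓ' : ℝ} (h : X.renorm.Percolates ℓ) (hl : μ.real X.lossEvent ≤ ℓ') :
    X.Percolates (ℓ + ℓ') := by
  obtain ⟨Λ, hΛ, hI⟩ := h
  refine ⟨Λ ∪ X.lossEvent, (measureReal_union_le _ _).trans (add_le_add hΛ hl), fun ω hω => ?_⟩
  rw [Set.mem_union, not_or] at hω
  obtain ⟨I, h1, h2, h3⟩ := hI ω hω.1
  exact ⟨I, h1, (rep_ssubset_renorm hω.2).subset.trans h2, h3⟩

theorem Bound.swap (hX : X.Bound q) : X.swap.Bound fun d => q !d := fun d v => hX (!d) v.swap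

theorem Bound.mono {q' : Bool → ℝ} (hX : X.Bound q) (h : ∀ d, q d ≤ q' d) : X.Bound q' :=
  fun d v => (hX d v).trans (h d)

/-- If 24c ≤ 1, then 12c² ≤ c/2, so after n rounds the rate is at most c·2⁻ⁿ and the loss at most (c
+ c²)·2⁻ⁿ. The losses add up to at most 2(c + c²). When no loss occurs, the representatives of the
origin strictly increase through connected sets. -/
theorem percolates_of_bound [IsProbabilityMeasure μ] {c : ℝ} (hc : 0 ≤ c) (hc' : 24 * c ≤ 1)
    (hX : X.Bound fun _ => c) : X.Percolates (2 * (c + c * c)) := by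
  set Y : ℕ → RenormField μ G := fun n => renorm^[n] X with hY
  have hYs : ∀ n, Y (n + 1) = (Y n).renorm := fun n => Function.iterate_succ_apply' _ _ _
  have hcn : ∀ n : ℕ, 0 ≤ c * (1 / 2) ^ n := fun n => by positivity
  have hcn' : ∀ n : ℕ, c * (1 / 2) ^ n ≤ c := fun n =>
    mul_le_of_le_one_right hc (pow_le_one₀ (by norm_num) (by norm_num))
  have hB : ∀ n, (Y n).Bound fun _ => c * (1 / 2) ^ n := by
    intro n
    induction n with
    | zero => simpa [hY] using hX
    | succ n ih =>
      rw [hYs]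
      refine (bound_renorm_sq (hcn n) ih).mono fun _ => ?_
      -- Only one factor of the square decays: the other is bounded by c, and 12c ≤ 1/2 supplies the
      -- halving.
      have h1 := mul_le_mul_of_nonneg_right (hcn' n) (hcn n)
      have h2 : c * (c * (1 / 2) ^ n) * 24 ≤ c * (1 / 2) ^ n := by
        nlinarith [hcn n]
      have h3 : c * (1 / 2) ^ (n + 1) = c * (1 / 2) ^ n / 2 := by ring
      rw [h3, sq]
      linarith
  have hl : ∀ n, μ (Y n).lossEvent ≤ ENNReal.ofReal ((c + c * c) * (1 / 2) ^ n) := by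
    intro n
    rw [← ENNReal.ofReal_toReal (measure_ne_top μ _)]
    refine ENNReal.ofReal_le_ofReal (((real_lossEvent_le (hB n) fun _ => hcn n).1).trans ?_)
    have := mul_le_mul_of_nonneg_right (hcn' n) (hcn n)
    nlinarith
  have hsum : HasSum (fun n : ℕ => (c + c * c) * (1 / 2 : ℝ) ^ n) ((c + c * c) * 2) :=
    hasSum_geometric_two.mul_left _
  refine ⟨⋃ n, (Y n).lossEvent, ?_, fun ω hω => ?_⟩
  · refine ENNReal.toReal_le_of_le_ofReal (by positivity) ?_
    refine (measure_iUnion_le _).trans ((ENNReal.tsum_le_tsum hl).trans ?_)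
    rw [← ENNReal.ofReal_tsum_of_nonneg (fun n => by positivity) hsum.summable, hsum.tsum_eq,
      mul_comm]
  · rw [Set.mem_iUnion, not_exists] at hω
    have hmono : StrictMono fun n => (Y n).rep ω 0 := strictMono_nat_of_lt_succ fun n => by
      have := rep_ssubset_renorm (hω n)
      rwa [← hYs] at this
    refine ⟨⋃ n, (Y n).rep ω 0, fun hfin => ?_, Set.subset_iUnion (fun n => (Y n).rep ω 0) 0, ?_⟩
    · exact Set.infinite_of_injective_forall_mem hmono.injective
        (fun n => Set.subset_iUnion (fun n => (Y n).rep ω 0) n) hfin.finite_subsets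
    · intro x hx y hy
      obtain ⟨n, hx⟩ := Set.mem_iUnion.1 hx
      obtain ⟨m, hy⟩ := Set.mem_iUnion.1 hy
      exact (Y (max n m)).rep_conn ω 0 x (hmono.monotone (le_max_left n m) hx) y
        (hmono.monotone (le_max_right n m) hy)

/-- The function with values `nh` at `false` and `nv` at `true`, divided by `10000`. -/
noncomputable def rate (nh nv : ℕ) (d : Bool) : ℝ := bif d then nv / 10000 else nh / 10000

theorem rate_nonneg (nh nv : ℕ) (d : Bool) : 0 ≤ rate nh nv d := by
  cases d <;> simp only [rate, cond_true, cond_false] <;> positivity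

theorem bound_renorm [IsProbabilityMeasure μ] {nh nv nh' nv' : ℕ} {C C' : Certificate}
    (hX : X.Bound (rate nh nv)) (hC : C.check false nh nv = true)
    (hC' : C'.check true nh nv = true) (h : C.value ≤ 10000 * nh') (h' : C'.value ≤ 10000 * nv') :
    X.renorm.Bound (rate nh' nv') := by
  have h1 : (C.value : ℝ) ≤ 10000 * nh' := by exact_mod_cast h
  have h2 : (C'.value : ℝ) ≤ 10000 * nv' := by exact_mod_cast h'
  intro d v
  cases d
  · refine (real_renorm_le hX rfl rfl hC v).trans ?_
    simp only [rate, cond_false]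
    linarith
  · refine (real_renorm_le hX rfl rfl hC' v).trans ?_
    simp only [rate, cond_true]
    linarith

theorem bound_swap {nh nv : ℕ} (hX : X.Bound (rate nh nv)) : X.swap.Bound (rate nv nh) :=
  hX.swap.mono fun d => by cases d <;> exact le_rfl

open Certificate in
-- The rates (horizontal, vertical), in units of 10⁻⁴ and after the reflections, run through (1541,
-- 1541), (2320, 962), (1458, 1325), (1814, 856), (1094, 989), (1075, 481), (400, 400). Each
-- intermediate rate is a certificate value rounded up. A reflection follows exactly when the
-- vertical edges have become the weaker ones. The six losses and the tail 2(c + c²) with c = 1/25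
-- add up to less than 0.8.
theorem percolates [IsProbabilityMeasure μ] (hX : X.Bound (rate 1541 1541)) :
    X.Percolates (9 / 10) := by
  have b1 := bound_swap (bound_renorm (nh' := 962) (nv' := 2320) hX horizontal1541_check
    vertical1541_check (by decide) (by decide))
  have b2 := bound_renorm (nh' := 1458) (nv' := 1325) b1 horizontal2320_check
    vertical2320_check (by decide) (by decide)
  have b3 := bound_swap (bound_renorm (nh' := 856) (nv' := 1814) b2 horizontal1458_check
    vertical1458_check (by decide) (by decide))
  have b4 := bound_renorm (nh' := 1094) (nv' := 989) b3 horizontal1814_check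
    vertical1814_check (by decide) (by decide)
  have b5 := bound_swap (bound_renorm (nh' := 481) (nv' := 1075) b4 horizontal1094_check
    vertical1094_check (by decide) (by decide))
  have b6 := bound_renorm (nh' := 400) (nv' := 400) b5 horizontal1075_check
    vertical1075_check (by decide) (by decide)
  -- At equal rates the two loss bounds agree. In all later rounds the vertical rate is the smaller
  -- one, so the second bound is used.
  have l1 := (real_lossEvent_le hX (rate_nonneg _ _)).1
  have l2 := (real_lossEvent_le b1 (rate_nonneg _ _)).2
  have l3 := (real_lossEvent_le b2 (rate_nonneg _ _)).2
  have l4 := (real_lossEvent_le b3 (rate_nonneg _ _)).2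
  have l5 := (real_lossEvent_le b4 (rate_nonneg _ _)).2
  have l6 := (real_lossEvent_le b5 (rate_nonneg _ _)).2
  -- The rate 400/10000 = 1/25 is small enough for the quadratic recursion, since 24/25 ≤ 1.
  have p6 := percolates_of_bound (c := 1 / 25) (by norm_num) (by norm_num)
    (b6.mono fun d => by cases d <;> simp only [rate, cond_true, cond_false] <;> norm_num)
  obtain ⟨Λ, hΛ, hI⟩ := ((((((p6.of_renorm l6).of_swap.of_renorm l5).of_renorm l4).of_swap.of_renorm
    l3).of_renorm l2).of_swap.of_renorm l1)
  refine ⟨Λ, hΛ.trans ?_, hI⟩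
  simp only [rate, cond_true, cond_false]
  norm_num

end Chain

/-! ### The field of a one-independent model -/

theorem adj_nxt (d : Bool) (v : ℤ × ℤ) : s(v, nxt d v) ∈ squareLattice.edgeSet := by
  rw [SimpleGraph.mem_edgeSet]
  change |v.1 - (nxt d v).1| + |v.2 - (nxt d v).2| = 1
  cases d <;> simp [nxt]

/-- The edge at a site in a direction. -/
def edge (d : Bool) (v : ℤ × ℤ) : squareLattice.edgeSet := ⟨s(v, nxt d v), adj_nxt d v⟩

/-- The edges with both ends in `U`. -/
def edgesWithin (U : Set (ℤ × ℤ)) : Set squareLattice.edgeSet := {e | ∀ v ∈ (e : Sym2 (ℤ × ℤ)), v ∈ U}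

/-- The field given by a one-independent bond percolation model. -/
def ofModel {μ : Measure (Config squareLattice)} (hμ : IsOneIndependent μ) :
    RenormField μ (fun ω : Config squareLattice => openGraph ω) where
  E d v := {ω | ω (edge d v) = false}
  F U := MeasurableSpace.comap (fun ω (e : edgesWithin U) => ω e) inferInstance
  rep _ v := {v}
  F_le U := Measurable.comap_le (by fun_prop)
  F_mono U U' h := by
    have hsub : edgesWithin U ⊆ edgesWithin U' := fun e he v hv => h (he v hv)
    have hg : Measurable fun (ω : edgesWithin U' → Bool) (e : edgesWithin U) => ω ⟨e, hsub e.2⟩ := by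
      fun_prop
    rintro _ ⟨s, hs, rfl⟩
    exact ⟨_, hg hs, rfl⟩
  F_indep U U' h := by
    rw [← IndepFun_iff_Indep]
    refine hμ _ _ fun e he f hf v hve hvf => ?_
    exact Set.disjoint_left.1 h (he v hve) (hf v hvf)
  E_meas d v := by
    have he : edge d v ∈ edgesWithin {v, nxt d v} := fun u hu => Sym2.mem_iff.1 hu
    exact ⟨{x | x ⟨edge d v, he⟩ = false}, measurable_pi_apply _ (measurableSet_singleton _), rfl⟩
  rep_nonempty _ v := Set.singleton_nonempty v
  rep_disjoint _ v w h := Set.disjoint_singleton.2 h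
  rep_conn ω v := by
    rintro x rfl y rfl
    exact SimpleGraph.Reachable.refl _
  rep_link ω d v hE := by
    rintro x rfl y rfl
    refine SimpleGraph.Adj.reachable ⟨adj_nxt d x, ?_⟩
    exact Bool.eq_true_of_not_eq_false hE

/-- The initial rate is 1 − 0.8459 = 0.1541 in both directions. -/
theorem bound_ofModel {μ : Measure (Config squareLattice)} (hμ : IsModelGe squareLattice 0.8459 μ) :
    (ofModel hμ.oneIndependent).Bound (rate 1541 1541) := by
  have := hμ.isProbabilityMeasure
  intro d v
  have h := hμ.le_prob_open (edge d v)
  have hm : MeasurableSet {ω : Config squareLattice | ω (edge d v) = true} :=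
    measurable_pi_apply _ (measurableSet_singleton _)
  have hc : (ofModel hμ.oneIndependent).E d v = {ω | ω (edge d v) = true}ᶜ := by
    ext ω
    simp [ofModel]
  rw [hc, probReal_compl_eq_one_sub hm]
  cases d <;> simp only [rate, cond_true, cond_false] <;> norm_num at h ⊢ <;> linarith

end RenormField
end BondPercolation

/-! ### Conclusion -/

theorem mainTheorem7 (μ : Measure (BondPercolation.Config squareLattice))
    (hμ : BondPercolation.IsModelGe squareLattice 0.8459 μ) :
    0 < μ {ω | (BondPercolation.openCluster ω ((0, 0) : ℤ × ℤ)).Infinite} := by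
  have := hμ.isProbabilityMeasure
  obtain ⟨Λ, hΛ, hI⟩ := BondPercolation.RenormField.percolates
    (BondPercolation.RenormField.bound_ofModel hμ)
  refine pos_iff_ne_zero.2 fun h0 => ?_
  -- Off the exceptional event of measure at most 9/10 the origin lies in an infinite connected set,
  -- since it is its own representative in the initial field. If infinite clusters had probability
  -- zero, the whole space would have measure at most 9/10.
  have hsub : Set.univ ⊆ Λ ∪
      {ω | (BondPercolation.openCluster ω ((0, 0) : ℤ × ℤ)).Infinite} := by
    intro ω _
    by_cases hω : ω ∈ Λ
    · exact Or.inl hω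
    · obtain ⟨I, h1, h2, h3⟩ := hI ω hω
      refine Or.inr (h1.mono fun x hx => ?_)
      exact SimpleGraph.ConnectedComponent.sound (h3 x hx _ (h2 rfl))
  have h1 := (measureReal_mono (μ := μ) hsub).trans (measureReal_union_le _ _)
  have h2 : μ.real {ω | (BondPercolation.openCluster ω ((0, 0) : ℤ × ℤ)).Infinite} = 0 := by
    rw [measureReal_def, h0, ENNReal.toReal_zero]
  rw [h2, probReal_univ] at h1
  linarith
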